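/- Let $(\Omega,\mathcal A,\mu)$ be a probability space and let $T=(T_{i,j})_{(i,j)\in\mathbb Z^2}$ be an ergodic measure preserving action of $\mathbb Z^2$ on it. Let $(\mathcal F_{i,j})_{i,j\in\mathbb Z}$ be a completely commuting invariant filtration, that is, a family of sub-$\sigma$-algebras of $\mathcal A$ such that, for all $i,j,i',j'\in\mathbb Z$, (i) $\mathcal F_{i,j}=T_{-i,-j}\mathcal F_{0,0}$; (ii) $\mathbb E[\mathbb E[g\mid\mathcal F_{i,j}]\mid\mathcal F_{i',j'}]=\mathbb E[g\mid\mathcal F_{\min(i,i'),\min(j,j')}]$ almost surely, for every integrable $g:\Omega\to\mathbb R$. Put $\mathcal F_{\infty,j}=\bigvee_{i\in\mathbb Z}\mathcal F_{i,j}$, $\mathcal F_{i,\infty}=\bigvee_{j\in\mathbb Z}\mathcal F_{i,j}$, $\mathcal F_{\infty,\infty}=\bigvee_{i,j\in\mathbb Z}\mathcal F_{i,j}$, and assume that $\mathcal F_{\infty,\infty}=\mathcal A$ up to $\mu$-null sets. Let $\mathcal I_1$ and $\mathcal I_2$ be the $\sigma$-algebras of the sets in $\mathcal A$ that are invariant under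 $T_{1,0}$ and under $T_{0,1}$, respectively, and let $\mathcal I=\mathcal I_1\vee\mathcal I_2$. Let $f\in\mathbb L^2(\Omega,\mathcal F_{0,0},\mu)$ be a real-valued martingale difference, that is, $$\mathbb E[f\mid\mathcal F_{-1,\infty}]=\mathbb E[f\mid\mathcal F_{\infty,-1}]=0\quad\text{almost surely}.$$ Suppose that $f$ is orthogonal to $\mathbb L^2(\mathcal I)$ (that is, $\mathbb E[fg]=0$ for every $g\in\mathbb L^2(\mathcal I)$), that $f\in\mathbb L^4$, and that $$\lim_{\ell\to\infty}\bigl\|\mathbb E[f\mid\mathcal F_{\infty,-\ell}\vee\mathcal I_1]\bigr\|_2=0 .$$ Then, as $\min\{m,n\}\to\infty$, the random variables $$\frac1{\sqrt{mn}}\sum_{i=1}^m\sum_{j=1}^n f\circ T_{i,j}$$ converge in distribution to the centered normal law $N(0,\mathbb E[f^2])$ with variance $\mathbb E[f^2]$ (the Dirac mass at $0$ if $\mathbb E[f^2]=0$). -/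

import Mathlib

open MeasureTheory ProbabilityTheory Filter
open scoped Topology ENNReal

namespace MartingaleField

section

variable {Ω : Type*}

/-- The `ℤ²`-action is written additively: `act i j` is the transformation `T_{i,j}`. -/
def act [AddAction (ℤ × ℤ) Ω] (i j : ℤ) (ω : Ω) : Ω := ((i, j) : ℤ × ℤ) +ᵥ ω

/-- `F_{∞,j}`, the σ-algebra generated by the `F_{i,j}`, `i ∈ ℤ`. -/
abbrev rowLimit (F : ℤ → ℤ → MeasurableSpace Ω) (j : ℤ) : MeasurableSpace Ω := ⨆ i, F i j

/-- `F_{i,∞}`, the σ-algebra generated by the `F_{i,j}`, `j ∈ ℤ`. -/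
abbrev colLimit (F : ℤ → ℤ → MeasurableSpace Ω) (i : ℤ) : MeasurableSpace Ω := ⨆ j, F i j

/-- `F_{∞,∞}`, the σ-algebra generated by all the `F_{i,j}`. -/
abbrev totalLimit (F : ℤ → ℤ → MeasurableSpace Ω) : MeasurableSpace Ω := ⨆ i, ⨆ j, F i j

/-- `I₁`, the σ-algebra of `T_{1,0}`-invariant measurable sets. -/
abbrev inv₁ [MeasurableSpace Ω] [AddAction (ℤ × ℤ) Ω] : MeasurableSpace Ω :=
  MeasurableSpace.invariants (act (Ω := Ω) 1 0)

/-- `I₂`, the σ-algebra of `T_{0,1}`-invariant measurable sets. -/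
abbrev inv₂ [MeasurableSpace Ω] [AddAction (ℤ × ℤ) Ω] : MeasurableSpace Ω :=
  MeasurableSpace.invariants (act (Ω := Ω) 0 1)

/-- The product type factor `I = I₁ ∨ I₂`. -/
abbrev prodFactor [MeasurableSpace Ω] [AddAction (ℤ × ℤ) Ω] : MeasurableSpace Ω :=
  inv₁ ⊔ inv₂

/-- Completely commuting invariant filtration indexed by `ℤ²`. Since `T_{i,j}` is invertible with
inverse `T_{-i,-j}`, the family of images `T_{-i,-j} A`, `A ∈ F_{0,0}`, is the family of preimages
of such `A` under `T_{i,j}`. -/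
structure IsCompletelyCommutingInvariant [mΩ : MeasurableSpace Ω] [AddAction (ℤ × ℤ) Ω]
    (μ : Measure Ω) (F : ℤ → ℤ → MeasurableSpace Ω) : Prop where
  le : ∀ i j, F i j ≤ mΩ
  invariant : ∀ i j, F i j = (F 0 0).comap (act i j)
  commute : ∀ i j i' j' : ℤ, ∀ g : Ω → ℝ, Integrable g μ →
    μ[μ[g | F i j] | F i' j'] =ᵐ[μ] μ[g | F (min i i') (min j j')]

/-- `f` is a (square integrable) martingale difference adapted to the filtration `F`. -/
structure IsMartingaleDifference [mΩ : MeasurableSpace Ω]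
    (μ : Measure Ω) (F : ℤ → ℤ → MeasurableSpace Ω) (f : Ω → ℝ) : Prop where
  memLp : MemLp f 2 μ
  adapted : AEStronglyMeasurable[F 0 0] f μ
  condExp_col : μ[f | colLimit F (-1)] =ᵐ[μ] 0
  condExp_row : μ[f | rowLimit F (-1)] =ᵐ[μ] 0

/-- `f` is orthogonal to `L²(m)`. -/
def OrthogonalTo [MeasurableSpace Ω] (μ : Measure Ω) (m : MeasurableSpace Ω) (f : Ω → ℝ) : Prop :=
  ∀ g : Ω → ℝ, AEStronglyMeasurable[m] g μ → MemLp g 2 μ → ∫ ω, f ω * g ω ∂μ = 0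

/-- `(mn)^{-1/2} ∑_{i=1}^m ∑_{j=1}^n f ∘ T_{i,j}`. -/
noncomputable def normalizedSum [AddAction (ℤ × ℤ) Ω] (f : Ω → ℝ) (m n : ℕ) (ω : Ω) : ℝ :=
  (1 / Real.sqrt ((m : ℝ) * (n : ℝ))) *
    ∑ i ∈ Finset.Icc 1 m, ∑ j ∈ Finset.Icc 1 n, f (act (i : ℤ) (j : ℤ) ω)

end

end MartingaleField

/-!
The normalized sum is, up to a translation, the sum over `i < m` of the columns
`(mn)^{-1/2} ∑_{p=1}^n f ∘ T_{i,-p}`, which form a martingale difference sequence for the σ-algebras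
`F_{i-1,∞}`. A quantitative martingale central limit theorem
(`exists_norm_integral_exp_sub_le`, proved with a stopped exponential martingale) reduces the claim
to two facts: the third absolute moments of the columns have a small sum, and the quadratic
variation converges to `E f²` in `L¹`. The first one follows from the bound
`E (∑_{p ≤ k} g ∘ V^p)⁴ ≤ 16 k² E g⁴` for martingale differences along `V = T_{0,-1}`
(`RowDiff.integral_vSum_pow_four_le`).

For the quadratic variation (`exists_forall_integral_abs_quadratic_le`), the squares of the column
sums are expanded. The diagonal terms form an ergodic average of `f²`, which converges by the mean
ergodic theorem for two commuting transformations. The off-diagonal terms are a sum of orthogonal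
innovations `f · ∑_{p ≤ k} f ∘ V^p`, averaged over `U = T_{1,0}`, so everything depends on showing
that the averages over `m` translates of such an innovation have variance `o(k)`
(`exists_forall_integral_sq_innovAvg_le`). For fixed `m` and `k → ∞` the normalized variance
converges to a Fejér mean of the numbers `β_r = ‖E[f ∘ U^r · f | V-invariant sets]‖²`, because the
remaining cross terms are bounded and asymptotically orthogonal to one another, and hence tend to
zero weakly.

It remains to see that `(1/m) ∑_{r < m} β_r → 0` (`tendsto_avg_integral_sq_relExp`); this is where
the tail condition enters. After truncation, the average is the matrix coefficient `⟨f, K f⟩` of a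
positive operator `K = K_m`, `K φ = (1/m) ∑_i ψ_i E[ψ_i φ | V-invariant sets]`, `ψ_i = ψ ∘ U^i`.
By the abstract mean ergodic theorem `K` hardly depends on the window of translates used to define
it, hence almost commutes with `U`. The coefficient `⟨f, K³ θ⟩` is a limit of averages over `j` of
`E[f · θ ∘ V^j · κ_j]`, with kernels `κ_j` that are therefore uniformly close to `U`-invariant
functions; the tail condition makes these integrals small. Positivity of `K` then passes from `K³`
to `K`.
-/

namespace MartingaleField

/-! ### Square integrable functions and the mean ergodic theorem -/

section MeanErgodic

variable {Ω : Type*} [mΩ : MeasurableSpace Ω] {μ : Measure Ω}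

lemma memLp_fun_add {f g : Ω → ℝ} {p : ℝ≥0∞} (hf : MemLp f p μ) (hg : MemLp g p μ) :
    MemLp (fun ω => f ω + g ω) p μ := hf.add hg

lemma memLp_fun_sub {f g : Ω → ℝ} {p : ℝ≥0∞} (hf : MemLp f p μ) (hg : MemLp g p μ) :
    MemLp (fun ω => f ω - g ω) p μ := hf.sub hg

lemma integrable_mul_of_memLp_two {f g : Ω → ℝ} (hf : MemLp f 2 μ) (hg : MemLp g 2 μ) :
    Integrable (fun ω => f ω * g ω) μ := hf.integrable_mul hg

/-- The Cauchy–Schwarz inequality for square integrable functions, without square roots. -/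
lemma sq_integral_mul_le {f g : Ω → ℝ} (hf : MemLp f 2 μ) (hg : MemLp g 2 μ) :
    (∫ ω, f ω * g ω ∂μ) ^ 2 ≤ (∫ ω, f ω ^ 2 ∂μ) * ∫ ω, g ω ^ 2 ∂μ := by
  have key : ∀ s : ℝ, 0 ≤ (∫ ω, g ω ^ 2 ∂μ) * (s * s) + (-2 * ∫ ω, f ω * g ω ∂μ) * s
      + ∫ ω, f ω ^ 2 ∂μ := by
    intro s
    have h : 0 ≤ ∫ ω, (f ω - s * g ω) ^ 2 ∂μ := integral_nonneg fun ω => sq_nonneg _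
    have h2 : ∫ ω, (f ω - s * g ω) ^ 2 ∂μ
        = ∫ ω, (f ω ^ 2 + ((-2 * s) * (f ω * g ω) + s ^ 2 * g ω ^ 2)) ∂μ := by
      congr 1; ext ω; ring
    have i1 := hf.integrable_sq
    have i2 := hg.integrable_sq.const_mul (s ^ 2)
    have i3 := (integrable_mul_of_memLp_two hf hg).const_mul (-2 * s)
    rw [h2, integral_add i1 (i3.fun_add i2), integral_add i3 i2, integral_const_mul,
      integral_const_mul] at h
    linarith
  have := discrim_le_zero key
  unfold discrim at this
  nlinarith

lemma memLp_comp {T : Ω → Ω} (hT : MeasurePreserving T μ μ) {g : Ω → ℝ} {p : ℝ≥0∞}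
    (hg : MemLp g p μ) : MemLp (fun ω => g (T ω)) p μ := hg.comp_measurePreserving hT

lemma integral_comp' {T : Ω → Ω} (hT : MeasurePreserving T μ μ) {g : Ω → ℝ}
    (hg : AEStronglyMeasurable g μ) : ∫ ω, g (T ω) ∂μ = ∫ ω, g ω ∂μ := by
  conv_rhs => rw [← hT.map_eq]
  rw [integral_map hT.aemeasurable (by rwa [hT.map_eq])]

/-- A function that is almost surely invariant under `T` agrees almost surely with a strictly
invariant one, namely with its upper limit along orbits. -/
lemma aestronglyMeasurable_invariants {T : Ω → Ω} (hT : MeasurePreserving T μ μ) {g : Ω → ℝ}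
    (hg : AEStronglyMeasurable g μ) (h : (fun ω => g (T ω)) =ᵐ[μ] g) :
    AEStronglyMeasurable[MeasurableSpace.invariants T] g μ := by
  obtain ⟨g', hg', hgg'⟩ := hg
  have h' : (fun ω => g' (T ω)) =ᵐ[μ] g' :=
    ((hT.quasiMeasurePreserving.ae_eq_comp hgg').symm.trans h).trans hgg'
  have hn : ∀ n : ℕ, (fun ω => g' (T^[n] ω)) =ᵐ[μ] g' := by
    intro n
    induction n with
    | zero => rfl
    | succ n ih =>
      exact (hT.quasiMeasurePreserving.ae_eq_comp ih).trans h'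
  let u : Ω → ℝ := fun ω => limsup (fun n : ℕ => g' (T^[n] ω)) atTop
  have hu : Measurable u :=
    Measurable.limsup fun n => hg'.measurable.comp (hT.measurable.iterate n)
  have huT : ∀ ω, u (T ω) = u ω := by
    intro ω
    change limsup (fun n : ℕ => g' (T^[n + 1] ω)) atTop = _
    change limsup ((fun n : ℕ => g' (T^[n] ω)) ∘ fun n => n + 1) atTop = _
    rw [Filter.limsup_comp, Filter.map_add_atTop_eq_nat]
  refine ⟨u, ?_, ?_⟩
  · refine Measurable.stronglyMeasurable ?_
    rw [MeasurableSpace.measurable_invariants_dom]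
    refine ⟨hu, fun s _ => ?_⟩
    ext ω
    simp [huT]
  · refine hgg'.trans ?_
    filter_upwards [ae_all_iff.2 hn] with ω hω
    simp [u, hω]

lemma comp_eq_of_stronglyMeasurable_invariants {T : Ω → Ω} {g : Ω → ℝ}
    (hg : StronglyMeasurable[MeasurableSpace.invariants T] g) (ω : Ω) : g (T ω) = g ω :=
  congrFun (MeasurableSpace.comp_eq_of_measurable_invariants hg.measurable) ω

lemma condExp_invariants_iterate {T : Ω → Ω} (g : Ω → ℝ) (j : ℕ) (ω : Ω) :
    (μ[g | MeasurableSpace.invariants T]) (T^[j] ω) = (μ[g | MeasurableSpace.invariants T]) ω := by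
  induction j generalizing ω with
  | zero => rfl
  | succ j ih =>
    rw [Function.iterate_succ_apply, ih]
    exact comp_eq_of_stronglyMeasurable_invariants stronglyMeasurable_condExp ω

lemma integral_sq_eq_norm_toLp {g : Ω → ℝ} (hg : MemLp g 2 μ) :
    ∫ ω, g ω ^ 2 ∂μ = ‖hg.toLp g‖ ^ 2 := by
  rw [← real_inner_self_eq_norm_sq, L2.inner_def]
  refine integral_congr_ae ?_
  filter_upwards [hg.coeFn_toLp] with ω hω
  simp [hω, sq]

lemma memLp_avg {T : Ω → Ω} (hT : MeasurePreserving T μ μ) {g : Ω → ℝ} {p : ℝ≥0∞}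
    (hg : MemLp g p μ) (n : ℕ) :
    MemLp (fun ω => (n : ℝ)⁻¹ * ∑ k ∈ Finset.range n, g (T^[k] ω)) p μ :=
  (memLp_finsetSum _ fun k _ => memLp_comp (hT.iterate k) hg).const_mul _

variable [IsProbabilityMeasure μ]

/-- Von Neumann's mean ergodic theorem: the ergodic averages of a square integrable function
converge in `L²` to its conditional expectation on the invariant σ-algebra. -/
theorem tendsto_integral_sq_avg_sub_condExp {T : Ω → Ω} (hT : MeasurePreserving T μ μ) {g : Ω → ℝ}
    (hg : MemLp g 2 μ) :
    Tendsto (fun n : ℕ => ∫ ω, ((n : ℝ)⁻¹ * ∑ k ∈ Finset.range n, g (T^[k] ω)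
      - (μ[g | MeasurableSpace.invariants T]) ω) ^ 2 ∂μ) atTop (𝓝 0) := by
  have hm : MeasurableSpace.invariants T ≤ mΩ := MeasurableSpace.invariants_le T
  have : Fact (MeasurableSpace.invariants T ≤ mΩ) := ⟨hm⟩
  let U : Lp ℝ 2 μ →L[ℝ] Lp ℝ 2 μ :=
    (Lp.compMeasurePreservingₗᵢ ℝ T hT).toContinuousLinearMap
  have hU : ∀ x, U x = Lp.compMeasurePreserving T hT x := fun x => rfl
  have hUn : ‖U‖ ≤ 1 := LinearIsometry.norm_toContinuousLinearMap_le _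
  have hfix : U.eqLocus (1 : Lp ℝ 2 μ →L[ℝ] Lp ℝ 2 μ)
      = lpMeas ℝ ℝ (MeasurableSpace.invariants T) 2 μ := by
    ext x
    rw [mem_lpMeas_iff_aestronglyMeasurable]
    have hx : x ∈ U.eqLocus (1 : Lp ℝ 2 μ →L[ℝ] Lp ℝ 2 μ) ↔ U x = x := by simp
    rw [hx, hU]
    constructor
    · intro h
      refine aestronglyMeasurable_invariants hT (Lp.aestronglyMeasurable x) ?_
      have := Lp.coeFn_compMeasurePreserving x hT
      rw [h] at this
      exact this.symm
    · rintro ⟨y, hy, hxy⟩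
      refine Lp.ext ?_
      refine (Lp.coeFn_compMeasurePreserving x hT).trans ?_
      refine (hT.quasiMeasurePreserving.ae_eq_comp hxy).trans (EventuallyEq.trans ?_ hxy.symm)
      exact Eventually.of_forall fun ω => comp_eq_of_stronglyMeasurable_invariants hy ω
  have hproj : ∀ (K : Submodule ℝ (Lp ℝ 2 μ)) [K.HasOrthogonalProjection],
      K = lpMeas ℝ ℝ (MeasurableSpace.invariants T) 2 μ → ∀ x,
      (K.orthogonalProjectionOnto x : Lp ℝ 2 μ) = condExpL2 ℝ ℝ hm x := by
    rintro K _ rfl x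
    rfl
  have key := U.tendsto_birkhoffAverage_orthogonalProjection hUn (hg.toLp g)
  rw [hproj _ hfix] at key
  have hiter : ∀ k : ℕ, (U^[k] (hg.toLp g))
      = (memLp_comp (hT.iterate k) hg).toLp (fun ω => g (T^[k] ω)) := by
    intro k
    induction k with
    | zero => rfl
    | succ k ih =>
      rw [Function.iterate_succ_apply', ih, hU, Lp.toLp_compMeasurePreserving]
      rfl
  have hce : MemLp (μ[g | MeasurableSpace.invariants T]) 2 μ := hg.condExp one_le_two
  have hEq : ∀ n : ℕ, birkhoffAverage ℝ U _root_.id n (hg.toLp g)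
      - (condExpL2 ℝ ℝ hm (hg.toLp g) : Lp ℝ 2 μ)
      = ((memLp_avg hT hg n).sub hce).toLp _ := by
    intro n
    have e1 : birkhoffAverage ℝ U _root_.id n (hg.toLp g) = (memLp_avg hT hg n).toLp _ := by
      simp only [birkhoffAverage, birkhoffSum, _root_.id, hiter]
      refine Lp.ext ?_
      refine (Lp.coeFn_smul _ _).trans ?_
      refine EventuallyEq.trans ?_ (memLp_avg hT hg n).coeFn_toLp.symm
      have hsum : (⇑(∑ k ∈ Finset.range n,
          (memLp_comp (hT.iterate k) hg).toLp (fun ω => g (T^[k] ω))) : Ω → ℝ)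
          =ᵐ[μ] fun ω => ∑ k ∈ Finset.range n, g (T^[k] ω) := by
        have h1 : ∀ᵐ ω ∂μ, ∀ k : ℕ, (memLp_comp (hT.iterate k) hg).toLp
            (fun ω => g (T^[k] ω)) ω = g (T^[k] ω) :=
          ae_all_iff.2 fun k => (memLp_comp (hT.iterate k) hg).coeFn_toLp
        filter_upwards [h1, Lp.coeFn_finsetSum (Finset.range n) (fun k =>
          (memLp_comp (hT.iterate k) hg).toLp (fun ω => g (T^[k] ω)))] with ω h2 h3
        rw [h3]
        simp [h2]
      filter_upwards [hsum] with ω hω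
      rw [Pi.smul_apply, hω, smul_eq_mul]
    rw [e1, MemLp.toLp_sub (memLp_avg hT hg n) hce]
    congr 1
    refine Lp.ext ?_
    refine (hg.condExpL2_ae_eq_condExp hm).trans hce.coeFn_toLp.symm
  have h2 : Tendsto (fun n : ℕ => ‖birkhoffAverage ℝ U _root_.id n (hg.toLp g)
      - (condExpL2 ℝ ℝ hm (hg.toLp g) : Lp ℝ 2 μ)‖ ^ 2) atTop (𝓝 0) := by
    have := (tendsto_iff_norm_sub_tendsto_zero.1 key).pow 2
    simpa using this
  refine h2.congr fun n => ?_
  rw [hEq, ← integral_sq_eq_norm_toLp]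
  rfl

lemma integral_condExp_mul_condExp {m : MeasurableSpace Ω} (hm : m ≤ mΩ) {x y : Ω → ℝ}
    (hx : MemLp x 2 μ) (hy : MemLp y 2 μ) :
    ∫ ω, x ω * (μ[y | m]) ω ∂μ = ∫ ω, (μ[x | m]) ω * (μ[y | m]) ω ∂μ := by
  have h : μ[x * μ[y | m] | m] =ᵐ[μ] μ[x | m] * μ[y | m] :=
    condExp_mul_of_stronglyMeasurable_right stronglyMeasurable_condExp
      (hx.integrable_mul (hy.condExp one_le_two)) (hx.integrable one_le_two)
  rw [← integral_condExp hm]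
  exact integral_congr_ae h

/-- Weak form of the mean ergodic theorem. -/
theorem tendsto_avg_integral_mul_comp {T : Ω → Ω} (hT : MeasurePreserving T μ μ) {x y : Ω → ℝ}
    (hx : MemLp x 2 μ) (hy : MemLp y 2 μ) :
    Tendsto (fun n : ℕ => (n : ℝ)⁻¹ * ∑ k ∈ Finset.range n, ∫ ω, x ω * y (T^[k] ω) ∂μ) atTop
      (𝓝 (∫ ω, x ω * (μ[y | MeasurableSpace.invariants T]) ω ∂μ)) := by
  have hce : MemLp (μ[y | MeasurableSpace.invariants T]) 2 μ := hy.condExp one_le_two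
  rw [tendsto_iff_norm_sub_tendsto_zero]
  have hb : Tendsto (fun n : ℕ => √((∫ ω, x ω ^ 2 ∂μ) *
      ∫ ω, ((n : ℝ)⁻¹ * ∑ k ∈ Finset.range n, y (T^[k] ω)
      - (μ[y | MeasurableSpace.invariants T]) ω) ^ 2 ∂μ)) atTop (𝓝 0) := by
    have := ((tendsto_integral_sq_avg_sub_condExp hT hy).const_mul (∫ ω, x ω ^ 2 ∂μ)).sqrt
    simpa using this
  refine squeeze_zero (fun n => norm_nonneg _) (fun n => ?_) hb
  rw [Real.norm_eq_abs]
  refine Real.abs_le_sqrt ?_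
  refine le_trans (le_of_eq ?_) (sq_integral_mul_le hx ((memLp_avg hT hy n).sub hce))
  congr 1
  have i1 : ∀ k, Integrable (fun ω => x ω * y (T^[k] ω)) μ := fun k =>
    integrable_mul_of_memLp_two hx (memLp_comp (hT.iterate k) hy)
  rw [← integral_finsetSum _ (fun k _ => i1 k), ← integral_const_mul,
    ← integral_sub ((integrable_finsetSum _ (fun k _ => i1 k)).const_mul _)
      (integrable_mul_of_memLp_two hx hce)]
  refine integral_congr_ae (Eventually.of_forall fun ω => ?_)
  simp only [mul_sub, Finset.mul_sum]
  congr 1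
  exact Finset.sum_congr rfl fun k _ => by ring

/-- Conditioning on the invariant sets of `V` commutes with composition with a transformation
that commutes with `V`. -/
theorem condExp_invariants_comp_comm {U V : Ω → Ω} (hU : MeasurePreserving U μ μ)
    (hV : MeasurePreserving V μ μ) (hUV : Function.Commute U V) {g : Ω → ℝ} (hg : MemLp g 2 μ) :
    (fun ω => (μ[g | MeasurableSpace.invariants V]) (U ω))
      =ᵐ[μ] μ[fun ω => g (U ω) | MeasurableSpace.invariants V] := by
  have hgU := memLp_comp hU hg
  have hc : MemLp (μ[g | MeasurableSpace.invariants V]) 2 μ := hg.condExp one_le_two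
  have hc' : MemLp (μ[fun ω => g (U ω) | MeasurableSpace.invariants V]) 2 μ :=
    hgU.condExp one_le_two
  have hcU := memLp_comp hU hc
  have key : ∫ ω, ((μ[g | MeasurableSpace.invariants V]) (U ω)
      - (μ[fun ω => g (U ω) | MeasurableSpace.invariants V]) ω) ^ 2 ∂μ ≤ 0 := by
    have h1 := tendsto_integral_sq_avg_sub_condExp hV hg
    have h2 := tendsto_integral_sq_avg_sub_condExp hV hgU
    have h3 := (h1.const_mul 2).add (h2.const_mul 2)
    simp only [mul_zero, add_zero] at h3
    refine ge_of_tendsto' h3 fun n => ?_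
    have m1 := memLp_fun_sub (memLp_avg hV hg n) hc
    have m2 := memLp_fun_sub (memLp_avg hV hgU n) hc'
    rw [← integral_comp' hU m1.integrable_sq.aestronglyMeasurable, ← integral_const_mul,
      ← integral_const_mul,
      ← integral_add ((memLp_comp hU m1).integrable_sq.const_mul 2) (m2.integrable_sq.const_mul 2)]
    refine integral_mono (memLp_fun_sub hcU hc').integrable_sq
      (((memLp_comp hU m1).integrable_sq.const_mul 2).add (m2.integrable_sq.const_mul 2))
      fun ω => ?_
    have e : ∀ k, V^[k] (U ω) = U (V^[k] ω) := fun k => ((hUV.iterate_right k) ω).symm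
    simp only [e]
    generalize (n : ℝ)⁻¹ * ∑ k ∈ Finset.range n, g (U (V^[k] ω)) = s
    nlinarith [sq_nonneg ((s - (μ[g | MeasurableSpace.invariants V]) (U ω))
      + (s - (μ[fun ω => g (U ω) | MeasurableSpace.invariants V]) ω))]
  have h0 := le_antisymm key (integral_nonneg fun ω => sq_nonneg _)
  rw [integral_eq_zero_iff_of_nonneg (fun ω => sq_nonneg _)
    (memLp_fun_sub hcU hc').integrable_sq] at h0
  filter_upwards [h0] with ω hω
  exact sub_eq_zero.1 (pow_eq_zero_iff two_ne_zero |>.1 hω)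

end MeanErgodic

/-! ### Averages of a contraction in a space with a semi-inner product -/

section Averages

variable {X : Type*} [SeminormedAddCommGroup X]

/-- The operator `m⁻¹ ∑_{i < m} Uⁱ` (which is `0` for `m = 0`). -/
noncomputable def opAvg [NormedSpace ℝ X] (U : X →ₗ[ℝ] X) (m : ℕ) : X →ₗ[ℝ] X :=
  (m : ℝ)⁻¹ • ∑ i ∈ Finset.range m, U ^ i

section NormedSpace

variable [NormedSpace ℝ X] {U : X →ₗ[ℝ] X}

lemma opAvg_apply (m : ℕ) (x : X) :
    opAvg U m x = (m : ℝ)⁻¹ • ∑ i ∈ Finset.range m, (U ^ i) x := by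
  simp [opAvg]

lemma norm_pow_apply_le (hU : ∀ x, ‖U x‖ ≤ ‖x‖) (i : ℕ) (x : X) : ‖(U ^ i) x‖ ≤ ‖x‖ := by
  induction i with
  | zero => simp
  | succ i ih => rw [pow_succ']; exact (hU _).trans ih

lemma norm_opAvg_le (hU : ∀ x, ‖U x‖ ≤ ‖x‖) (m : ℕ) (x : X) : ‖opAvg U m x‖ ≤ ‖x‖ := by
  rcases Nat.eq_zero_or_pos m with rfl | hm
  · simp [opAvg]
  have hm' : (0 : ℝ) < m := by exact_mod_cast hm
  rw [opAvg_apply, norm_smul, norm_inv, Real.norm_natCast, inv_mul_le_iff₀ hm']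
  refine (norm_sum_le _ _).trans ((Finset.sum_le_card_nsmul _ _ ‖x‖
    fun i _ => norm_pow_apply_le hU i x).trans ?_)
  simp

lemma opAvg_comm_pow (m r : ℕ) (x : X) : opAvg U m ((U ^ r) x) = (U ^ r) (opAvg U m x) := by
  simp only [opAvg_apply, map_smul, map_sum]
  congr 1
  refine Finset.sum_congr rfl fun i _ => ?_
  rw [← Module.End.mul_apply, ← Module.End.mul_apply, ← pow_add, ← pow_add, add_comm]

lemma opAvg_comm (m n : ℕ) (x : X) : opAvg U m (opAvg U n x) = opAvg U n (opAvg U m x) := by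
  conv_lhs => rw [opAvg_apply n]
  conv_rhs => rw [opAvg_apply n]
  simp only [map_smul, map_sum, opAvg_comm_pow]

lemma norm_opAvg_sub_pow_le (hU : ∀ x, ‖U x‖ ≤ ‖x‖) (m r : ℕ) (x : X) :
    ‖opAvg U m x - (U ^ r) (opAvg U m x)‖ ≤ 2 * r / m * ‖x‖ := by
  have h1 : ‖opAvg U m x - U (opAvg U m x)‖ ≤ 2 / m * ‖x‖ := by
    have e : opAvg U m x - U (opAvg U m x) = (m : ℝ)⁻¹ • (x - (U ^ m) x) := by
      have := Finset.sum_range_sub' (fun i => (U ^ i) x) m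
      simp only [pow_zero, Module.End.one_apply] at this
      rw [← this, opAvg_apply, map_smul, map_sum, ← smul_sub, ← Finset.sum_sub_distrib]
      simp only [pow_succ', Module.End.mul_apply]
    rw [e, norm_smul, norm_inv, Real.norm_natCast]
    have h2 : ‖x - (U ^ m) x‖ ≤ 2 * ‖x‖ := by
      have := norm_sub_le x ((U ^ m) x)
      linarith [norm_pow_apply_le hU m x]
    calc (m : ℝ)⁻¹ * ‖x - (U ^ m) x‖ ≤ (m : ℝ)⁻¹ * (2 * ‖x‖) := by gcongr
      _ = 2 / m * ‖x‖ := by ring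
  induction r with
  | zero => simp
  | succ r ih =>
    have e : opAvg U m x - (U ^ (r + 1)) (opAvg U m x)
        = (opAvg U m x - (U ^ r) (opAvg U m x))
          + (U ^ r) (opAvg U m x - U (opAvg U m x)) := by
      rw [map_sub, pow_succ, Module.End.mul_apply]; abel
    rw [e]
    refine (norm_add_le _ _).trans ?_
    have h3 := (norm_pow_apply_le hU r (opAvg U m x - U (opAvg U m x))).trans h1
    push_cast
    calc _ ≤ 2 * (r : ℝ) / m * ‖x‖ + 2 / m * ‖x‖ := add_le_add ih h3
      _ = _ := by ring

lemma norm_opAvg_sub_opAvg_opAvg_le (hU : ∀ x, ‖U x‖ ≤ ‖x‖) {m : ℕ} (hm : 0 < m) (M : ℕ) (x : X) :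
    ‖opAvg U M x - opAvg U m (opAvg U M x)‖ ≤ 2 * m / M * ‖x‖ := by
  have hm' : (0 : ℝ) < m := by exact_mod_cast hm
  have e : opAvg U M x - opAvg U m (opAvg U M x)
      = (m : ℝ)⁻¹ • ∑ i ∈ Finset.range m, (opAvg U M x - (U ^ i) (opAvg U M x)) := by
    rw [Finset.sum_sub_distrib, smul_sub, ← opAvg_apply]
    simp only [Finset.sum_const, Finset.card_range]
    rw [← Nat.cast_smul_eq_nsmul ℝ, smul_smul, inv_mul_cancel₀ hm'.ne', one_smul]
  rw [e, norm_smul, norm_inv, Real.norm_natCast, inv_mul_le_iff₀ hm']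
  refine (norm_sum_le _ _).trans ((Finset.sum_le_card_nsmul _ _ (2 * m / M * ‖x‖)
    fun i hi => (norm_opAvg_sub_pow_le hU M i x).trans ?_).trans ?_)
  · have : (i : ℝ) ≤ m := by exact_mod_cast (Finset.mem_range.1 hi).le
    gcongr
  · simp

/-- Long averages are not much larger than short ones. -/
lemma norm_opAvg_le_add (hU : ∀ x, ‖U x‖ ≤ ‖x‖) {m : ℕ} (hm : 0 < m) (M : ℕ) (x : X) :
    ‖opAvg U M x‖ ≤ ‖opAvg U m x‖ + 2 * m / M * ‖x‖ := by
  have h1 := norm_opAvg_sub_opAvg_opAvg_le hU hm M x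
  have h2 : ‖opAvg U m (opAvg U M x)‖ ≤ ‖opAvg U m x‖ := by
    rw [opAvg_comm]; exact norm_opAvg_le hU M _
  have h3 := norm_le_norm_add_norm_sub (opAvg U m (opAvg U M x)) (opAvg U M x)
  rw [norm_sub_rev] at h3
  linarith

end NormedSpace

/-- Averages over long intervals are almost invariant under arbitrary powers of the contraction,
uniformly in the power. -/
theorem exists_forall_norm_opAvg_sub_pow_le [InnerProductSpace ℝ X] {U : X →ₗ[ℝ] X}
    (hU : ∀ x, ‖U x‖ ≤ ‖x‖) (x : X) {ε : ℝ} (hε : 0 < ε) :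
    ∃ m₀ : ℕ, 0 < m₀ ∧ ∀ m, m₀ ≤ m → ∀ r : ℕ,
      ‖opAvg U m x - (U ^ r) (opAvg U m x)‖ ^ 2 ≤ ε := by
  set d : ℝ := ⨅ n : ℕ, ‖opAvg U (n + 1) x‖ with hd
  have hbdd : BddBelow (Set.range fun n : ℕ => ‖opAvg U (n + 1) x‖) :=
    ⟨0, by rintro _ ⟨n, rfl⟩; exact norm_nonneg _⟩
  have hd0 : 0 ≤ d := Real.iInf_nonneg fun n => norm_nonneg _
  have hdle : ∀ n, 0 < n → d ≤ ‖opAvg U n x‖ := by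
    intro n hn
    obtain ⟨k, rfl⟩ := Nat.exists_eq_succ_of_ne_zero hn.ne'
    exact ciInf_le hbdd k
  -- The norms of the averages converge to their infimum.
  have hlim : ∀ δ > 0, ∃ m₀ : ℕ, 0 < m₀ ∧ ∀ m, m₀ ≤ m → ‖opAvg U m x‖ ≤ d + δ := by
    intro δ hδ
    obtain ⟨n, hn⟩ := exists_lt_of_ciInf_lt (show d < d + δ / 2 by linarith)
    obtain ⟨N, hN⟩ := exists_nat_gt (2 * ((n : ℝ) + 1) * ‖x‖ / (δ / 2))
    refine ⟨N + 1, Nat.succ_pos _, fun m hm => ?_⟩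
    have h1 := norm_opAvg_le_add hU (Nat.succ_pos n) m x
    have hNm : (N : ℝ) < m := by exact_mod_cast hm
    have hm0 : (0 : ℝ) < m := lt_of_le_of_lt (Nat.cast_nonneg N) hNm
    have h2 : 2 * ((n + 1 : ℕ) : ℝ) / m * ‖x‖ ≤ δ / 2 := by
      rw [div_lt_iff₀ (by linarith)] at hN
      rw [div_mul_eq_mul_div, div_le_iff₀ hm0]
      push_cast
      nlinarith
    simp only [Nat.succ_eq_add_one] at h1
    linarith
  -- Averaging once more shows that the midpoint of two averages has norm at least `d`.
  have hmid : ∀ m, 0 < m → ∀ r : ℕ, 2 * d ≤ ‖opAvg U m x + (U ^ r) (opAvg U m x)‖ := by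
    intro m hm r
    refine le_of_forall_pos_le_add fun δ hδ => ?_
    obtain ⟨N, hN⟩ := exists_nat_gt ((4 * (m : ℝ) + 2 * r) * ‖x‖ / δ)
    have hN0 : (0 : ℝ) < N := lt_of_le_of_lt (by positivity) hN
    have hNpos : 0 < N := by exact_mod_cast hN0
    set y := opAvg U m x + (U ^ r) (opAvg U m x) with hy
    have h1 := norm_opAvg_le hU N y
    have h2 := norm_opAvg_sub_opAvg_opAvg_le hU hm N x
    have h3 := norm_opAvg_sub_pow_le hU N r x
    have e : (2 : ℝ) • opAvg U N x = opAvg U N y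
        + (opAvg U N x - opAvg U m (opAvg U N x))
        + (opAvg U N x - (U ^ r) (opAvg U N x))
        + (U ^ r) (opAvg U N x - opAvg U m (opAvg U N x)) := by
      rw [hy, map_add, opAvg_comm_pow, opAvg_comm N m, map_sub, two_smul]; abel
    have h4 : 2 * ‖opAvg U N x‖ ≤ ‖y‖ + (4 * m + 2 * r) / N * ‖x‖ := by
      have : ‖(2 : ℝ) • opAvg U N x‖ = 2 * ‖opAvg U N x‖ := by simp [norm_smul]
      rw [← this, e]
      refine (norm_add₄_le ..).trans ?_
      have h5 := (norm_pow_apply_le hU r (opAvg U N x - opAvg U m (opAvg U N x))).trans h2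
      calc _ ≤ ‖y‖ + 2 * m / N * ‖x‖ + 2 * r / N * ‖x‖ + 2 * m / N * ‖x‖ := by gcongr
        _ = _ := by ring
    have h6 : (4 * (m : ℝ) + 2 * r) / N * ‖x‖ ≤ δ := by
      rw [div_lt_iff₀ hδ] at hN
      rw [div_mul_eq_mul_div, div_le_iff₀ hN0]
      linarith
    linarith [hdle N hNpos]
  obtain ⟨δ, hδ, hδε⟩ : ∃ δ > 0, 4 * (d + δ) ^ 2 - 4 * d ^ 2 ≤ ε := by
    refine ⟨min 1 (ε / (4 * (2 * d + 1))), by positivity, ?_⟩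
    have a1 : min 1 (ε / (4 * (2 * d + 1))) ≤ 1 := min_le_left _ _
    have a2 : min 1 (ε / (4 * (2 * d + 1))) ≤ ε / (4 * (2 * d + 1)) := min_le_right _ _
    have a3 : 0 < min 1 (ε / (4 * (2 * d + 1))) := by positivity
    rw [le_div_iff₀ (by positivity)] at a2
    nlinarith
  obtain ⟨m₀, hm₀, h⟩ := hlim δ hδ
  refine ⟨m₀, hm₀, fun m hm r => ?_⟩
  have h1 := h m hm
  have h2 := hmid m (hm₀.trans_le hm) r
  have h3 := norm_pow_apply_le hU r (opAvg U m x)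
  have h4 := parallelogram_law_with_norm ℝ (opAvg U m x) ((U ^ r) (opAvg U m x))
  have h5 : ‖opAvg U m x‖ ^ 2 ≤ (d + δ) ^ 2 := by gcongr
  have h6 : ‖(U ^ r) (opAvg U m x)‖ ^ 2 ≤ (d + δ) ^ 2 := by
    have := h3.trans h1
    gcongr
  have h7 : (2 * d) ^ 2 ≤ ‖opAvg U m x + (U ^ r) (opAvg U m x)‖ ^ 2 := by gcongr
  nlinarith

end Averages

/-- Averages of an isometry of a positive semidefinite form are almost invariant under all powers
of the isometry, uniformly in the power. -/
theorem exists_forall_inner_opAvg_sub_pow_le {X : Type*} [AddCommGroup X] [Module ℝ X]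
    (c : PreInnerProductSpace.Core ℝ X) {U : X →ₗ[ℝ] X}
    (hU : ∀ x, c.inner (U x) (U x) = c.inner x x) (x : X) {ε : ℝ} (hε : 0 < ε) :
    ∃ m₀ : ℕ, 0 < m₀ ∧ ∀ m, m₀ ≤ m → ∀ r : ℕ, ∀ y,
      y = (m : ℝ)⁻¹ • ∑ i ∈ Finset.range m, ((U ^ (i + r)) x - (U ^ i) x) →
      c.inner y y ≤ ε := by
  let := c
  let : SeminormedAddCommGroup X := InnerProductSpace.Core.toSeminormedAddCommGroup (𝕜 := ℝ)
  let : InnerProductSpace ℝ X := InnerProductSpace.ofCore c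
  have hn : ∀ y : X, ‖y‖ ^ 2 = c.inner y y := fun y =>
    (real_inner_self_eq_norm_sq y).symm
  have hU' : ∀ y, ‖U y‖ ≤ ‖y‖ := fun y => by
    refine le_of_eq ?_
    rw [← sq_eq_sq₀ (norm_nonneg _) (norm_nonneg _), hn, hn, hU]
  obtain ⟨m₀, hm₀, h⟩ := exists_forall_norm_opAvg_sub_pow_le hU' x hε
  refine ⟨m₀, hm₀, fun m hm r y hy => ?_⟩
  rw [← hn]
  refine le_trans (le_of_eq ?_) (h m hm r)
  rw [← norm_neg, hy]
  congr 2
  rw [Finset.sum_sub_distrib, smul_sub, neg_sub, opAvg_apply, map_smul, map_sum]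
  congr 2
  refine Finset.sum_congr rfl fun i _ => ?_
  rw [← Module.End.mul_apply, ← pow_add, add_comm]

/-! ### Bounded functions and conditional expectations on invariant sets -/

section Bounded

variable {Ω : Type*} [mΩ : MeasurableSpace Ω] {μ : Measure Ω}

/-- `g` is measurable and almost surely bounded by `C` in absolute value. -/
structure BddBy (μ : Measure Ω) (C : ℝ) (g : Ω → ℝ) : Prop where
  aesm : AEStronglyMeasurable g μ
  bound : ∀ᵐ ω ∂μ, |g ω| ≤ C

lemma BddBy.mul {C D : ℝ} {g h : Ω → ℝ} (hg : BddBy μ C g) (hh : BddBy μ D h) :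
    BddBy μ (C * D) (fun ω => g ω * h ω) := by
  refine ⟨hg.aesm.mul hh.aesm, ?_⟩
  filter_upwards [hg.bound, hh.bound] with ω h1 h2
  rw [abs_mul]
  exact mul_le_mul h1 h2 (abs_nonneg _) ((abs_nonneg _).trans h1)

lemma BddBy.comp {C : ℝ} {g : Ω → ℝ} (hg : BddBy μ C g) {T : Ω → Ω}
    (hT : MeasurePreserving T μ μ) : BddBy μ C (fun ω => g (T ω)) :=
  ⟨hg.aesm.comp_measurePreserving hT, hT.quasiMeasurePreserving.ae hg.bound⟩

lemma BddBy.memLp [IsFiniteMeasure μ] {C : ℝ} {g : Ω → ℝ} (hg : BddBy μ C g) {p : ℝ≥0∞} :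
    MemLp g p μ := MemLp.of_bound hg.aesm C hg.bound

lemma BddBy.avg {C : ℝ} (hC : 0 ≤ C) {m : ℕ} {g : ℕ → Ω → ℝ} (hg : ∀ i < m, BddBy μ C (g i)) :
    BddBy μ C (fun ω => (m : ℝ)⁻¹ * ∑ i ∈ Finset.range m, g i ω) := by
  refine ⟨(Finset.aestronglyMeasurable_fun_sum _ fun i hi =>
    (hg i (Finset.mem_range.1 hi)).aesm).const_mul _, ?_⟩
  have h : ∀ᵐ ω ∂μ, ∀ i : ℕ, i < m → |g i ω| ≤ C :=
    ae_all_iff.2 fun i => by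
      by_cases hi : i < m
      · filter_upwards [(hg i hi).bound] with ω hω _ using hω
      · exact Eventually.of_forall fun ω h => absurd h hi
  filter_upwards [h] with ω hω
  rcases Nat.eq_zero_or_pos m with rfl | hm
  · simpa using hC
  have hm' : (0 : ℝ) < m := by exact_mod_cast hm
  rw [abs_mul, abs_of_nonneg (inv_nonneg.2 hm'.le), inv_mul_le_iff₀ hm']
  refine (Finset.abs_sum_le_sum_abs _ _).trans ((Finset.sum_le_card_nsmul _ _ C
    fun i hi => hω i (Finset.mem_range.1 hi)).trans ?_)
  simp

lemma BddBy.mul_memLp {C : ℝ} {g h : Ω → ℝ} (hg : BddBy μ C g) (hh : MemLp h 2 μ) :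
    MemLp (fun ω => g ω * h ω) 2 μ := by
  refine MemLp.of_le_mul (c := C) hh (hg.aesm.mul hh.1) ?_
  filter_upwards [hg.bound] with ω h1
  rw [norm_mul]
  exact mul_le_mul_of_nonneg_right h1 (norm_nonneg _)

lemma BddBy.integral_sq_mul_le {C : ℝ} {g h : Ω → ℝ} (hg : BddBy μ C g) (hh : MemLp h 2 μ) :
    ∫ ω, (g ω * h ω) ^ 2 ∂μ ≤ C ^ 2 * ∫ ω, h ω ^ 2 ∂μ := by
  rw [← integral_const_mul]
  refine integral_mono_ae (hg.mul_memLp hh).integrable_sq (hh.integrable_sq.const_mul _) ?_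
  filter_upwards [hg.bound] with ω h1
  rw [mul_pow]
  exact mul_le_mul_of_nonneg_right (sq_le_sq' (neg_le_of_abs_le h1) (le_of_abs_le h1))
    (sq_nonneg _)

lemma BddBy.integral_sq_le [IsProbabilityMeasure μ] {C : ℝ} {g : Ω → ℝ} (hg : BddBy μ C g) :
    ∫ ω, g ω ^ 2 ∂μ ≤ C ^ 2 := by
  have h := hg.integral_sq_mul_le (memLp_const (1 : ℝ))
  simpa using h

lemma integral_abs_mul_le {f g : Ω → ℝ} (hf : MemLp f 2 μ) (hg : MemLp g 2 μ) {a b : ℝ}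
    (ha : 0 ≤ a) (hb : 0 ≤ b) (hfa : ∫ ω, f ω ^ 2 ∂μ ≤ a ^ 2) (hgb : ∫ ω, g ω ^ 2 ∂μ ≤ b ^ 2) :
    ∫ ω, |f ω * g ω| ∂μ ≤ a * b := by
  have h := sq_integral_mul_le hf.abs hg.abs
  simp only [Pi.abs_apply, sq_abs, ← abs_mul] at h
  refine (abs_le_of_sq_le_sq' (h.trans ?_) (by positivity)).2
  rw [mul_pow]
  exact mul_le_mul hfa hgb (integral_nonneg fun ω => sq_nonneg _) (sq_nonneg _)

lemma integral_abs_le_of_sq [IsProbabilityMeasure μ] {f : Ω → ℝ} (hf : MemLp f 2 μ) {a : ℝ}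
    (ha : 0 ≤ a) (hfa : ∫ ω, f ω ^ 2 ∂μ ≤ a ^ 2) : ∫ ω, |f ω| ∂μ ≤ a := by
  have h := integral_abs_mul_le hf (memLp_const (1 : ℝ)) ha zero_le_one hfa (by simp)
  simpa using h

lemma sq_avg_le (m : ℕ) (x : ℕ → ℝ) :
    ((m : ℝ)⁻¹ * ∑ i ∈ Finset.range m, x i) ^ 2
      ≤ (m : ℝ)⁻¹ * ∑ i ∈ Finset.range m, x i ^ 2 := by
  rcases Nat.eq_zero_or_pos m with rfl | hm
  · simp
  have hm' : (0 : ℝ) < m := by exact_mod_cast hm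
  have h := sq_sum_le_card_mul_sum_sq (s := Finset.range m) (f := x)
  rw [Finset.card_range] at h
  rw [mul_pow, inv_pow, sq (m : ℝ), mul_inv, mul_assoc]
  refine mul_le_mul_of_nonneg_left ?_ (by positivity)
  rwa [inv_mul_le_iff₀ hm']

lemma avg_le_of_le {m : ℕ} {x : ℕ → ℝ} {C : ℝ} (hC : 0 ≤ C) (h : ∀ i < m, x i ≤ C) :
    (m : ℝ)⁻¹ * ∑ i ∈ Finset.range m, x i ≤ C := by
  rcases Nat.eq_zero_or_pos m with rfl | hm
  · simpa using hC
  have hm' : (0 : ℝ) < m := by exact_mod_cast hm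
  rw [inv_mul_le_iff₀ hm']
  refine (Finset.sum_le_card_nsmul _ _ C fun i hi => h i (Finset.mem_range.1 hi)).trans ?_
  simp

lemma abs_avg_le (m : ℕ) (x : ℕ → ℝ) :
    |(m : ℝ)⁻¹ * ∑ i ∈ Finset.range m, x i| ≤ (m : ℝ)⁻¹ * ∑ i ∈ Finset.range m, |x i| := by
  rw [abs_mul, abs_of_nonneg (by positivity : (0 : ℝ) ≤ (m : ℝ)⁻¹)]
  exact mul_le_mul_of_nonneg_left (Finset.abs_sum_le_sum_abs _ _) (by positivity)

/-- The conditional expectation on the σ-algebra of `V`-invariant sets. -/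
noncomputable abbrev relExp (μ : Measure Ω) (V : Ω → Ω) (g : Ω → ℝ) : Ω → ℝ :=
  μ[g | MeasurableSpace.invariants V]

variable {V : Ω → Ω}

lemma memLp_relExp {g : Ω → ℝ} (hg : MemLp g 2 μ) : MemLp (relExp μ V g) 2 μ :=
  hg.condExp one_le_two

lemma BddBy.relExp {C : ℝ} {g : Ω → ℝ} (hg : BddBy μ C g) : BddBy μ C (relExp μ V g) :=
  ⟨(stronglyMeasurable_condExp.mono (MeasurableSpace.invariants_le V)).aestronglyMeasurable,
    ae_bdd_abs_condExp_of_ae_bdd_abs hg.bound⟩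

lemma integral_mul_relExp [IsProbabilityMeasure μ] {x y : Ω → ℝ} (hx : MemLp x 2 μ)
    (hy : MemLp y 2 μ) :
    ∫ ω, x ω * relExp μ V y ω ∂μ = ∫ ω, relExp μ V x ω * relExp μ V y ω ∂μ :=
  integral_condExp_mul_condExp (MeasurableSpace.invariants_le V) hx hy

lemma relExp_mul_relExp [IsProbabilityMeasure μ] {x y : Ω → ℝ} (hx : MemLp x 2 μ)
    (hy : MemLp y 2 μ) :
    relExp μ V (fun ω => x ω * relExp μ V y ω)
      =ᵐ[μ] fun ω => relExp μ V x ω * relExp μ V y ω :=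
  condExp_mul_of_stronglyMeasurable_right stronglyMeasurable_condExp
    (hx.integrable_mul (memLp_relExp hy)) (hx.integrable one_le_two)

lemma relExp_avg {m : ℕ} {g : ℕ → Ω → ℝ} (hg : ∀ i, Integrable (g i) μ) :
    relExp μ V (fun ω => (m : ℝ)⁻¹ * ∑ i ∈ Finset.range m, g i ω)
      =ᵐ[μ] fun ω => (m : ℝ)⁻¹ * ∑ i ∈ Finset.range m, relExp μ V (g i) ω := by
  have h1 : (fun ω => (m : ℝ)⁻¹ * ∑ i ∈ Finset.range m, g i ω)
      = (m : ℝ)⁻¹ • ∑ i ∈ Finset.range m, g i := by ext ω; simp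
  rw [h1]
  refine (condExp_smul _ _ _).trans ?_
  filter_upwards [condExp_finsetSum (fun i (_ : i ∈ Finset.range m) => hg i)
    (MeasurableSpace.invariants V)] with ω hω
  simp [hω]

lemma integral_sq_relExp_le [IsProbabilityMeasure μ] {g : Ω → ℝ} (hg : MemLp g 2 μ) :
    ∫ ω, relExp μ V g ω ^ 2 ∂μ ≤ ∫ ω, g ω ^ 2 ∂μ := by
  have h0 : ∫ ω, g ω * relExp μ V g ω ∂μ = ∫ ω, relExp μ V g ω ^ 2 ∂μ := by
    rw [integral_mul_relExp hg hg]; simp only [sq]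
  have h1 := sq_integral_mul_le hg (memLp_relExp (V := V) hg)
  rw [h0] at h1
  have h2 : 0 ≤ ∫ ω, relExp μ V g ω ^ 2 ∂μ := integral_nonneg fun ω => sq_nonneg _
  have h3 : 0 ≤ ∫ ω, g ω ^ 2 ∂μ := integral_nonneg fun ω => sq_nonneg _
  nlinarith

end Bounded

/-! ### The relative correlation operator -/

section RelOp

variable {Ω : Type*} [mΩ : MeasurableSpace Ω] {μ : Measure Ω}

/-- The orbit `ψ ∘ Uⁱ` of a function. -/
def orb (U : Ω → Ω) (ψ : Ω → ℝ) (i : ℕ) : Ω → ℝ := fun ω => ψ (U^[i] ω)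

/-- The conditional correlation of `ψ ∘ Uⁱ` and `ψ ∘ Uˢ` given the `V`-invariant sets. -/
noncomputable def relCorr (μ : Measure Ω) (U V : Ω → Ω) (ψ : Ω → ℝ) (i s : ℕ) : Ω → ℝ :=
  relExp μ V (fun ω => orb U ψ i ω * orb U ψ s ω)

/-- The averaged relative correlation operator
`φ ↦ m⁻¹ ∑_{i < m} ψ_{i+r} E[ψ_{i+r} φ | V]`, where `ψ_i = ψ ∘ Uⁱ`. -/
noncomputable def relOp (μ : Measure Ω) (U V : Ω → Ω) (ψ : Ω → ℝ) (m r : ℕ) (φ : Ω → ℝ) : Ω → ℝ :=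
  fun ω => (m : ℝ)⁻¹ * ∑ i ∈ Finset.range m,
    orb U ψ (i + r) ω * relExp μ V (fun ω => orb U ψ (i + r) ω * φ ω) ω

variable {U V : Ω → Ω} {ψ : Ω → ℝ} {B : ℝ}

lemma BddBy.orb (hU : MeasurePreserving U μ μ) (hψ : BddBy μ B ψ) (i : ℕ) :
    BddBy μ B (orb U ψ i) := hψ.comp (hU.iterate i)

lemma orb_iterate {Ω : Type*} {U : Ω → Ω} (ψ : Ω → ℝ) (i r : ℕ) (ω : Ω) : orb U ψ i
    (U^[r] ω) = orb U ψ (i + r) ω := by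
  simp only [orb, Function.iterate_add_apply]

lemma bddBy_relCorr (hU : MeasurePreserving U μ μ) (hψ : BddBy μ B ψ) (i s : ℕ) :
    BddBy μ (B * B) (relCorr μ U V ψ i s) :=
  ((hψ.orb hU i).mul (hψ.orb hU s)).relExp

lemma relCorr_comm (i s : ℕ) : relCorr μ U V ψ i s = relCorr μ U V ψ s i := by
  simp only [relCorr, mul_comm]

lemma relCorr_comp_iterate [IsProbabilityMeasure μ] (hU : MeasurePreserving U μ μ)
    (hV : MeasurePreserving V μ μ)
    (hUV : Function.Commute U V) (hψ : BddBy μ B ψ) (i s r : ℕ) :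
    (fun ω => relCorr μ U V ψ i s (U^[r] ω)) =ᵐ[μ] relCorr μ U V ψ (i + r) (s + r) := by
  refine (condExp_invariants_comp_comm (hU.iterate r) hV (hUV.iterate_left r)
    ((hψ.orb hU i).mul (hψ.orb hU s)).memLp).trans ?_
  simp only [orb_iterate]
  rfl

/-- The squared `L²` norm of the relative correlation, the Gram matrix of the vectors
`ψ_i ⊗ ψ_i` in the product over the factor of `V`-invariant sets. -/
noncomputable def gramCoeff (μ : Measure Ω) (U V : Ω → Ω) (ψ : Ω → ℝ) (i s : ℕ) : ℝ :=
  ∫ ω, relCorr μ U V ψ i s ω ^ 2 ∂μ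

/-- The quadratic form on finitely supported sequences whose matrix is `gramCoeff`. -/
noncomputable def gram (μ : Measure Ω) (U V : Ω → Ω) (ψ : Ω → ℝ) (a b : ℕ →₀ ℝ) : ℝ :=
  a.sum fun s u => b.sum fun t v => u * (v * gramCoeff μ U V ψ s t)

lemma gramCoeff_add [IsProbabilityMeasure μ] (hU : MeasurePreserving U μ μ)
    (hV : MeasurePreserving V μ μ)
    (hUV : Function.Commute U V) (hψ : BddBy μ B ψ) (i s r : ℕ) :
    gramCoeff μ U V ψ (i + r) (s + r) = gramCoeff μ U V ψ i s := by
  unfold gramCoeff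
  rw [← integral_comp' (hU.iterate r) (bddBy_relCorr hU hψ i s).memLp.integrable_sq.1]
  refine integral_congr_ae ?_
  filter_upwards [relCorr_comp_iterate hU hV hUV hψ i s r] with ω hω
  rw [hω]

lemma integral_sq_sum {ι : Type*} (S : Finset ι) {F : ι → Ω → ℝ} (hF : ∀ s, MemLp (F s) 2 μ) :
    ∫ ω, (∑ s ∈ S, F s ω) ^ 2 ∂μ = ∑ s ∈ S, ∑ t ∈ S, ∫ ω, F s ω * F t ω ∂μ := by
  have hi : ∀ s t, Integrable (fun ω => F s ω * F t ω) μ := fun s t =>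
    integrable_mul_of_memLp_two (hF s) (hF t)
  simp only [sq, Finset.sum_mul_sum]
  rw [integral_finsetSum _ fun s _ => integrable_finsetSum _ fun t _ => hi s t]
  exact Finset.sum_congr rfl fun s _ => integral_finsetSum _ fun t _ => hi s t

/-- The quadratic form is a limit of averages of squared `L²` norms along the orbit of `V`. -/
lemma tendsto_gram [IsProbabilityMeasure μ] (hU : MeasurePreserving U μ μ)
    (hV : MeasurePreserving V μ μ)
    (hψ : BddBy μ B ψ) (a : ℕ →₀ ℝ) :
    Tendsto (fun k : ℕ => (k : ℝ)⁻¹ * ∑ j ∈ Finset.range k,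
      ∫ ω, (a.sum fun s u => u * (orb U ψ s ω * orb U ψ s (V^[j] ω))) ^ 2 ∂μ) atTop
      (𝓝 (gram μ U V ψ a a)) := by
  have hst : ∀ s t : ℕ, Tendsto (fun k : ℕ => (k : ℝ)⁻¹ * ∑ j ∈ Finset.range k,
      ∫ ω, (orb U ψ s ω * orb U ψ t ω) * (orb U ψ s (V^[j] ω) * orb U ψ t (V^[j] ω)) ∂μ) atTop
      (𝓝 (gramCoeff μ U V ψ s t)) := by
    intro s t
    have hm : MemLp (fun ω => orb U ψ s ω * orb U ψ t ω) 2 μ :=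
      ((hψ.orb hU s).mul (hψ.orb hU t)).memLp
    have := tendsto_avg_integral_mul_comp hV hm hm
    rw [integral_condExp_mul_condExp (MeasurableSpace.invariants_le V) hm hm] at this
    simpa only [gramCoeff, relCorr, sq] using this
  have h := tendsto_finsetSum a.support fun s _ => tendsto_finsetSum a.support fun t _ =>
    ((hst s t).const_mul (a t)).const_mul (a s)
  refine h.congr fun k => ?_
  have e : ∀ j, ∫ ω, (a.sum fun s u => u * (orb U ψ s ω * orb U ψ s (V^[j] ω))) ^ 2 ∂μ
      = ∑ s ∈ a.support, ∑ t ∈ a.support, a s * (a t *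
        ∫ ω, (orb U ψ s ω * orb U ψ t ω) * (orb U ψ s (V^[j] ω) * orb U ψ t (V^[j] ω)) ∂μ) := by
    intro j
    have hF : ∀ s, MemLp (fun ω => a s * (orb U ψ s ω * orb U ψ s (V^[j] ω))) 2 μ := fun s =>
      ((hψ.orb hU s).mul ((hψ.orb hU s).comp (hV.iterate j))).memLp.const_mul _
    simp only [Finsupp.sum]
    rw [integral_sq_sum _ hF]
    refine Finset.sum_congr rfl fun s _ => Finset.sum_congr rfl fun t _ => ?_
    rw [← integral_const_mul, ← integral_const_mul]
    congr 1; ext ω; ring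
  simp only [e, Finset.mul_sum]
  refine Eq.symm ?_
  rw [Finset.sum_comm]
  refine Finset.sum_congr rfl fun s _ => ?_
  rw [Finset.sum_comm]
  refine Finset.sum_congr rfl fun t _ => ?_
  refine Finset.sum_congr rfl fun j _ => ?_
  ring

lemma gram_nonneg [IsProbabilityMeasure μ] (hU : MeasurePreserving U μ μ)
    (hV : MeasurePreserving V μ μ) (hψ : BddBy μ B ψ) (a : ℕ →₀ ℝ) : 0 ≤ gram μ U V ψ a a :=
  ge_of_tendsto' (tendsto_gram hU hV hψ a) fun k => mul_nonneg (by positivity)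
    (Finset.sum_nonneg fun j _ => integral_nonneg fun ω => sq_nonneg _)

/-- The form `gram` as a semi-inner product. -/
@[reducible] noncomputable def gramCore [IsProbabilityMeasure μ] (hU : MeasurePreserving U μ μ)
    (hV : MeasurePreserving V μ μ) (hψ : BddBy μ B ψ) : PreInnerProductSpace.Core ℝ (ℕ →₀ ℝ) where
  inner := gram μ U V ψ
  conj_inner_symm a b := by
    simp only [gram, conj_trivial, Finsupp.sum]
    rw [Finset.sum_comm]
    refine Finset.sum_congr rfl fun s _ => Finset.sum_congr rfl fun t _ => ?_
    rw [gramCoeff, gramCoeff, relCorr_comm]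
    ring
  re_inner_nonneg a := gram_nonneg hU hV hψ a
  add_left a b c := by
    simp only [gram]
    rw [Finsupp.sum_add_index' (by simp)]
    intro s u u'
    simp only [add_mul, Finsupp.sum_add]
  smul_left a b r := by
    simp only [gram, conj_trivial]
    rw [Finsupp.sum_smul_index' (by simp), Finsupp.mul_sum]
    refine Finsupp.sum_congr fun s _ => ?_
    rw [Finsupp.mul_sum]
    refine Finsupp.sum_congr fun t _ => ?_
    simp only [smul_eq_mul, mul_assoc]

/-- The operator with coefficients `a` is bounded, from `L^∞` to `L²`, by its Hilbert–Schmidt norm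
relative to the factor of `V`-invariant sets. -/
lemma integral_sq_sum_relExp_le [IsProbabilityMeasure μ] (hU : MeasurePreserving U μ μ)
    (hV : MeasurePreserving V μ μ) (hψ : BddBy μ B ψ) (a : ℕ →₀ ℝ) {φ : Ω → ℝ} {D : ℝ}
    (hφ : BddBy μ D φ) :
    ∫ ω, (a.sum fun s u => u * (orb U ψ s ω * relExp μ V (fun ω => orb U ψ s ω * φ ω) ω)) ^ 2 ∂μ
      ≤ D ^ 2 * gram μ U V ψ a a := by
  set η : Ω → ℝ := fun ω =>
    a.sum fun s u => u * (orb U ψ s ω * relExp μ V (fun ω => orb U ψ s ω * φ ω) ω) with hη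
  have hpφ : ∀ s, MemLp (fun ω => orb U ψ s ω * φ ω) 2 μ := fun s =>
    ((hψ.orb hU s).mul hφ).memLp
  have hηL : MemLp η 2 μ := memLp_finsetSum _ fun s _ =>
    ((hψ.orb hU s).mul_memLp (memLp_relExp (hpφ s))).const_mul _
  have hηp : ∀ s, MemLp (fun ω => orb U ψ s ω * η ω) 2 μ := fun s => (hψ.orb hU s).mul_memLp hηL
  have hκ : ∀ j, MemLp (fun ω => a.sum fun s u => u * (orb U ψ s ω * orb U ψ s (V^[j] ω))) 2 μ :=
    fun j => memLp_finsetSum _ fun s _ =>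
      ((hψ.orb hU s).mul ((hψ.orb hU s).comp (hV.iterate j))).memLp.const_mul _
  -- `∫ η²` is a limit of averages of correlations along the orbit of `V`.
  have hlim : Tendsto (fun k : ℕ => (k : ℝ)⁻¹ * ∑ j ∈ Finset.range k,
      ∫ ω, η ω * (φ (V^[j] ω) *
        a.sum fun s u => u * (orb U ψ s ω * orb U ψ s (V^[j] ω))) ∂μ) atTop
      (𝓝 (∫ ω, η ω ^ 2 ∂μ)) := by
    have h1 := tendsto_finsetSum a.support fun s _ =>
      (tendsto_avg_integral_mul_comp hV (hηp s) (hpφ s)).const_mul (a s)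
    have e : ∑ s ∈ a.support, a s * ∫ ω, (orb U ψ s ω * η ω) *
        relExp μ V (fun ω => orb U ψ s ω * φ ω) ω ∂μ = ∫ ω, η ω ^ 2 ∂μ := by
      have : ∀ ω, η ω ^ 2 = ∑ s ∈ a.support, a s * ((orb U ψ s ω * η ω) *
          relExp μ V (fun ω => orb U ψ s ω * φ ω) ω) := by
        intro ω
        have hη' : η ω = ∑ s ∈ a.support,
          a s * (orb U ψ s ω * relExp μ V (fun ω => orb U ψ s ω * φ ω) ω) := rfl
        rw [sq]
        nth_rewrite 1 [hη']
        rw [Finset.sum_mul]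
        refine Finset.sum_congr rfl fun s _ => ?_
        ring
      simp only [this]
      rw [integral_finsetSum _ fun s _ => (integrable_mul_of_memLp_two (hηp s)
        (memLp_relExp (hpφ s))).const_mul _]
      simp only [integral_const_mul]
    rw [← e]
    refine h1.congr fun k => ?_
    simp only [Finset.mul_sum]
    rw [Finset.sum_comm]
    refine Finset.sum_congr rfl fun j _ => ?_
    have : ∀ ω, η ω * (φ (V^[j] ω) * a.sum fun s u => u * (orb U ψ s ω * orb U ψ s (V^[j] ω)))
        = ∑ s ∈ a.support, a s * ((orb U ψ s ω * η ω) *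
          (orb U ψ s (V^[j] ω) * φ (V^[j] ω))) := by
      intro ω
      simp only [Finsupp.sum, Finset.mul_sum]
      refine Finset.sum_congr rfl fun s _ => ?_
      ring
    simp only [this]
    rw [integral_finsetSum _ fun s _ => (integrable_mul_of_memLp_two (hηp s)
        (memLp_comp (hV.iterate j) (hpφ s))).const_mul _, Finset.mul_sum]
    refine Finset.sum_congr rfl fun s _ => ?_
    rw [integral_const_mul]
    ring
  have hη0 : 0 ≤ ∫ ω, η ω ^ 2 ∂μ := integral_nonneg fun ω => sq_nonneg _
  have hle : (∫ ω, η ω ^ 2 ∂μ) ^ 2 ≤ (∫ ω, η ω ^ 2 ∂μ) * (D ^ 2 * gram μ U V ψ a a) := by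
    refine le_of_tendsto_of_tendsto' (hlim.pow 2)
      (((tendsto_gram hU hV hψ a).const_mul (D ^ 2)).const_mul _) fun k => ?_
    refine (sq_avg_le _ _).trans ?_
    have e : ∀ x y z w : ℝ, x * (y * (z * w)) = z * (x * (y * w)) := fun _ _ _ _ => by ring
    rw [e]
    refine mul_le_mul_of_nonneg_left ?_ (by positivity)
    rw [Finset.mul_sum, Finset.mul_sum]
    refine Finset.sum_le_sum fun j _ => ?_
    have hb := hφ.comp (hV.iterate j)
    refine (sq_integral_mul_le hηL (hb.mul_memLp (hκ j))).trans ?_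
    exact mul_le_mul_of_nonneg_left (hb.integral_sq_mul_le (hκ j)) hη0
  have hg := gram_nonneg hU hV hψ a
  rcases hη0.eq_or_lt with h0 | h0
  · rw [← h0]; exact mul_nonneg (sq_nonneg D) hg
  · rw [sq] at hle; exact le_of_mul_le_mul_left hle h0

/-- The averaged relative correlation operators over a long window hardly change when the window
is moved, uniformly in the displacement. -/
theorem exists_forall_integral_sq_relOp_sub_le [IsProbabilityMeasure μ]
    (hU : MeasurePreserving U μ μ) (hV : MeasurePreserving V μ μ) (hUV : Function.Commute U V)
    (hψ : BddBy μ B ψ) {ε : ℝ} (hε : 0 < ε) :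
    ∃ m₀ : ℕ, 0 < m₀ ∧ ∀ m, m₀ ≤ m → ∀ (r : ℕ) (D : ℝ) (φ : Ω → ℝ), BddBy μ D φ →
      ∫ ω, (relOp μ U V ψ m r φ ω - relOp μ U V ψ m 0 φ ω) ^ 2 ∂μ ≤ D ^ 2 * ε := by
  let S : (ℕ →₀ ℝ) →ₗ[ℝ] (ℕ →₀ ℝ) := Finsupp.lmapDomain ℝ ℝ (fun i => i + 1)
  have hS : ∀ x, (gramCore hU hV hψ).inner (S x) (S x) = (gramCore hU hV hψ).inner x x := by
    intro x
    change gram μ U V ψ (S x) (S x) = gram μ U V ψ x x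
    simp only [gram, S, Finsupp.lmapDomain_apply]
    rw [Finsupp.sum_mapDomain_index (by simp) (fun s u u' => by
      simp only [add_mul, Finsupp.sum_add])]
    refine Finsupp.sum_congr fun s _ => ?_
    rw [Finsupp.sum_mapDomain_index (by simp) (fun t v v' => by ring)]
    simp only [gramCoeff_add hU hV hUV hψ]
  have hSi : ∀ i : ℕ, (S ^ i) (Finsupp.single 0 1) = Finsupp.single i 1 := by
    intro i
    induction i with
    | zero => simp
    | succ i ih => rw [pow_succ', Module.End.mul_apply, ih]; simp [S]
  obtain ⟨m₀, hm₀, h⟩ := exists_forall_inner_opAvg_sub_pow_le (gramCore hU hV hψ) hS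
    (Finsupp.single 0 1) hε
  refine ⟨m₀, hm₀, fun m hm r D φ hφ => ?_⟩
  have h1 := h m hm r _ rfl
  simp only [hSi] at h1
  set a : ℕ →₀ ℝ := (m : ℝ)⁻¹ • ∑ i ∈ Finset.range m,
    (Finsupp.single (i + r) (1 : ℝ) - Finsupp.single i 1) with ha
  have h2 := integral_sq_sum_relExp_le hU hV hψ a hφ
  have e : ∀ ω, (a.sum fun s u => u * (orb U ψ s ω *
      relExp μ V (fun ω => orb U ψ s ω * φ ω) ω))
      = relOp μ U V ψ m r φ ω - relOp μ U V ψ m 0 φ ω := by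
    intro ω
    have : ∀ b : ℕ →₀ ℝ, (b.sum fun s u => u * (orb U ψ s ω *
        relExp μ V (fun ω => orb U ψ s ω * φ ω) ω)) = Finsupp.linearCombination ℝ
          (fun s => orb U ψ s ω * relExp μ V (fun ω => orb U ψ s ω * φ ω) ω) b := fun b => by
      simp [Finsupp.linearCombination_apply]
    rw [this, ha, map_smul, map_sum]
    simp only [map_sub, Finsupp.linearCombination_single, one_mul, smul_eq_mul, relOp,
      Finset.sum_sub_distrib, mul_sub, add_zero]
  simp only [e] at h2
  exact h2.trans (mul_le_mul_of_nonneg_left h1 (sq_nonneg D))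

end RelOp

section RelOp

variable {Ω : Type*} [mΩ : MeasurableSpace Ω] {μ : Measure Ω} {U V : Ω → Ω} {ψ : Ω → ℝ} {B : ℝ}
lemma memLp_orb_mul (hU : MeasurePreserving U μ μ) (hψ : BddBy μ B ψ) {x : Ω → ℝ}
    (hx : MemLp x 2 μ) (i : ℕ) : MemLp (fun ω => orb U ψ i ω * x ω) 2 μ :=
  (hψ.orb hU i).mul_memLp hx

lemma memLp_relOp [IsProbabilityMeasure μ] (hU : MeasurePreserving U μ μ) (hψ : BddBy μ B ψ)
    {x : Ω → ℝ}
    (hx : MemLp x 2 μ) (m r : ℕ) : MemLp (relOp μ U V ψ m r x) 2 μ :=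
  (memLp_finsetSum _ fun i _ => memLp_orb_mul hU hψ
    (memLp_relExp (memLp_orb_mul hU hψ hx (i + r))) (i + r)).const_mul _

lemma bddBy_relOp (hU : MeasurePreserving U μ μ) (hψ : BddBy μ B ψ) (hB : 0 ≤ B) {x : Ω → ℝ}
    {D : ℝ} (hD : 0 ≤ D) (hx : BddBy μ D x) (m r : ℕ) :
    BddBy μ (B * (B * D)) (relOp μ U V ψ m r x) :=
  BddBy.avg (by positivity) fun i _ => (hψ.orb hU (i + r)).mul ((hψ.orb hU (i + r)).mul hx).relExp

lemma relExp_mul_relOp [IsProbabilityMeasure μ] (hU : MeasurePreserving U μ μ) (hψ : BddBy μ B ψ)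
    {x y : Ω → ℝ}
    (hx : MemLp x 2 μ) (hy : MemLp y 2 μ) (m r : ℕ) :
    relExp μ V (fun ω => x ω * relOp μ U V ψ m r y ω)
      =ᵐ[μ] fun ω => (m : ℝ)⁻¹ * ∑ i ∈ Finset.range m,
        relExp μ V (fun ω => orb U ψ (i + r) ω * x ω) ω
          * relExp μ V (fun ω => orb U ψ (i + r) ω * y ω) ω := by
  have hxi := memLp_orb_mul hU hψ hx
  have hyi := memLp_orb_mul hU hψ hy
  have e : (fun ω => x ω * relOp μ U V ψ m r y ω) = fun ω => (m : ℝ)⁻¹ * ∑ i ∈ Finset.range m,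
      (orb U ψ (i + r) ω * x ω) * relExp μ V (fun ω => orb U ψ (i + r) ω * y ω) ω := by
    ext ω
    simp only [relOp, Finset.mul_sum]
    refine Finset.sum_congr rfl fun i _ => ?_
    ring
  rw [e]
  refine (relExp_avg fun i => integrable_mul_of_memLp_two (hxi _) (memLp_relExp (hyi _))).trans ?_
  have h : ∀ᵐ ω ∂μ, ∀ i, relExp μ V (fun ω => (orb U ψ (i + r) ω * x ω) *
      relExp μ V (fun ω => orb U ψ (i + r) ω * y ω) ω) ω
      = relExp μ V (fun ω => orb U ψ (i + r) ω * x ω) ω *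
      relExp μ V (fun ω => orb U ψ (i + r) ω * y ω) ω :=
    ae_all_iff.2 fun i => relExp_mul_relExp (hxi _) (hyi _)
  filter_upwards [h] with ω hω
  simp only [hω]

/-- The bilinear form of the operator `relOp`; in particular this operator is symmetric. -/
lemma integral_mul_relOp [IsProbabilityMeasure μ] (hU : MeasurePreserving U μ μ) (hψ : BddBy μ B ψ)
    {x y : Ω → ℝ}
    (hx : MemLp x 2 μ) (hy : MemLp y 2 μ) (m r : ℕ) :
    ∫ ω, x ω * relOp μ U V ψ m r y ω ∂μ = (m : ℝ)⁻¹ * ∑ i ∈ Finset.range m,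
      ∫ ω, relExp μ V (fun ω => orb U ψ (i + r) ω * x ω) ω
          * relExp μ V (fun ω => orb U ψ (i + r) ω * y ω) ω ∂μ := by
  rw [← integral_condExp (MeasurableSpace.invariants_le V),
    integral_congr_ae (relExp_mul_relOp hU hψ hx hy m r), integral_const_mul, integral_finsetSum]
  exact fun i _ => integrable_mul_of_memLp_two (memLp_relExp (memLp_orb_mul hU hψ hx _))
    (memLp_relExp (memLp_orb_mul hU hψ hy _))

lemma integral_mul_relOp_comm [IsProbabilityMeasure μ] (hU : MeasurePreserving U μ μ)
    (hψ : BddBy μ B ψ) {x y : Ω → ℝ}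
    (hx : MemLp x 2 μ) (hy : MemLp y 2 μ) (m r : ℕ) :
    ∫ ω, x ω * relOp μ U V ψ m r y ω ∂μ = ∫ ω, y ω * relOp μ U V ψ m r x ω ∂μ := by
  rw [integral_mul_relOp hU hψ hx hy, integral_mul_relOp hU hψ hy hx]
  simp only [mul_comm]

lemma integral_sq_relOp_le [IsProbabilityMeasure μ] (hU : MeasurePreserving U μ μ)
    (hψ : BddBy μ B ψ) {x : Ω → ℝ}
    (hx : MemLp x 2 μ) (m r : ℕ) :
    ∫ ω, relOp μ U V ψ m r x ω ^ 2 ∂μ ≤ B ^ 2 * ∫ ω, x ω * relOp μ U V ψ m r x ω ∂μ := by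
  rw [integral_mul_relOp hU hψ hx hx]
  have h1 : ∀ i, MemLp (relExp μ V (fun ω => orb U ψ (i + r) ω * x ω)) 2 μ := fun i =>
    memLp_relExp (memLp_orb_mul hU hψ hx _)
  have h2 : ∀ i, MemLp (fun ω => orb U ψ (i + r) ω *
    relExp μ V (fun ω => orb U ψ (i + r) ω * x ω) ω) 2 μ := fun i =>
    memLp_orb_mul hU hψ (h1 i) _
  calc ∫ ω, relOp μ U V ψ m r x ω ^ 2 ∂μ
      ≤ ∫ ω, (m : ℝ)⁻¹ * ∑ i ∈ Finset.range m,
        (orb U ψ (i + r) ω * relExp μ V (fun ω => orb U ψ (i + r) ω * x ω) ω) ^ 2 ∂μ :=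
        integral_mono (memLp_relOp hU hψ hx m r).integrable_sq
          ((integrable_finsetSum _ fun i _ => (h2 i).integrable_sq).const_mul _)
          fun ω => sq_avg_le _ _
    _ = (m : ℝ)⁻¹ * ∑ i ∈ Finset.range m, ∫ ω,
        (orb U ψ (i + r) ω * relExp μ V (fun ω => orb U ψ (i + r) ω * x ω) ω) ^ 2 ∂μ := by
        rw [integral_const_mul, integral_finsetSum _ fun i _ => (h2 i).integrable_sq]
    _ ≤ (m : ℝ)⁻¹ * ∑ i ∈ Finset.range m, (B ^ 2 * ∫ ω,
        relExp μ V (fun ω => orb U ψ (i + r) ω * x ω) ω ^ 2 ∂μ) := by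
        gcongr with i
        exact (hψ.orb hU _).integral_sq_mul_le (h1 i)
    _ = _ := by
        simp only [← Finset.mul_sum, sq]
        ring

/-! ### An almost invariant kernel -/

/-- The kernel `m⁻¹ ∑_{s < m} (K ψ_s) ⊗ (K ψ_s)`, where `K` is the correlation operator, evaluated
on the graph of `V^j`. -/
noncomputable def relKer (μ : Measure Ω) (U V : Ω → Ω) (ψ : Ω → ℝ) (m r j : ℕ) : Ω → ℝ :=
  fun ω => (m : ℝ)⁻¹ * ∑ s ∈ Finset.range m,
    relOp μ U V ψ m 0 (orb U ψ (s + r)) ω * relOp μ U V ψ m 0 (orb U ψ (s + r)) (V^[j] ω)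

lemma relOp_orb (m t : ℕ) (ω : Ω) : relOp μ U V ψ m 0 (orb U ψ t) ω
    = (m : ℝ)⁻¹ * ∑ i ∈ Finset.range m, orb U ψ i ω * relCorr μ U V ψ i t ω := rfl

lemma relKer_eq (m r j : ℕ) (ω : Ω) : relKer μ U V ψ m r j ω
    = (m : ℝ)⁻¹ * ∑ i ∈ Finset.range m, (m : ℝ)⁻¹ * ∑ i' ∈ Finset.range m,
      (orb U ψ i ω * orb U ψ i' (V^[j] ω)) *
      ((m : ℝ)⁻¹ * ∑ s ∈ Finset.range m,
        relCorr μ U V ψ i (s + r) ω * relCorr μ U V ψ i' (s + r) ω) := by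
  have hc : ∀ i t, relCorr μ U V ψ i t (V^[j] ω) = relCorr μ U V ψ i t ω := fun i t =>
    condExp_invariants_iterate _ j ω
  simp only [relKer, relOp_orb, hc, Finset.mul_sum, Finset.sum_mul]
  conv_rhs => rw [Finset.sum_comm]
  rw [Finset.sum_comm]
  refine Finset.sum_congr rfl fun i _ => ?_
  rw [Finset.sum_comm]
  refine Finset.sum_congr rfl fun i' _ => Finset.sum_congr rfl fun s _ => ?_
  ring

lemma bddBy_relKer (hU : MeasurePreserving U μ μ) (hV : MeasurePreserving V μ μ)
    (hψ : BddBy μ B ψ) (hB : 0 ≤ B) (m r j : ℕ) :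
    BddBy μ (B ^ 6) (relKer μ U V ψ m r j) := by
  have h : ∀ s, BddBy μ (B * (B * B)) (relOp μ U V ψ m 0 (orb U ψ (s + r))) := fun s =>
    bddBy_relOp hU hψ hB hB (hψ.orb hU _) m 0
  have e : B ^ 6 = B * (B * B) * (B * (B * B)) := by ring
  rw [e]
  exact BddBy.avg (by positivity) fun s _ => (h s).mul ((h s).comp (hV.iterate j))

lemma relOp_orb_comp_iterate [IsProbabilityMeasure μ] (hU : MeasurePreserving U μ μ)
    (hV : MeasurePreserving V μ μ)
    (hUV : Function.Commute U V) (hψ : BddBy μ B ψ) (m s r : ℕ) :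
    (fun ω => relOp μ U V ψ m 0 (orb U ψ s) (U^[r] ω))
      =ᵐ[μ] relOp μ U V ψ m r (orb U ψ (s + r)) := by
  have h : ∀ᵐ ω ∂μ, ∀ i, relCorr μ U V ψ i s (U^[r] ω) = relCorr μ U V ψ (i + r) (s + r) ω :=
    ae_all_iff.2 fun i => relCorr_comp_iterate hU hV hUV hψ i s r
  filter_upwards [h] with ω hω
  simp only [relOp_orb, hω, orb_iterate]
  rfl

/-- The kernel `relKer` is almost invariant under all powers of `U`, in `L¹` and uniformly in the
graph parameter `j`, as soon as the correlation operator hardly depends on the window. -/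
lemma integral_abs_relKer_comp_sub_le [IsProbabilityMeasure μ] (hU : MeasurePreserving U μ μ)
    (hV : MeasurePreserving V μ μ)
    (hUV : Function.Commute U V) (hψ : BddBy μ B ψ) (hB : 0 ≤ B) {δ : ℝ} (hδ : 0 ≤ δ) {m : ℕ}
    (h : ∀ (r : ℕ) (D : ℝ) (φ : Ω → ℝ), BddBy μ D φ →
      ∫ ω, (relOp μ U V ψ m r φ ω - relOp μ U V ψ m 0 φ ω) ^ 2 ∂μ ≤ D ^ 2 * δ ^ 2) (r j : ℕ) :
    ∫ ω, |relKer μ U V ψ m 0 j (U^[r] ω) - relKer μ U V ψ m 0 j ω| ∂μ ≤ 3 * B ^ 4 * δ := by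
  have hV' := hV.iterate j
  have hBδ : ∀ φ, BddBy μ B φ → ∀ r,
      ∫ ω, (relOp μ U V ψ m r φ ω - relOp μ U V ψ m 0 φ ω) ^ 2 ∂μ ≤ (B * δ) ^ 2 := fun φ hφ r =>
    (h r B φ hφ).trans_eq (by ring)
  set p : ℕ → Ω → ℝ := fun s => relOp μ U V ψ m r (orb U ψ (s + r)) with hp
  set q : ℕ → Ω → ℝ := fun s => relOp μ U V ψ m 0 (orb U ψ (s + r)) with hq
  have hpb : ∀ s, BddBy μ (B * (B * B)) (p s) := fun s =>
    bddBy_relOp hU hψ hB hB (hψ.orb hU _) m r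
  have hqb : ∀ s, BddBy μ (B * (B * B)) (q s) := fun s =>
    bddBy_relOp hU hψ hB hB (hψ.orb hU _) m 0
  have hpq : ∀ s, MemLp (fun ω => p s ω - q s ω) 2 μ := fun s =>
    memLp_fun_sub (hpb s).memLp (hqb s).memLp
  have hpq2 : ∀ s, ∫ ω, (p s ω - q s ω) ^ 2 ∂μ ≤ (B * δ) ^ 2 := fun s => hBδ _ (hψ.orb hU _) r
  have hpq2' : ∀ s, ∫ ω, (p s (V^[j] ω) - q s (V^[j] ω)) ^ 2 ∂μ ≤ (B * δ) ^ 2 := fun s => by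
    rw [integral_comp' hV' (hpq s).integrable_sq.1]; exact hpq2 s
  -- Moving the window of the two outer operators back.
  have h1 : ∫ ω, |relKer μ U V ψ m 0 j (U^[r] ω) - relKer μ U V ψ m r j ω| ∂μ
      ≤ 2 * B ^ 4 * δ := by
    have hae : ∀ᵐ ω ∂μ, ∀ s, relOp μ U V ψ m 0 (orb U ψ s) (U^[r] ω) = p s ω :=
      ae_all_iff.2 fun s => relOp_orb_comp_iterate hU hV hUV hψ m s r
    have hbd : ∀ᵐ ω ∂μ, |relKer μ U V ψ m 0 j (U^[r] ω) - relKer μ U V ψ m r j ω|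
        ≤ (m : ℝ)⁻¹ * ∑ s ∈ Finset.range m, (|(p s ω - q s ω) * p s (V^[j] ω)|
          + |q s ω * (p s (V^[j] ω) - q s (V^[j] ω))|) := by
      filter_upwards [hae, hV'.quasiMeasurePreserving.ae hae] with ω h1 h2
      have e : V^[j] (U^[r] ω) = U^[r] (V^[j] ω) :=
        ((hUV.iterate_iterate r j) ω).symm
      have e2 : relKer μ U V ψ m 0 j (U^[r] ω) - relKer μ U V ψ m r j ω
          = (m : ℝ)⁻¹ * ∑ s ∈ Finset.range m, ((p s ω - q s ω) * p s (V^[j] ω)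
          + q s ω * (p s (V^[j] ω) - q s (V^[j] ω))) := by
        simp only [relKer, add_zero, e, h1, h2]
        rw [← mul_sub, ← Finset.sum_sub_distrib]
        congr 1
        refine Finset.sum_congr rfl fun s _ => ?_
        simp only [hq]
        ring
      rw [e2]
      refine (abs_avg_le _ _).trans ?_
      gcongr with s
      exact abs_add_le _ _
    have i1 : ∀ s, Integrable (fun ω => |(p s ω - q s ω) * p s (V^[j] ω)|) μ := fun s =>
      (integrable_mul_of_memLp_two (hpq s) ((hpb s).comp hV').memLp).abs
    have i2 : ∀ s, Integrable (fun ω => |q s ω * (p s (V^[j] ω) - q s (V^[j] ω))|) μ := fun s =>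
      (integrable_mul_of_memLp_two (hqb s).memLp (memLp_comp hV' (hpq s))).abs
    refine (integral_mono_ae ?_ ((integrable_finsetSum _ fun s _ =>
      (i1 s).fun_add (i2 s)).const_mul _) hbd).trans ?_
    · exact (((bddBy_relKer hU hV hψ hB m 0 j).comp (hU.iterate r)).memLp.integrable one_le_two
        |>.sub ((bddBy_relKer hU hV hψ hB m r j).memLp.integrable one_le_two)).abs
    rw [integral_const_mul, integral_finsetSum _ fun s _ => (i1 s).fun_add (i2 s)]
    refine avg_le_of_le (by positivity) fun s _ => ?_
    rw [integral_add (i1 s) (i2 s)]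
    have b1 := integral_abs_mul_le (hpq s) ((hpb s).comp hV').memLp (by positivity)
      (by positivity) (hpq2 s) ((hpb s).comp hV').integral_sq_le
    have b2 := integral_abs_mul_le (hqb s).memLp (memLp_comp hV' (hpq s)) (by positivity)
      (by positivity) (hqb s).integral_sq_le (hpq2' s)
    calc _ ≤ B * δ * (B * (B * B)) + B * (B * B) * (B * δ) := add_le_add b1 b2
      _ = _ := by ring
  -- Moving the window of the inner operator back.
  have h2 : ∫ ω, |relKer μ U V ψ m r j ω - relKer μ U V ψ m 0 j ω| ∂μ ≤ B ^ 4 * δ := by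
    set a : ℕ → ℕ → ℕ → Ω → ℝ := fun r i i' ω => (m : ℝ)⁻¹ * ∑ s ∈ Finset.range m,
      relCorr μ U V ψ i (s + r) ω * relCorr μ U V ψ i' (s + r) ω with ha
    have ha_b : ∀ r i i', BddBy μ (B * B * (B * B)) (a r i i') := fun r i i' =>
      BddBy.avg (by positivity) fun s _ =>
        (bddBy_relCorr hU hψ i (s + r)).mul (bddBy_relCorr hU hψ i' (s + r))
    have ha_eq : ∀ r i i', relExp μ V (fun ω => orb U ψ i ω * relOp μ U V ψ m r (orb U ψ i') ω)
        =ᵐ[μ] a r i i' := by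
      intro r i i'
      refine (relExp_mul_relOp hU hψ (hψ.orb hU i).memLp (hψ.orb hU i').memLp m r).trans ?_
      refine Eventually.of_forall fun ω => ?_
      simp only [ha, relCorr, mul_comm (orb U ψ i _), mul_comm (orb U ψ i' _)]
    have hdiff : ∀ i i', ∫ ω, |a r i i' ω - a 0 i i' ω| ∂μ ≤ B * (B * δ) := by
      intro i i'
      have hm : ∀ r, MemLp (fun ω => orb U ψ i ω * relOp μ U V ψ m r (orb U ψ i') ω) 2 μ :=
        fun r => memLp_orb_mul hU hψ (memLp_relOp hU hψ (hψ.orb hU i').memLp m r) i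
      have e1 : ∫ ω, |a r i i' ω - a 0 i i' ω| ∂μ = ∫ ω, |relExp μ V
          ((fun ω => orb U ψ i ω * relOp μ U V ψ m r (orb U ψ i') ω) -
            (fun ω => orb U ψ i ω * relOp μ U V ψ m 0 (orb U ψ i') ω)) ω| ∂μ := by
        refine integral_congr_ae ?_
        filter_upwards [ha_eq r i i', ha_eq 0 i i', condExp_sub ((hm r).integrable one_le_two)
          ((hm 0).integrable one_le_two) (MeasurableSpace.invariants V)] with ω w1 w2 w3
        refine congrArg abs (Eq.trans ?_ w3.symm)
        rw [Pi.sub_apply]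
        exact (congrArg₂ (· - ·) w1 w2).symm
      rw [e1]
      refine (integral_abs_condExp_le _).trans ?_
      have := integral_abs_mul_le (hψ.orb hU i).memLp (memLp_fun_sub
        (memLp_relOp (V := V) hU hψ (hψ.orb hU i').memLp m r)
        (memLp_relOp (V := V) hU hψ (hψ.orb hU i').memLp m 0)) hB (by positivity)
        (hψ.orb hU i).integral_sq_le (hBδ _ (hψ.orb hU i') r)
      refine le_trans (le_of_eq ?_) this
      congr 1; ext ω
      rw [Pi.sub_apply, mul_sub]
    have hw : ∀ i i', BddBy μ (B * B) (fun ω => orb U ψ i ω * orb U ψ i' (V^[j] ω)) :=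
      fun i i' => (hψ.orb hU i).mul ((hψ.orb hU i').comp hV')
    have ia : ∀ i i', Integrable (fun ω => |a r i i' ω - a 0 i i' ω|) μ := fun i i' =>
      (memLp_fun_sub (ha_b r i i').memLp (ha_b 0 i i').memLp |>.integrable one_le_two).abs
    have hbd : ∀ᵐ ω ∂μ, |relKer μ U V ψ m r j ω - relKer μ U V ψ m 0 j ω|
        ≤ (m : ℝ)⁻¹ * ∑ i ∈ Finset.range m, (m : ℝ)⁻¹ * ∑ i' ∈ Finset.range m,
          B * B * |a r i i' ω - a 0 i i' ω| := by
      have hall : ∀ᵐ ω ∂μ, ∀ i i', |orb U ψ i ω * orb U ψ i' (V^[j] ω)| ≤ B * B :=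
        ae_all_iff.2 fun i => ae_all_iff.2 fun i' => (hw i i').bound
      filter_upwards [hall] with ω hω
      rw [relKer_eq, relKer_eq, ← mul_sub, ← Finset.sum_sub_distrib]
      refine (abs_avg_le _ _).trans ?_
      gcongr with i
      rw [← mul_sub, ← Finset.sum_sub_distrib]
      refine (abs_avg_le _ _).trans ?_
      gcongr with i'
      rw [← mul_sub, abs_mul]
      exact mul_le_mul_of_nonneg_right (hω i i') (abs_nonneg _)
    refine (integral_mono_ae ?_ ((integrable_finsetSum _ fun i _ => (integrable_finsetSum _
      fun i' _ => (ia i i').const_mul _).const_mul _).const_mul _) hbd).trans ?_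
    · exact ((bddBy_relKer hU hV hψ hB m r j).memLp.integrable one_le_two
        |>.sub ((bddBy_relKer hU hV hψ hB m 0 j).memLp.integrable one_le_two)).abs
    rw [integral_const_mul, integral_finsetSum _ fun i _ => (integrable_finsetSum _
      fun i' _ => (ia i i').const_mul _).const_mul _]
    refine avg_le_of_le (by positivity) fun i _ => ?_
    rw [integral_const_mul, integral_finsetSum _ fun i' _ => (ia i i').const_mul _]
    refine avg_le_of_le (by positivity) fun i' _ => ?_
    rw [integral_const_mul]
    calc _ ≤ B * B * (B * (B * δ)) := mul_le_mul_of_nonneg_left (hdiff i i') (by positivity)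
      _ = _ := by ring
  have k1 := (bddBy_relKer hU hV hψ hB m 0 j).memLp (p := 1) |>.integrable le_rfl
  have k2 := (bddBy_relKer hU hV hψ hB m r j).memLp (p := 1) |>.integrable le_rfl
  have k3 := ((bddBy_relKer hU hV hψ hB m 0 j).comp (hU.iterate r)).memLp (p := 1)
    |>.integrable le_rfl
  calc ∫ ω, |relKer μ U V ψ m 0 j (U^[r] ω) - relKer μ U V ψ m 0 j ω| ∂μ
      ≤ ∫ ω, (|relKer μ U V ψ m 0 j (U^[r] ω) - relKer μ U V ψ m r j ω|
        + |relKer μ U V ψ m r j ω - relKer μ U V ψ m 0 j ω|) ∂μ :=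
        integral_mono (k3.sub k1).abs ((k3.sub k2).abs.add (k2.sub k1).abs)
          fun ω => abs_sub_le _ _ _
    _ = _ := integral_add (k3.sub k2).abs (k2.sub k1).abs
    _ ≤ 3 * B ^ 4 * δ := by linarith

/-- Conditioning the kernel on the `U`-invariant sets moves it little, uniformly in `j`. -/
lemma integral_abs_condExp_relKer_sub_le [IsProbabilityMeasure μ] (hU : MeasurePreserving U μ μ)
    (hV : MeasurePreserving V μ μ)
    (hUV : Function.Commute U V) (hψ : BddBy μ B ψ) (hB : 0 ≤ B) {δ : ℝ} (hδ : 0 ≤ δ) {m : ℕ}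
    (h : ∀ (r : ℕ) (D : ℝ) (φ : Ω → ℝ), BddBy μ D φ →
      ∫ ω, (relOp μ U V ψ m r φ ω - relOp μ U V ψ m 0 φ ω) ^ 2 ∂μ ≤ D ^ 2 * δ ^ 2) (j : ℕ) :
    ∫ ω, |relExp μ U (relKer μ U V ψ m 0 j) ω - relKer μ U V ψ m 0 j ω| ∂μ ≤ 3 * B ^ 4 * δ := by
  set κ := relKer μ U V ψ m 0 j with hκ
  have hκb : BddBy μ (B ^ 6) κ := bddBy_relKer hU hV hψ hB m 0 j
  have hκ2 : MemLp κ 2 μ := hκb.memLp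
  have hw2 : MemLp (relExp μ U κ) 2 μ := memLp_relExp hκ2
  have hs : Tendsto (fun n : ℕ => √(∫ ω, ((n : ℝ)⁻¹ * ∑ k ∈ Finset.range n, κ (U^[k] ω)
      - relExp μ U κ ω) ^ 2 ∂μ) + 3 * B ^ 4 * δ) atTop (𝓝 (3 * B ^ 4 * δ)) := by
    simpa using (tendsto_integral_sq_avg_sub_condExp hU hκ2).sqrt.add_const (3 * B ^ 4 * δ)
  refine ge_of_tendsto hs ?_
  filter_upwards [eventually_gt_atTop 0] with n hn
  have hn' : (0 : ℝ) < n := by exact_mod_cast hn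
  have ha := memLp_avg hU hκ2 n
  have h1 : ∫ ω, |(n : ℝ)⁻¹ * ∑ k ∈ Finset.range n, κ (U^[k] ω) - relExp μ U κ ω| ∂μ
      ≤ √(∫ ω, ((n : ℝ)⁻¹ * ∑ k ∈ Finset.range n, κ (U^[k] ω) - relExp μ U κ ω) ^ 2 ∂μ) :=
    integral_abs_le_of_sq (memLp_fun_sub ha hw2) (Real.sqrt_nonneg _)
      (Real.sq_sqrt (integral_nonneg fun ω => sq_nonneg _)).ge
  have hi : ∀ k, Integrable (fun ω => |κ (U^[k] ω) - κ ω|) μ := fun k =>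
    (memLp_fun_sub (memLp_comp (hU.iterate k) hκ2) hκ2 |>.integrable one_le_two).abs
  have h2 : ∫ ω, |(n : ℝ)⁻¹ * ∑ k ∈ Finset.range n, κ (U^[k] ω) - κ ω| ∂μ ≤ 3 * B ^ 4 * δ := by
    calc _ ≤ ∫ ω, (n : ℝ)⁻¹ * ∑ k ∈ Finset.range n, |κ (U^[k] ω) - κ ω| ∂μ := by
          refine integral_mono (memLp_fun_sub ha hκ2 |>.integrable one_le_two).abs
            ((integrable_finsetSum _ fun k _ => hi k).const_mul _) fun ω => ?_
          refine le_trans (le_of_eq ?_) (abs_avg_le _ _)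
          rw [Finset.sum_sub_distrib, mul_sub]
          simp [hn'.ne']
      _ = (n : ℝ)⁻¹ * ∑ k ∈ Finset.range n, ∫ ω, |κ (U^[k] ω) - κ ω| ∂μ := by
          rw [integral_const_mul, integral_finsetSum _ fun k _ => hi k]
      _ ≤ _ := avg_le_of_le (by positivity) fun k _ =>
          integral_abs_relKer_comp_sub_le hU hV hUV hψ hB hδ h k j
  have i1 := (memLp_fun_sub ha hw2 |>.integrable one_le_two).abs
  have i2 := (memLp_fun_sub ha hκ2 |>.integrable one_le_two).abs
  calc ∫ ω, |relExp μ U κ ω - κ ω| ∂μ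
      ≤ ∫ ω, (|(n : ℝ)⁻¹ * ∑ k ∈ Finset.range n, κ (U^[k] ω) - relExp μ U κ ω|
        + |(n : ℝ)⁻¹ * ∑ k ∈ Finset.range n, κ (U^[k] ω) - κ ω|) ∂μ := by
        refine integral_mono (memLp_fun_sub hw2 hκ2 |>.integrable one_le_two).abs
          (i1.fun_add i2) fun ω => ?_
        have := abs_sub_le (relExp μ U κ ω) ((n : ℝ)⁻¹ * ∑ k ∈ Finset.range n, κ (U^[k] ω)) (κ ω)
        rwa [abs_sub_comm (relExp μ U κ ω) (_ * _)] at this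
    _ = _ := integral_add i1 i2
    _ ≤ _ := add_le_add h1 h2

end RelOp

/-! ### Vanishing of the relative correlations -/

section RelCorr

variable {Ω : Type*} [mΩ : MeasurableSpace Ω] {μ : Measure Ω} {U V : Ω → Ω} {ψ : Ω → ℝ} {B : ℝ}

/-- `f` decorrelates from every product of `θ ∘ V^j` with a bounded sequence of `U`-invariant
functions, as `j → ∞`. -/
def Decorrelates (μ : Measure Ω) (U V : Ω → Ω) (f θ : Ω → ℝ) : Prop :=
  ∀ (R : ℝ) (w : ℕ → Ω → ℝ), (∀ j, StronglyMeasurable[MeasurableSpace.invariants U] (w j)) →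
    (∀ j, ∀ᵐ ω ∂μ, |w j ω| ≤ R) →
    Tendsto (fun j => ∫ ω, f ω * (θ (V^[j] ω) * w j ω) ∂μ) atTop (𝓝 0)

lemma integral_sq_relOp_le' [IsProbabilityMeasure μ] (hU : MeasurePreserving U μ μ)
    (hψ : BddBy μ B ψ) {x : Ω → ℝ} (hx : MemLp x 2 μ) (m r : ℕ) :
    ∫ ω, relOp μ U V ψ m r x ω ^ 2 ∂μ ≤ B ^ 4 * ∫ ω, x ω ^ 2 ∂μ := by
  have h1 := integral_sq_relOp_le (V := V) hU hψ hx m r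
  have h2 := sq_integral_mul_le hx (memLp_relOp (V := V) hU hψ hx m r)
  have h3 : 0 ≤ ∫ ω, relOp μ U V ψ m r x ω ^ 2 ∂μ := integral_nonneg fun ω => sq_nonneg _
  have h4 : 0 ≤ ∫ ω, x ω ^ 2 ∂μ := integral_nonneg fun ω => sq_nonneg _
  set N := ∫ ω, relOp μ U V ψ m r x ω ^ 2 ∂μ
  set c := ∫ ω, x ω * relOp μ U V ψ m r x ω ∂μ
  have h5 : N * N ≤ B ^ 4 * (∫ ω, x ω ^ 2 ∂μ) * N := by
    calc N * N ≤ (B ^ 2 * c) * (B ^ 2 * c) := mul_self_le_mul_self h3 h1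
      _ = B ^ 4 * c ^ 2 := by ring
      _ ≤ B ^ 4 * ((∫ ω, x ω ^ 2 ∂μ) * N) := by gcongr
      _ = _ := by ring
  rcases h3.eq_or_lt with h0 | h0
  · rw [← h0]; positivity
  · exact le_of_mul_le_mul_right h5 h0

/-- If `f` decorrelates from `θ`, then the cube of the correlation operator has a small matrix
coefficient at `(f, θ)` as soon as the operator hardly depends on its window: the kernel of the
cube is uniformly close to a sequence of exactly `U`-invariant functions. -/
lemma abs_integral_relOp_cube_le [IsProbabilityMeasure μ] (hU : MeasurePreserving U μ μ)
    (hV : MeasurePreserving V μ μ)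
    (hUV : Function.Commute U V) (hψ : BddBy μ B ψ) (hB : 0 ≤ B) {δ : ℝ} (hδ : 0 ≤ δ) {m : ℕ}
    (h : ∀ (r : ℕ) (D : ℝ) (φ : Ω → ℝ), BddBy μ D φ →
      ∫ ω, (relOp μ U V ψ m r φ ω - relOp μ U V ψ m 0 φ ω) ^ 2 ∂μ ≤ D ^ 2 * δ ^ 2)
    {f θ : Ω → ℝ} {D : ℝ} (hf : MemLp f 2 μ) (hθ : BddBy μ D θ) (hfθ : Decorrelates μ U V f θ) :
    |∫ ω, relOp μ U V ψ m 0 f ω * relOp μ U V ψ m 0 (relOp μ U V ψ m 0 θ) ω ∂μ|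
      ≤ √((∫ ω, f ω ^ 2 ∂μ) * (D ^ 2 * (2 * B ^ 6 * (3 * B ^ 4 * δ)))) := by
  set κ := relKer μ U V ψ m 0 with hκ
  set k : ℕ → Ω → ℝ := fun s => relOp μ U V ψ m 0 (orb U ψ s) with hk
  have hkb : ∀ s, BddBy μ (B * (B * B)) (k s) := fun s =>
    bddBy_relOp hU hψ hB hB (hψ.orb hU _) m 0
  have hκb : ∀ j, BddBy μ (B ^ 6) (κ j) := fun j => bddBy_relKer hU hV hψ hB m 0 j
  have hθ2 : MemLp θ 2 μ := hθ.memLp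
  have hfk : ∀ s, MemLp (fun ω => k s ω * f ω) 2 μ := fun s => (hkb s).mul_memLp hf
  have hθk : ∀ s, MemLp (fun ω => k s ω * θ ω) 2 μ := fun s => (hkb s).mul_memLp hθ2
  -- The matrix coefficient as a limit of averages over `j`.
  have hrel : ∀ x, MemLp x 2 μ → ∀ s, relExp μ V (fun ω => k s ω * x ω)
      =ᵐ[μ] relExp μ V (fun ω => orb U ψ (s + 0) ω * relOp μ U V ψ m 0 x ω) := by
    intro x hx s
    have e1 := relExp_mul_relOp (V := V) hU hψ hx (hψ.orb hU s).memLp m 0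
    have e2 := relExp_mul_relOp (V := V) hU hψ (hψ.orb hU s).memLp hx m 0
    have e3 : (fun ω => k s ω * x ω) = fun ω => x ω * relOp μ U V ψ m 0 (orb U ψ s) ω := by
      ext ω; rw [mul_comm]
    rw [e3]
    refine e1.trans (EventuallyEq.trans ?_ e2.symm)
    refine Eventually.of_forall fun ω => ?_
    simp only
    congr 1
    exact Finset.sum_congr rfl fun i _ => mul_comm _ _
  have hlim : Tendsto (fun n : ℕ => (n : ℝ)⁻¹ * ∑ j ∈ Finset.range n,
      ∫ ω, f ω * (θ (V^[j] ω) * κ j ω) ∂μ) atTop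
      (𝓝 (∫ ω, relOp μ U V ψ m 0 f ω * relOp μ U V ψ m 0 (relOp μ U V ψ m 0 θ) ω ∂μ)) := by
    have h1 := (tendsto_finsetSum (Finset.range m) fun s _ =>
      tendsto_avg_integral_mul_comp hV (hfk s) (hθk s)).const_mul (m : ℝ)⁻¹
    have e : (m : ℝ)⁻¹ * ∑ s ∈ Finset.range m,
        ∫ ω, (k s ω * f ω) * relExp μ V (fun ω => k s ω * θ ω) ω ∂μ
        = ∫ ω, relOp μ U V ψ m 0 f ω * relOp μ U V ψ m 0 (relOp μ U V ψ m 0 θ) ω ∂μ := by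
      rw [integral_mul_relOp hU hψ (memLp_relOp hU hψ hf m 0) (memLp_relOp hU hψ hθ2 m 0)]
      congr 1
      refine Finset.sum_congr rfl fun s _ => ?_
      rw [integral_mul_relExp (hfk s) (hθk s)]
      refine integral_congr_ae ?_
      filter_upwards [hrel f hf s, hrel θ hθ2 s] with ω w1 w2
      rw [w1, w2]
    rw [← e]
    refine h1.congr fun n => ?_
    simp only [Finset.mul_sum]
    rw [Finset.sum_comm]
    refine Finset.sum_congr rfl fun j _ => ?_
    have : ∀ ω, f ω * (θ (V^[j] ω) * κ j ω) = (m : ℝ)⁻¹ * ∑ s ∈ Finset.range m,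
        (k s ω * f ω) * (k s (V^[j] ω) * θ (V^[j] ω)) := by
      intro ω
      simp only [hκ, relKer, Finset.mul_sum, add_zero]
      refine Finset.sum_congr rfl fun s _ => ?_
      simp only [hk]
      ring
    simp only [this]
    rw [integral_const_mul, integral_finsetSum _ fun s _ =>
      integrable_mul_of_memLp_two (hfk s) (memLp_comp (hV.iterate j) (hθk s)),
      Finset.mul_sum, Finset.mul_sum]
    refine Finset.sum_congr rfl fun s _ => ?_
    ring
  -- Replacing the kernel by its projection on the invariant functions costs little.
  set w : ℕ → Ω → ℝ := fun j => relExp μ U (κ j) with hw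
  have hwb : ∀ j, BddBy μ (B ^ 6) (w j) := fun j => (hκb j).relExp
  have hces := (hfθ (B ^ 6) w (fun j => stronglyMeasurable_condExp) fun j => (hwb j).bound).cesaro
  have hsub : ∀ j, |∫ ω, f ω * (θ (V^[j] ω) * κ j ω) ∂μ - ∫ ω, f ω * (θ (V^[j] ω) * w j ω) ∂μ|
      ≤ √((∫ ω, f ω ^ 2 ∂μ) * (D ^ 2 * (2 * B ^ 6 * (3 * B ^ 4 * δ)))) := by
    intro j
    have hθj := hθ.comp (hV.iterate j)
    have m1 : MemLp (fun ω => θ (V^[j] ω) * κ j ω) 2 μ := (hθj.mul (hκb j)).memLp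
    have m2 : MemLp (fun ω => θ (V^[j] ω) * w j ω) 2 μ := (hθj.mul (hwb j)).memLp
    have m3 : MemLp (fun ω => κ j ω - w j ω) 2 μ := memLp_fun_sub (hκb j).memLp (hwb j).memLp
    rw [← integral_sub (integrable_mul_of_memLp_two hf m1) (integrable_mul_of_memLp_two hf m2)]
    have e : ∀ ω, f ω * (θ (V^[j] ω) * κ j ω) - f ω * (θ (V^[j] ω) * w j ω)
        = f ω * (θ (V^[j] ω) * (κ j ω - w j ω)) := fun ω => by ring
    simp only [e]
    refine Real.abs_le_sqrt ((sq_integral_mul_le hf (hθj.mul_memLp m3)).trans ?_)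
    have hf0 : 0 ≤ ∫ ω, f ω ^ 2 ∂μ := integral_nonneg fun ω => sq_nonneg _
    refine mul_le_mul_of_nonneg_left ((hθj.integral_sq_mul_le m3).trans
      (mul_le_mul_of_nonneg_left ?_ (sq_nonneg D))) hf0
    have hle : ∫ ω, (κ j ω - w j ω) ^ 2 ∂μ ≤ ∫ ω, 2 * B ^ 6 * |w j ω - κ j ω| ∂μ := by
      refine integral_mono_ae m3.integrable_sq
        ((memLp_fun_sub (hwb j).memLp (hκb j).memLp |>.integrable one_le_two).abs.const_mul _) ?_
      filter_upwards [(hκb j).bound, (hwb j).bound] with ω b1 b2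
      rw [← sq_abs, sq, abs_sub_comm]
      refine mul_le_mul_of_nonneg_right ?_ (abs_nonneg _)
      have := abs_sub (w j ω) (κ j ω)
      linarith
    refine hle.trans ?_
    rw [integral_const_mul]
    exact mul_le_mul_of_nonneg_left
      (integral_abs_condExp_relKer_sub_le hU hV hUV hψ hB hδ h j) (by positivity)
  have hdiff := hlim.sub hces
  rw [sub_zero] at hdiff
  refine le_of_tendsto' hdiff.abs fun n => ?_
  rw [← mul_sub, ← Finset.sum_sub_distrib]
  refine (abs_avg_le _ _).trans (avg_le_of_le (Real.sqrt_nonneg _) fun j _ => hsub j)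

/-- The averaged relative correlations of `f` with the orbit of a bounded function vanish in the
limit, if `f` can be approximated by bounded functions from which it decorrelates. -/
theorem tendsto_integral_mul_relOp [IsProbabilityMeasure μ] (hU : MeasurePreserving U μ μ)
    (hV : MeasurePreserving V μ μ) (hUV : Function.Commute U V) (hψ : BddBy μ B ψ) (hB : 0 ≤ B)
    {f : Ω → ℝ} (hf : MemLp f 2 μ)
    (happ : ∀ ε > 0, ∃ (D : ℝ) (θ : Ω → ℝ), BddBy μ D θ ∧ Decorrelates μ U V f θ ∧
      ∫ ω, (f ω - θ ω) ^ 2 ∂μ ≤ ε) :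
    Tendsto (fun m => ∫ ω, f ω * relOp μ U V ψ m 0 f ω ∂μ) atTop (𝓝 0) := by
  have hf0 : 0 ≤ ∫ ω, f ω ^ 2 ∂μ := integral_nonneg fun ω => sq_nonneg _
  set K : ℕ → (Ω → ℝ) → Ω → ℝ := fun m => relOp μ U V ψ m 0 with hK
  have hKm : ∀ m x, MemLp x 2 μ → MemLp (K m x) 2 μ := fun m x hx => memLp_relOp hU hψ hx m 0
  have hsymm : ∀ m x y, MemLp x 2 μ → MemLp y 2 μ →
      ∫ ω, x ω * K m y ω ∂μ = ∫ ω, y ω * K m x ω ∂μ := fun m x y hx hy =>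
    integral_mul_relOp_comm hU hψ hx hy m 0
  have ht : Tendsto (fun m => ∫ ω, K m f ω * K m (K m f) ω ∂μ) atTop (𝓝 0) := by
    rw [Metric.tendsto_atTop]
    intro ε hε
    obtain ⟨D, θ, hθ, hfθ, hfθ2⟩ := happ ((ε / 3) ^ 2 / (B ^ 12 * (∫ ω, f ω ^ 2 ∂μ) + 1))
      (by positivity)
    have hθ2 : MemLp θ 2 μ := hθ.memLp
    obtain ⟨δ, hδ, hδε⟩ : ∃ δ > 0,
        √((∫ ω, f ω ^ 2 ∂μ) * (D ^ 2 * (2 * B ^ 6 * (3 * B ^ 4 * δ)))) ≤ ε / 3 := by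
      refine ⟨(ε / 3) ^ 2 / ((∫ ω, f ω ^ 2 ∂μ) * (D ^ 2 * (2 * B ^ 6 * (3 * B ^ 4))) + 1),
        by positivity, ?_⟩
      refine Real.sqrt_le_iff.2 ⟨by positivity, ?_⟩
      have hc : 0 ≤ (∫ ω, f ω ^ 2 ∂μ) * (D ^ 2 * (2 * B ^ 6 * (3 * B ^ 4))) := by positivity
      set c := (∫ ω, f ω ^ 2 ∂μ) * (D ^ 2 * (2 * B ^ 6 * (3 * B ^ 4))) with hcdef
      calc _ = c * ((ε / 3) ^ 2 / (c + 1)) := by rw [hcdef]; ring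
        _ ≤ (ε / 3) ^ 2 := by
          rw [mul_div_assoc', div_le_iff₀ (by positivity)]
          nlinarith [sq_nonneg (ε / 3)]
    obtain ⟨m₀, -, h⟩ := exists_forall_integral_sq_relOp_sub_le hU hV hUV hψ (pow_pos hδ 2)
    refine ⟨m₀, fun m hm => ?_⟩
    have h1 := abs_integral_relOp_cube_le hU hV hUV hψ hB hδ.le (h m hm) hf hθ hfθ
    have e1 : ∀ x, MemLp x 2 μ → ∫ ω, K m f ω * K m (K m x) ω ∂μ
        = ∫ ω, x ω * K m (K m (K m f)) ω ∂μ := by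
      intro x hx
      rw [hsymm m _ _ (hKm m _ hf) (hKm m _ hx)]
      have : ∀ ω, K m x ω * K m (K m f) ω = K m (K m f) ω * K m x ω := fun ω => mul_comm _ _
      simp only [this]
      exact hsymm m _ _ (hKm m _ (hKm m _ hf)) hx
    have h3 := hKm m _ (hKm m _ (hKm m _ hf))
    have h4 : |∫ ω, (f ω - θ ω) * K m (K m (K m f)) ω ∂μ| ≤ ε / 3 := by
      refine abs_le_of_sq_le_sq ((sq_integral_mul_le (memLp_fun_sub hf hθ2) h3).trans ?_)
        (by positivity)
      have b1 := integral_sq_relOp_le' (V := V) hU hψ (hKm m _ (hKm m _ hf)) m 0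
      have b2 := integral_sq_relOp_le' (V := V) hU hψ (hKm m _ hf) m 0
      have b3 := integral_sq_relOp_le' (V := V) hU hψ hf m 0
      have b4 : ∫ ω, K m (K m (K m f)) ω ^ 2 ∂μ ≤ B ^ 12 * ∫ ω, f ω ^ 2 ∂μ := by
        calc _ ≤ B ^ 4 * (B ^ 4 * (B ^ 4 * ∫ ω, f ω ^ 2 ∂μ)) := by
              refine b1.trans (mul_le_mul_of_nonneg_left (b2.trans
                (mul_le_mul_of_nonneg_left b3 (by positivity))) (by positivity))
          _ = _ := by ring
      calc _ ≤ ((ε / 3) ^ 2 / (B ^ 12 * (∫ ω, f ω ^ 2 ∂μ) + 1)) * (B ^ 12 * ∫ ω, f ω ^ 2 ∂μ) :=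
            mul_le_mul hfθ2 b4 (integral_nonneg fun ω => sq_nonneg _) (by positivity)
        _ ≤ (ε / 3) ^ 2 := by
          rw [div_mul_eq_mul_div, div_le_iff₀ (by positivity)]
          nlinarith [sq_nonneg (ε / 3)]
    have e2 : ∫ ω, K m f ω * K m (K m f) ω ∂μ = ∫ ω, K m f ω * K m (K m θ) ω ∂μ
        + ∫ ω, (f ω - θ ω) * K m (K m (K m f)) ω ∂μ := by
      rw [e1 f hf, e1 θ hθ2, ← integral_add (integrable_mul_of_memLp_two hθ2 h3)
        (integrable_mul_of_memLp_two (memLp_fun_sub hf hθ2) h3)]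
      congr 1; ext ω; ring
    rw [Real.dist_eq, sub_zero, e2]
    refine (abs_add_le _ _).trans_lt ?_
    have := h1.trans hδε
    linarith
  have h4 : Tendsto (fun m => (∫ ω, f ω * K m f ω ∂μ) ^ 4) atTop (𝓝 0) := by
    have hz := ht.const_mul ((∫ ω, f ω ^ 2 ∂μ) ^ 3 * B ^ 2)
    rw [mul_zero] at hz
    refine squeeze_zero (fun m => by positivity) (fun m => ?_) hz
    have b1 := integral_sq_relOp_le (V := V) hU hψ (hKm m _ hf) m 0
    have b2 := sq_integral_mul_le hf (hKm m _ (hKm m _ hf))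
    have b3 := sq_integral_mul_le hf (hKm m _ hf)
    rw [hsymm m _ _ hf (hKm m _ hf)] at b2
    simp only [← sq] at b2
    calc (∫ ω, f ω * K m f ω ∂μ) ^ 4 = ((∫ ω, f ω * K m f ω ∂μ) ^ 2) ^ 2 := by ring
      _ ≤ ((∫ ω, f ω ^ 2 ∂μ) * ∫ ω, K m f ω ^ 2 ∂μ) ^ 2 := by gcongr
      _ = (∫ ω, f ω ^ 2 ∂μ) ^ 2 * (∫ ω, K m f ω ^ 2 ∂μ) ^ 2 := by ring
      _ ≤ (∫ ω, f ω ^ 2 ∂μ) ^ 2 * ((∫ ω, f ω ^ 2 ∂μ) *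
          (B ^ 2 * ∫ ω, K m f ω * K m (K m f) ω ∂μ)) := by
          refine mul_le_mul_of_nonneg_left (b2.trans ?_) (by positivity)
          exact mul_le_mul_of_nonneg_left b1 hf0
      _ = _ := by ring
  have h5 := (h4.sqrt).sqrt
  simp only [Real.sqrt_zero] at h5
  rw [tendsto_zero_iff_abs_tendsto_zero]
  refine h5.congr fun m => ?_
  rw [show (∫ ω, f ω * K m f ω ∂μ) ^ 4 = ((∫ ω, f ω * K m f ω ∂μ) ^ 2) ^ 2 by ring,
    Real.sqrt_sq (sq_nonneg _), Real.sqrt_sq_eq_abs]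
  rfl

/-! ### Fourth moments and truncation -/

lemma memLp_mul_of_memLp_four {f g : Ω → ℝ} (hf : MemLp f 4 μ) (hg : MemLp g 4 μ) :
    MemLp (fun ω => f ω * g ω) 2 μ := by
  have : ENNReal.HolderTriple 4 4 2 := ⟨by
    have h1 : ((4 : ℝ≥0∞))⁻¹ = 2⁻¹ * 2⁻¹ := by
      rw [← ENNReal.mul_inv (by simp) (by simp)]; norm_num
    rw [h1, ← mul_add, ENNReal.inv_two_add_inv_two, mul_one]⟩
  exact MemLp.mul hg hf

lemma memLp_sq_of_memLp_four {f : Ω → ℝ} (hf : MemLp f 4 μ) : MemLp (fun ω => f ω ^ 2) 2 μ := by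
  simpa only [sq] using memLp_mul_of_memLp_four hf hf

lemma integrable_pow_four {f : Ω → ℝ} (hf : MemLp f 4 μ) : Integrable (fun ω => f ω ^ 4) μ := by
  have := (memLp_sq_of_memLp_four hf).integrable_sq
  refine this.congr (Eventually.of_forall fun ω => ?_)
  simp only; ring

lemma sq_integral_sq_mul_le {f g : Ω → ℝ} (hf : MemLp f 4 μ) (hg : MemLp g 4 μ) :
    (∫ ω, (f ω * g ω) ^ 2 ∂μ) ^ 2 ≤ (∫ ω, f ω ^ 4 ∂μ) * ∫ ω, g ω ^ 4 ∂μ := by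
  have h := sq_integral_mul_le (memLp_sq_of_memLp_four hf) (memLp_sq_of_memLp_four hg)
  simp only [← mul_pow, ← pow_mul] at h
  exact h

/-- Truncation of a real number to the interval `[-N, N]`. -/
def clamp (N x : ℝ) : ℝ := max (-N) (min x N)

lemma continuous_clamp (N : ℝ) : Continuous (clamp N) := by unfold clamp; fun_prop

lemma abs_clamp_le {N : ℝ} (hN : 0 ≤ N) (x : ℝ) : |clamp N x| ≤ N := by
  unfold clamp
  rw [abs_le]
  exact ⟨le_max_left _ _, max_le (by linarith) (min_le_right _ _)⟩

lemma abs_sub_clamp_le {N : ℝ} (hN : 0 ≤ N) (x : ℝ) : |x - clamp N x| ≤ |x| := by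
  unfold clamp
  rcases le_total x N with h1 | h1
  · rw [min_eq_left h1]
    rcases le_total (-N) x with h2 | h2
    · rw [max_eq_right h2]; simp
    · rw [max_eq_left h2, abs_of_nonpos (by linarith), abs_of_nonpos (by linarith)]; linarith
  · rw [min_eq_right h1, max_eq_right (by linarith), abs_of_nonneg (by linarith),
      abs_of_nonneg (by linarith)]
    linarith

lemma clamp_of_abs_le {N x : ℝ} (h : |x| ≤ N) : clamp N x = x := by
  unfold clamp
  rw [abs_le] at h
  rw [min_eq_left h.2, max_eq_right h.1]

lemma bddBy_clamp {f : Ω → ℝ} (hf : AEStronglyMeasurable f μ) (N : ℕ) :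
    BddBy μ N (fun ω => clamp N (f ω)) :=
  ⟨(continuous_clamp N).comp_aestronglyMeasurable hf,
    Eventually.of_forall fun _ => abs_clamp_le (Nat.cast_nonneg N) _⟩

lemma tendsto_integral_sub_clamp_pow {f : Ω → ℝ} (hf : AEStronglyMeasurable f μ) {k : ℕ}
    (hk : Even k) (hk0 : k ≠ 0) (hfk : Integrable (fun ω => f ω ^ k) μ) :
    Tendsto (fun N : ℕ => ∫ ω, (f ω - clamp N (f ω)) ^ k ∂μ) atTop (𝓝 0) := by
  have h := tendsto_integral_of_dominated_convergence (μ := μ)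
    (F := fun (N : ℕ) ω => (f ω - clamp N (f ω)) ^ k) (f := fun _ => (0 : ℝ))
    (fun ω => f ω ^ k)
    (fun N => (hf.sub ((continuous_clamp N).comp_aestronglyMeasurable hf)).pow k) hfk
    (fun N => Eventually.of_forall fun ω => by
      rw [Real.norm_eq_abs, abs_pow, ← hk.pow_abs (f ω)]
      exact pow_le_pow_left₀ (abs_nonneg _) (abs_sub_clamp_le (Nat.cast_nonneg N) _) k)
    (Eventually.of_forall fun ω => by
      obtain ⟨N₀, hN₀⟩ := exists_nat_ge |f ω|
      refine tendsto_const_nhds.congr' ?_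
      filter_upwards [eventually_ge_atTop N₀] with N hN
      have : |f ω| ≤ N := hN₀.trans (by exact_mod_cast hN)
      rw [clamp_of_abs_le this, sub_self, zero_pow hk0])
  simpa using h

/-- If `f ∈ L⁴` decorrelates from its truncations, then the conditional correlations
`E[f · f ∘ U^r | V]` vanish in `L²`, on average over `r`. -/
theorem tendsto_avg_integral_sq_relExp [IsProbabilityMeasure μ] (hU : MeasurePreserving U μ μ)
    (hV : MeasurePreserving V μ μ) (hUV : Function.Commute U V) {f : Ω → ℝ} (hf : MemLp f 4 μ)
    (hdec : ∀ N : ℕ, Decorrelates μ U V f (fun ω => clamp N (f ω))) :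
    Tendsto (fun m : ℕ => (m : ℝ)⁻¹ * ∑ r ∈ Finset.range m,
      ∫ ω, relExp μ V (fun ω => f (U^[r] ω) * f ω) ω ^ 2 ∂μ) atTop (𝓝 0) := by
  have hf2 : MemLp f 2 μ := hf.mono_exponent (by norm_num)
  have happ : ∀ ε > 0, ∃ (D : ℝ) (θ : Ω → ℝ), BddBy μ D θ ∧ Decorrelates μ U V f θ ∧
      ∫ ω, (f ω - θ ω) ^ 2 ∂μ ≤ ε := by
    intro ε hε
    obtain ⟨N, hN⟩ := ((tendsto_integral_sub_clamp_pow hf.1 even_two two_ne_zero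
      hf2.integrable_sq).eventually (ge_mem_nhds hε)).exists
    exact ⟨N, _, bddBy_clamp hf.1 N, hdec N, hN⟩
  rw [Metric.tendsto_atTop]
  intro ε hε
  obtain ⟨N, hN⟩ : ∃ N : ℕ, √((∫ ω, (f ω - clamp N (f ω)) ^ 4 ∂μ) * ∫ ω, f ω ^ 4 ∂μ)
      < ε / 4 := by
    have h := ((tendsto_integral_sub_clamp_pow hf.1 (by decide : Even 4) (by norm_num)
      (integrable_pow_four hf)).mul_const (∫ ω, f ω ^ 4 ∂μ)).sqrt
    simp only [zero_mul, Real.sqrt_zero] at h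
    exact (h.eventually (gt_mem_nhds (show (0 : ℝ) < ε / 4 by positivity))).exists
  set ψ : Ω → ℝ := fun ω => clamp N (f ω) with hψdef
  have hψ : BddBy μ N ψ := bddBy_clamp hf.1 N
  have hlim := tendsto_integral_mul_relOp hU hV hUV hψ (Nat.cast_nonneg N) hf2 happ
  obtain ⟨m₀, hm₀⟩ := Metric.tendsto_atTop.1 hlim (ε / 4) (by positivity)
  refine ⟨m₀, fun m hm => ?_⟩
  have h1 := hm₀ m hm
  rw [Real.dist_eq, sub_zero, integral_mul_relOp hU hψ hf2 hf2] at h1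
  have hg4 : MemLp (fun ω => f ω - ψ ω) 4 μ := memLp_fun_sub hf hψ.memLp
  have hr : ∀ r, ∫ ω, relExp μ V (fun ω => f (U^[r] ω) * f ω) ω ^ 2 ∂μ
      ≤ 2 * ∫ ω, relExp μ V (fun ω => orb U ψ (r + 0) ω * f ω) ω
          * relExp μ V (fun ω => orb U ψ (r + 0) ω * f ω) ω ∂μ + ε / 2 := by
    intro r
    have hUr := hU.iterate r
    have m1 : MemLp (fun ω => orb U ψ r ω * f ω) 2 μ := memLp_orb_mul hU hψ hf2 r
    have m2 : MemLp (fun ω => (f (U^[r] ω) - ψ (U^[r] ω)) * f ω) 2 μ :=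
      memLp_mul_of_memLp_four (memLp_comp hUr hg4) hf
    have hae : relExp μ V (fun ω => f (U^[r] ω) * f ω) =ᵐ[μ] fun ω =>
        relExp μ V (fun ω => orb U ψ r ω * f ω) ω
        + relExp μ V (fun ω => (f (U^[r] ω) - ψ (U^[r] ω)) * f ω) ω := by
      have e : (fun ω => f (U^[r] ω) * f ω) = (fun ω => orb U ψ r ω * f ω)
          + fun ω => (f (U^[r] ω) - ψ (U^[r] ω)) * f ω := by
        ext ω; simp only [orb, Pi.add_apply]; ring
      rw [e]
      exact condExp_add (m1.integrable one_le_two) (m2.integrable one_le_two) _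
    have b1 : ∫ ω, relExp μ V (fun ω => (f (U^[r] ω) - ψ (U^[r] ω)) * f ω) ω ^ 2 ∂μ ≤ ε / 4 := by
      refine (integral_sq_relExp_le m2).trans (le_trans ?_ hN.le)
      refine Real.le_sqrt_of_sq_le ((sq_integral_sq_mul_le (memLp_comp hUr hg4) hf).trans ?_)
      rw [integral_comp' (g := fun ω => (f ω - ψ ω) ^ 4) hUr (integrable_pow_four hg4).1]
    calc ∫ ω, relExp μ V (fun ω => f (U^[r] ω) * f ω) ω ^ 2 ∂μ
        ≤ ∫ ω, (2 * relExp μ V (fun ω => orb U ψ r ω * f ω) ω ^ 2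
          + 2 * relExp μ V (fun ω => (f (U^[r] ω) - ψ (U^[r] ω)) * f ω) ω ^ 2) ∂μ := by
          refine integral_mono_ae (memLp_relExp
            (memLp_mul_of_memLp_four (memLp_comp hUr hf) hf)).integrable_sq
            (((memLp_relExp m1).integrable_sq.const_mul 2).fun_add
              ((memLp_relExp m2).integrable_sq.const_mul 2)) ?_
          filter_upwards [hae] with ω hω
          rw [hω]
          nlinarith [sq_nonneg (relExp μ V (fun ω => orb U ψ r ω * f ω) ω
            - relExp μ V (fun ω => (f (U^[r] ω) - ψ (U^[r] ω)) * f ω) ω)]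
      _ = 2 * ∫ ω, relExp μ V (fun ω => orb U ψ r ω * f ω) ω ^ 2 ∂μ + 2 * ∫ ω,
          relExp μ V (fun ω => (f (U^[r] ω) - ψ (U^[r] ω)) * f ω) ω ^ 2 ∂μ := by
          rw [integral_add ((memLp_relExp m1).integrable_sq.const_mul 2)
              ((memLp_relExp m2).integrable_sq.const_mul 2), integral_const_mul,
              integral_const_mul]
      _ ≤ _ := by
          simp only [add_zero, ← sq]
          linarith
  rw [Real.dist_eq, sub_zero, abs_of_nonneg (mul_nonneg (by positivity)
    (Finset.sum_nonneg fun r _ => integral_nonneg fun ω => sq_nonneg _))]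
  have hA := (le_abs_self _).trans_lt h1
  rcases Nat.eq_zero_or_pos m with rfl | hm0
  · simpa using hε
  have hm' : (0 : ℝ) < m := by exact_mod_cast hm0
  calc _ ≤ (m : ℝ)⁻¹ * ∑ r ∈ Finset.range m,
        (2 * ∫ ω, relExp μ V (fun ω => orb U ψ (r + 0) ω * f ω) ω
          * relExp μ V (fun ω => orb U ψ (r + 0) ω * f ω) ω ∂μ + ε / 2) := by
        gcongr with r
        exact hr r
    _ = 2 * ((m : ℝ)⁻¹ * ∑ r ∈ Finset.range m,
        ∫ ω, relExp μ V (fun ω => orb U ψ (r + 0) ω * f ω) ω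
          * relExp μ V (fun ω => orb U ψ (r + 0) ω * f ω) ω ∂μ) + ε / 2 := by
        rw [Finset.sum_add_distrib, ← Finset.mul_sum]
        simp only [Finset.sum_const, Finset.card_range, nsmul_eq_mul]
        field_simp
    _ < ε := by linarith

end RelCorr

/-! ### A quantitative martingale central limit theorem -/

section CLT

/-- The real part `t² min(x², 1) / 2` of the exponent cancels the second order term of the
exponential for `|x| ≤ 1`; the truncation keeps the exponential bounded for large `x`, where the
cube dominates. -/
lemma exists_norm_exp_sub_le (t : ℝ) : ∃ K : ℝ, 0 ≤ K ∧ ∀ x : ℝ,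
    ‖Complex.exp (t * x * Complex.I + (t ^ 2 * min (x ^ 2) 1 / 2 : ℝ)) - 1 - t * x * Complex.I‖
      ≤ K * |x| ^ 3 := by
  set a : ℝ := |t| + t ^ 2 with ha
  have ha0 : 0 ≤ a := by positivity
  refine ⟨a ^ 3 * Real.exp a + |t| ^ 3 + t ^ 4 + (Real.exp (t ^ 2) + 1 + |t|), by positivity,
    fun x => ?_⟩
  rcases le_total |x| 1 with hx | hx
  · have hx2 : x ^ 2 ≤ 1 := by rw [← sq_abs]; exact pow_le_one₀ (abs_nonneg x) hx
    rw [min_eq_left hx2]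
    set z : ℂ := t * x * Complex.I + (t ^ 2 * x ^ 2 / 2 : ℝ) with hz
    have hza : ‖z‖ ≤ a * |x| := by
      refine (norm_add_le _ _).trans ?_
      have h1 : ‖(t : ℂ) * x * Complex.I‖ = |t| * |x| := by simp
      have h2 : ‖((t ^ 2 * x ^ 2 / 2 : ℝ) : ℂ)‖ = t ^ 2 * x ^ 2 / 2 := by
        rw [Complex.norm_real, Real.norm_of_nonneg (by positivity)]
      rw [h1, h2, ha, add_mul]
      have h3 : x ^ 2 ≤ |x| := by
        rw [← sq_abs]; nlinarith [abs_nonneg x]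
      nlinarith [sq_nonneg t, abs_nonneg x, sq_nonneg x]
    have hza1 : ‖z‖ ≤ a := hza.trans (mul_le_of_le_one_right ha0 hx)
    have key := Complex.norm_exp_sub_sum_le_norm_mul_exp z 3
    have e : Complex.exp z - 1 - t * x * Complex.I
        = (Complex.exp z - ∑ m ∈ Finset.range 3, z ^ m / (m.factorial : ℂ))
          + (Complex.I * (t ^ 3 * x ^ 3 / 2 : ℝ) + (t ^ 4 * x ^ 4 / 8 : ℝ)) := by
      simp only [Finset.sum_range_succ, Finset.sum_range_zero, Nat.factorial]
      rw [hz]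
      push_cast
      ring_nf
      rw [Complex.I_sq]
      ring
    rw [e]
    refine (norm_add_le _ _).trans ((add_le_add key (norm_add_le _ _)).trans ?_)
    have h4 : ‖Complex.I * ((t ^ 3 * x ^ 3 / 2 : ℝ) : ℂ)‖ ≤ |t| ^ 3 * |x| ^ 3 := by
      rw [norm_mul, Complex.norm_I, one_mul, Complex.norm_real, Real.norm_eq_abs, abs_div, abs_mul,
        abs_pow, abs_pow, abs_of_pos (two_pos : (0 : ℝ) < 2)]
      have : 0 ≤ |t| ^ 3 * |x| ^ 3 := by positivity
      linarith
    have h5 : ‖((t ^ 4 * x ^ 4 / 8 : ℝ) : ℂ)‖ ≤ t ^ 4 * |x| ^ 3 := by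
      rw [Complex.norm_real, Real.norm_of_nonneg (by positivity)]
      have h6 : x ^ 4 ≤ |x| ^ 3 := by
        rw [show x ^ 4 = |x| ^ 4 by rw [show (4 : ℕ) = 2 * 2 by norm_num, pow_mul, pow_mul, sq_abs]]
        exact pow_le_pow_of_le_one (abs_nonneg x) hx (by norm_num)
      have h7 : 0 ≤ t ^ 4 := by positivity
      have h8 : 0 ≤ |x| ^ 3 := by positivity
      nlinarith
    have h9 : ‖z‖ ^ 3 * Real.exp ‖z‖ ≤ (a * |x|) ^ 3 * Real.exp a := by gcongr
    have h10 : 0 ≤ (Real.exp (t ^ 2) + 1 + |t|) * |x| ^ 3 := by positivity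
    nlinarith
  · have hx3 : 1 ≤ |x| ^ 3 := one_le_pow₀ hx
    have hx1 : |x| ≤ |x| ^ 3 := le_self_pow₀ hx (by norm_num)
    have h1 : ‖Complex.exp (t * x * Complex.I + (t ^ 2 * min (x ^ 2) 1 / 2 : ℝ))‖
        ≤ Real.exp (t ^ 2) := by
      rw [Complex.norm_exp]
      refine Real.exp_le_exp.2 ?_
      have h2 : min (x ^ 2) 1 ≤ 1 := min_le_right _ _
      have h3 : (t * x * Complex.I + (t ^ 2 * min (x ^ 2) 1 / 2 : ℝ) : ℂ).re
          = t ^ 2 * min (x ^ 2) 1 / 2 := by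
        rw [Complex.add_re, Complex.ofReal_re]
        simp
      rw [h3]
      nlinarith [sq_nonneg t]
    refine (norm_sub_le _ _).trans ((add_le_add (norm_sub_le _ _) le_rfl).trans ?_)
    have h2 : ‖(t : ℂ) * x * Complex.I‖ = |t| * |x| := by simp
    rw [h2, norm_one]
    have h3 : 0 ≤ (a ^ 3 * Real.exp a + |t| ^ 3 + t ^ 4) * |x| ^ 3 := by positivity
    nlinarith [abs_nonneg t, Real.exp_pos (t ^ 2)]

variable {Ω : Type*}

/-- The quadratic variation, with each increment truncated at `1`. -/
def quadVar (X : ℕ → Ω → ℝ) (k : ℕ) (ω : Ω) : ℝ := ∑ i ∈ Finset.range k, min (X i ω ^ 2) 1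

lemma quadVar_succ (X : ℕ → Ω → ℝ) (k : ℕ) (ω : Ω) :
    quadVar X (k + 1) ω = quadVar X k ω + min (X k ω ^ 2) 1 := Finset.sum_range_succ _ _

lemma quadVar_mono (X : ℕ → Ω → ℝ) {k n : ℕ} (hkn : k ≤ n) (ω : Ω) :
    quadVar X k ω ≤ quadVar X n ω :=
  Finset.sum_le_sum_of_subset_of_nonneg (Finset.range_mono hkn) fun _ _ _ => by positivity

lemma quadVar_nonneg (X : ℕ → Ω → ℝ) (k : ℕ) (ω : Ω) : 0 ≤ quadVar X k ω :=
  Finset.sum_nonneg fun _ _ => by positivity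

/-- The exponential martingale, whose increments are small because the drift compensates. -/
noncomputable def expMart (X : ℕ → Ω → ℝ) (t : ℝ) (k : ℕ) (ω : Ω) : ℂ :=
  Complex.exp (t * (∑ i ∈ Finset.range k, X i ω : ℝ) * Complex.I
    + (t ^ 2 * quadVar X k ω / 2 : ℝ))

lemma norm_expMart (X : ℕ → Ω → ℝ) (t : ℝ) (k : ℕ) (ω : Ω) :
    ‖expMart X t k ω‖ = Real.exp (t ^ 2 * quadVar X k ω / 2) := by
  rw [expMart, Complex.norm_exp, Complex.add_re, Complex.ofReal_re]
  congr 1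
  rw [← Complex.ofReal_mul, Complex.re_ofReal_mul]
  simp

lemma expMart_succ (X : ℕ → Ω → ℝ) (t : ℝ) (k : ℕ) (ω : Ω) :
    expMart X t (k + 1) ω = expMart X t k ω *
      Complex.exp (t * X k ω * Complex.I + (t ^ 2 * min (X k ω ^ 2) 1 / 2 : ℝ)) := by
  rw [expMart, expMart, ← Complex.exp_add, quadVar_succ, Finset.sum_range_succ]
  congr 1
  push_cast
  ring

/-- The sequence `X`, stopped once its quadratic variation exceeds `C`. -/
noncomputable def stopAt (C : ℝ) (X : ℕ → Ω → ℝ) (k : ℕ) (ω : Ω) : ℝ :=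
  if quadVar X k ω ≤ C then X k ω else 0

lemma abs_stopAt_le (C : ℝ) (X : ℕ → Ω → ℝ) (k : ℕ) (ω : Ω) : |stopAt C X k ω| ≤ |X k ω| := by
  unfold stopAt; split_ifs <;> simp

lemma quadVar_stopAt_le_quadVar (C : ℝ) (X : ℕ → Ω → ℝ) (k : ℕ) (ω : Ω) :
    quadVar (stopAt C X) k ω ≤ quadVar X k ω := by
  refine Finset.sum_le_sum fun i _ => min_le_min_right _ ?_
  exact sq_le_sq.2 (abs_stopAt_le C X i ω)

lemma quadVar_stopAt_le {C : ℝ} (hC : 0 ≤ C) (X : ℕ → Ω → ℝ) (k : ℕ) (ω : Ω) :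
    quadVar (stopAt C X) k ω ≤ C + 1 := by
  induction k with
  | zero => simp only [quadVar, Finset.range_zero, Finset.sum_empty]; linarith
  | succ k ih =>
    rw [quadVar_succ]
    by_cases h : quadVar X k ω ≤ C
    · exact add_le_add ((quadVar_stopAt_le_quadVar C X k ω).trans h) (min_le_right _ _)
    · simp only [stopAt, h, if_false]
      simpa using ih

lemma stopAt_eq_of_quadVar_le {C : ℝ} {X : ℕ → Ω → ℝ} {n : ℕ} {ω : Ω} (h : quadVar X n ω ≤ C)
    {k : ℕ} (hk : k < n) : stopAt C X k ω = X k ω :=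
  if_pos ((quadVar_mono X hk.le ω).trans h)

lemma abs_exp_sub_one_le' (x : ℝ) : |Real.exp x - 1| ≤ |x| * Real.exp |x| := by
  have h := Complex.norm_exp_sub_sum_le_norm_mul_exp (x : ℂ) 1
  have e : Complex.exp x - ∑ m ∈ Finset.range 1, (x : ℂ) ^ m / (m.factorial : ℂ)
      = ((Real.exp x - 1 : ℝ) : ℂ) := by simp
  rw [e, Complex.norm_real, Complex.norm_real, Real.norm_eq_abs, Real.norm_eq_abs, pow_one] at h
  exact h

/-- Comparison of the characteristic exponential with the stopped exponential martingale. -/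
lemma norm_exp_sub_expMart_stopAt_le {v : ℝ} (hv : 0 ≤ v) (t : ℝ) (X : ℕ → Ω → ℝ) (n : ℕ)
    (ω : Ω) :
    ‖Complex.exp (t * (∑ i ∈ Finset.range n, X i ω : ℝ) * Complex.I)
      - Complex.exp ((-(t ^ 2 * v / 2) : ℝ)) * expMart (stopAt (v + 1) X) t n ω‖
      ≤ (2 + t ^ 2 * (v + 2) * Real.exp (t ^ 2 * (v + 2))) * (v + 2) * |quadVar X n ω - v| := by
  set q := quadVar (stopAt (v + 1) X) n ω with hq
  have hq0 : 0 ≤ q := quadVar_nonneg _ _ _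
  have hq1 : q ≤ v + 1 + 1 := quadVar_stopAt_le (by linarith) X n ω
  set S := ∑ i ∈ Finset.range n, X i ω with hS
  set S' := ∑ i ∈ Finset.range n, stopAt (v + 1) X i ω with hS'
  -- Both the sum and the quadratic variation are unaffected by the stopping, unless `quadVar X n`
  -- is at distance at least one from `v`.
  have hcase : (quadVar X n ω ≤ v + 1 ∧ S' = S ∧ q = quadVar X n ω) ∨ 1 ≤ |quadVar X n ω - v| := by
    by_cases h : quadVar X n ω ≤ v + 1
    · left
      refine ⟨h, Finset.sum_congr rfl fun i hi =>
        stopAt_eq_of_quadVar_le h (Finset.mem_range.1 hi), ?_⟩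
      exact Finset.sum_congr rfl fun i hi => by
        rw [stopAt_eq_of_quadVar_le h (Finset.mem_range.1 hi)]
    · right
      push Not at h
      exact le_abs.2 (Or.inl (by linarith))
  have h1 : ‖Complex.exp (t * (S : ℝ) * Complex.I) - Complex.exp (t * (S' : ℝ) * Complex.I)‖
      ≤ 2 * |quadVar X n ω - v| := by
    have hn : ∀ s : ℝ, ‖Complex.exp (t * s * Complex.I)‖ = 1 := fun s => by
      rw [← Complex.ofReal_mul]; exact Complex.norm_exp_ofReal_mul_I _
    rcases hcase with ⟨_, h, _⟩ | h
    · rw [h, sub_self, norm_zero]; positivity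
    · refine (norm_sub_le _ _).trans ?_
      rw [hn, hn]; linarith
  have hqv : |q - v| ≤ (v + 2) * |quadVar X n ω - v| := by
    rcases hcase with ⟨_, _, h⟩ | h
    · rw [h]; nlinarith [abs_nonneg (quadVar X n ω - v)]
    · have : |q - v| ≤ v + 2 := abs_le.2 ⟨by linarith, by linarith⟩
      nlinarith
  have hqv' : |q - v| ≤ v + 2 := abs_le.2 ⟨by linarith, by linarith⟩
  have h2 : ‖Complex.exp (t * (S' : ℝ) * Complex.I)
      - Complex.exp ((-(t ^ 2 * v / 2) : ℝ)) * expMart (stopAt (v + 1) X) t n ω‖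
      ≤ t ^ 2 * Real.exp (t ^ 2 * (v + 2)) * |q - v| := by
    have e : Complex.exp ((-(t ^ 2 * v / 2) : ℝ)) * expMart (stopAt (v + 1) X) t n ω
        = Complex.exp (t * (S' : ℝ) * Complex.I) * ((Real.exp (t ^ 2 * (q - v) / 2) : ℝ) : ℂ) := by
      rw [expMart, ← Complex.exp_add, Complex.ofReal_exp, ← Complex.exp_add]
      congr 1
      rw [← hS', ← hq]
      push_cast
      ring
    rw [e]
    have e2 : Complex.exp (t * (S' : ℝ) * Complex.I) - Complex.exp (t * (S' : ℝ) * Complex.I)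
          * ((Real.exp (t ^ 2 * (q - v) / 2) : ℝ) : ℂ)
        = - (Complex.exp (t * (S' : ℝ) * Complex.I)
          * ((Real.exp (t ^ 2 * (q - v) / 2) - 1 : ℝ) : ℂ)) := by
      push_cast; ring
    rw [e2, norm_neg, norm_mul, Complex.norm_real, ← Complex.ofReal_mul,
      Complex.norm_exp_ofReal_mul_I, one_mul, Real.norm_eq_abs]
    refine (abs_exp_sub_one_le' _).trans ?_
    have e3 : |t ^ 2 * (q - v) / 2| = t ^ 2 * |q - v| / 2 := by
      rw [abs_div, abs_mul, abs_of_nonneg (sq_nonneg t), abs_of_pos (two_pos : (0 : ℝ) < 2)]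
    rw [e3]
    have h3 : t ^ 2 * |q - v| / 2 ≤ t ^ 2 * |q - v| := by
      have : 0 ≤ t ^ 2 * |q - v| := by positivity
      linarith
    calc _ ≤ t ^ 2 * |q - v| * Real.exp (t ^ 2 * (v + 2)) := by
          gcongr
          exact h3.trans (by gcongr)
      _ = _ := by ring
  have h4 := norm_sub_le_norm_sub_add_norm_sub (Complex.exp (t * (S : ℝ) * Complex.I))
    (Complex.exp (t * (S' : ℝ) * Complex.I))
    (Complex.exp ((-(t ^ 2 * v / 2) : ℝ)) * expMart (stopAt (v + 1) X) t n ω)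
  refine h4.trans ((add_le_add h1 h2).trans ?_)
  have h5 : 0 ≤ |quadVar X n ω - v| := abs_nonneg _
  have h6 : 0 ≤ t ^ 2 * Real.exp (t ^ 2 * (v + 2)) := by positivity
  have h7 := mul_le_mul_of_nonneg_left hqv h6
  have h8 : 0 ≤ t ^ 2 * (v + 1) * Real.exp (t ^ 2 * (v + 2)) * (v + 2) * |quadVar X n ω - v| := by
    positivity
  nlinarith

variable {mΩ : MeasurableSpace Ω} {μ : Measure Ω}

/-- `X` is a martingale difference sequence for the σ-algebras `𝒢 k` (describing the past before
time `k`), expressed by orthogonality to the bounded functions of the past. The σ-algebras need not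
be nested. The variables have third absolute moments. -/
structure IsMDS (μ : Measure Ω) (𝒢 : ℕ → MeasurableSpace Ω) (X : ℕ → Ω → ℝ) : Prop where
  aesm : ∀ i, AEStronglyMeasurable (X i) μ
  adapted : ∀ k, ∀ i < k, AEStronglyMeasurable[𝒢 k] (X i) μ
  orthogonal : ∀ k (W : Ω → ℝ) (C : ℝ), AEStronglyMeasurable W μ → AEStronglyMeasurable[𝒢 k] W μ →
    (∀ ω, |W ω| ≤ C) → ∫ ω, W ω * X k ω ∂μ = 0
  cube : ∀ i, Integrable (fun ω => |X i ω| ^ 3) μ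
  int : ∀ i, Integrable (X i) μ

lemma aestronglyMeasurable_fun_sum {ι : Type*} {m : MeasurableSpace Ω} {X : ι → Ω → ℝ}
    (s : Finset ι) (h : ∀ i ∈ s, AEStronglyMeasurable[m] (X i) μ) :
    AEStronglyMeasurable[m] (fun ω => ∑ i ∈ s, X i ω) μ := by
  classical
  induction s using Finset.induction_on with
  | empty => simpa using aestronglyMeasurable_const
  | insert a s ha ih =>
    simp only [Finset.sum_insert ha]
    exact (h a (Finset.mem_insert_self a s)).add
      (ih fun i hi => h i (Finset.mem_insert_of_mem hi))

lemma aestronglyMeasurable_quadVar {m : MeasurableSpace Ω} {X : ℕ → Ω → ℝ} {k : ℕ}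
    (h : ∀ i < k, AEStronglyMeasurable[m] (X i) μ) :
    AEStronglyMeasurable[m] (quadVar X k) μ := by
  unfold quadVar
  refine aestronglyMeasurable_fun_sum _ fun i hi => ?_
  have hc : Continuous fun x : ℝ => min (x ^ 2) 1 := by fun_prop
  exact hc.comp_aestronglyMeasurable (h i (Finset.mem_range.1 hi))

lemma aestronglyMeasurable_expMart {m : MeasurableSpace Ω} {X : ℕ → Ω → ℝ} {t : ℝ} {k : ℕ}
    (h : ∀ i < k, AEStronglyMeasurable[m] (X i) μ) :
    AEStronglyMeasurable[m] (expMart X t k) μ := by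
  have h1 : AEStronglyMeasurable[m] (fun ω => ∑ i ∈ Finset.range k, X i ω) μ :=
    aestronglyMeasurable_fun_sum _ fun i hi => h i (Finset.mem_range.1 hi)
  have h2 := aestronglyMeasurable_quadVar h
  have hc1 : Continuous fun x : ℝ => t * (x : ℂ) * Complex.I := by fun_prop
  have hc2 : Continuous fun x : ℝ => ((t ^ 2 * x / 2 : ℝ) : ℂ) := by fun_prop
  exact Complex.continuous_exp.comp_aestronglyMeasurable
    ((hc1.comp_aestronglyMeasurable h1).add (hc2.comp_aestronglyMeasurable h2))

/-- If the quadratic variation is bounded, the exponential martingale has mean close to `1`. -/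
lemma norm_integral_expMart_sub_one_le [IsProbabilityMeasure μ] {t K B : ℝ}
    (hK : ∀ x : ℝ, ‖Complex.exp (t * x * Complex.I + (t ^ 2 * min (x ^ 2) 1 / 2 : ℝ)) - 1
      - t * x * Complex.I‖ ≤ K * |x| ^ 3)
    {𝒢 : ℕ → MeasurableSpace Ω} {X : ℕ → Ω → ℝ} (hX : IsMDS μ 𝒢 X)
    (hB : ∀ k ω, quadVar X k ω ≤ B) (n : ℕ) :
    ‖∫ ω, expMart X t n ω ∂μ - 1‖
      ≤ Real.exp (t ^ 2 * B / 2) * K * ∑ k ∈ Finset.range n, ∫ ω, |X k ω| ^ 3 ∂μ := by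
  have hbd : ∀ k ω, ‖expMart X t k ω‖ ≤ Real.exp (t ^ 2 * B / 2) := by
    intro k ω
    rw [norm_expMart]
    have := hB k ω
    gcongr
  have hm : ∀ k, AEStronglyMeasurable (expMart X t k) μ := fun k =>
    aestronglyMeasurable_expMart fun i _ => hX.aesm i
  have hi : ∀ k, Integrable (expMart X t k) μ := fun k =>
    Integrable.of_bound (hm k) _ (Eventually.of_forall (hbd k))
  induction n with
  | zero => simp [expMart, quadVar]
  | succ n ih =>
    have hXc : Integrable (fun ω => (X n ω : ℂ)) μ := (hX.int n).ofReal
    have hYX : Integrable (fun ω => expMart X t n ω * (X n ω : ℂ)) μ :=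
      hXc.bdd_mul (hm n) (Eventually.of_forall (hbd n))
    have hzero : ∫ ω, expMart X t n ω * (X n ω : ℂ) ∂μ = 0 := by
      have hG := aestronglyMeasurable_expMart (t := t) (hX.adapted n)
      apply Complex.ext
      · rw [← RCLike.re_eq_complex_re, ← integral_re hYX, RCLike.re_eq_complex_re]
        simp only [Complex.re_mul_ofReal, Complex.zero_re]
        exact hX.orthogonal n _ _ (Complex.continuous_re.comp_aestronglyMeasurable (hm n))
          (Complex.continuous_re.comp_aestronglyMeasurable hG)
          fun ω => (Complex.abs_re_le_norm _).trans (hbd n ω)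
      · rw [← RCLike.im_eq_complex_im, ← integral_im hYX, RCLike.im_eq_complex_im]
        simp only [Complex.im_mul_ofReal, Complex.zero_im]
        exact hX.orthogonal n _ _ (Complex.continuous_im.comp_aestronglyMeasurable (hm n))
          (Complex.continuous_im.comp_aestronglyMeasurable hG)
          fun ω => (Complex.abs_im_le_norm _).trans (hbd n ω)
    have hstep : ‖∫ ω, expMart X t (n + 1) ω ∂μ - ∫ ω, expMart X t n ω ∂μ‖
        ≤ Real.exp (t ^ 2 * B / 2) * K * ∫ ω, |X n ω| ^ 3 ∂μ := by
      have e : ∫ ω, expMart X t (n + 1) ω ∂μ - ∫ ω, expMart X t n ω ∂μ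
          = ∫ ω, ((expMart X t (n + 1) - expMart X t n) ω
            - (t * Complex.I) * (expMart X t n ω * (X n ω : ℂ))) ∂μ := by
        rw [integral_sub ((hi (n + 1)).sub (hi n)) (hYX.const_mul _), integral_const_mul, hzero,
          integral_sub' (hi _) (hi _)]
        simp
      rw [e, ← integral_const_mul]
      refine norm_integral_le_of_norm_le ((hX.cube n).const_mul _) (Eventually.of_forall fun ω => ?_)
      have e2 : expMart X t (n + 1) ω - expMart X t n ω
            - (t * Complex.I) * (expMart X t n ω * (X n ω : ℂ))
          = expMart X t n ω * (Complex.exp (t * X n ω * Complex.I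
            + (t ^ 2 * min (X n ω ^ 2) 1 / 2 : ℝ)) - 1 - t * X n ω * Complex.I) := by
        rw [expMart_succ]; ring
      rw [Pi.sub_apply, e2, norm_mul, mul_assoc (Real.exp _)]
      exact mul_le_mul (hbd n ω) (hK (X n ω)) (norm_nonneg _) (Real.exp_pos _).le
    rw [Finset.sum_range_succ, mul_add]
    have e3 : ∫ ω, expMart X t (n + 1) ω ∂μ - 1
        = (∫ ω, expMart X t n ω ∂μ - 1)
          + (∫ ω, expMart X t (n + 1) ω ∂μ - ∫ ω, expMart X t n ω ∂μ) := by ring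
    rw [e3]
    exact (norm_add_le _ _).trans (add_le_add ih hstep)

lemma aestronglyMeasurable_indicator_quadVar {m : MeasurableSpace Ω} {X : ℕ → Ω → ℝ} {k : ℕ}
    (C : ℝ) (h : ∀ i < k, AEStronglyMeasurable[m] (X i) μ) :
    AEStronglyMeasurable[m] (fun ω => if quadVar X k ω ≤ C then (1 : ℝ) else 0) μ := by
  have hm : Measurable fun x : ℝ => if x ≤ C then (1 : ℝ) else 0 :=
    Measurable.ite measurableSet_Iic measurable_const measurable_const
  obtain ⟨q, hq, hqe⟩ := aestronglyMeasurable_quadVar h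
  exact ⟨_, (hm.comp hq.measurable).stronglyMeasurable, hqe.fun_comp fun x : ℝ => if x ≤ C then (1 : ℝ) else 0⟩

lemma IsMDS.stopAt {𝒢 : ℕ → MeasurableSpace Ω} {X : ℕ → Ω → ℝ} (hX : IsMDS μ 𝒢 X) (C : ℝ) :
    IsMDS μ 𝒢 (stopAt C X) := by
  have e : ∀ k, MartingaleField.stopAt C X k
      = fun ω => (if quadVar X k ω ≤ C then (1 : ℝ) else 0) * X k ω := by
    intro k; ext ω; simp [MartingaleField.stopAt]
  have hm : ∀ k, AEStronglyMeasurable (MartingaleField.stopAt C X k) μ := by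
    intro k
    rw [e]
    exact (aestronglyMeasurable_indicator_quadVar C fun i _ => hX.aesm i).mul (hX.aesm k)
  refine ⟨hm, fun k i hi => ?_, fun k W D hW hW' hD => ?_, fun i => ?_, fun i => ?_⟩
  · rw [e]
    exact (aestronglyMeasurable_indicator_quadVar C fun j hj => hX.adapted k j (hj.trans hi)).mul
      (hX.adapted k i hi)
  · simp only [e, ← mul_assoc]
    refine hX.orthogonal k (fun ω => W ω * if quadVar X k ω ≤ C then (1 : ℝ) else 0) D
      (hW.mul (aestronglyMeasurable_indicator_quadVar C fun i _ => hX.aesm i))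
      (hW'.mul (aestronglyMeasurable_indicator_quadVar C (hX.adapted k))) fun ω => ?_
    split_ifs
    · simpa using hD ω
    · simpa using (abs_nonneg _).trans (hD ω)
  · refine (hX.cube i).mono' ((hm i).norm.pow 3) (Eventually.of_forall fun ω => ?_)
    rw [norm_pow, Real.norm_eq_abs, abs_abs]
    exact pow_le_pow_left₀ (abs_nonneg _) (abs_stopAt_le C X i ω) 3
  · exact (hX.int i).norm.mono' (hm i) (Eventually.of_forall fun ω => abs_stopAt_le C X i ω)

/-- A quantitative central limit theorem for martingale differences: the characteristic function
of the sum is close to the Gaussian one if the third absolute moments have a small sum and the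
quadratic variation is close to a constant in `L¹`. -/
theorem exists_norm_integral_exp_sub_le [IsProbabilityMeasure μ] {v : ℝ} (hv : 0 ≤ v) (t : ℝ) :
    ∃ K : ℝ, ∀ (𝒢 : ℕ → MeasurableSpace Ω) (X : ℕ → Ω → ℝ), IsMDS μ 𝒢 X →
      (∀ i, Integrable (fun ω => X i ω ^ 2) μ) → ∀ n : ℕ,
      ‖∫ ω, Complex.exp (t * (∑ i ∈ Finset.range n, X i ω : ℝ) * Complex.I) ∂μ
        - Complex.exp ((-(t ^ 2 * v / 2) : ℝ))‖
      ≤ K * (∫ ω, |∑ i ∈ Finset.range n, X i ω ^ 2 - v| ∂μ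
        + ∑ i ∈ Finset.range n, ∫ ω, |X i ω| ^ 3 ∂μ) := by
  obtain ⟨K, hK0, hK⟩ := exists_norm_exp_sub_le t
  set K₁ := (2 + t ^ 2 * (v + 2) * Real.exp (t ^ 2 * (v + 2))) * (v + 2) with hK₁
  set K₂ := Real.exp (t ^ 2 * (v + 1 + 1) / 2) * K with hK₂
  have hK₁0 : 0 ≤ K₁ := by positivity
  have hK₂0 : 0 ≤ K₂ := by positivity
  refine ⟨K₁ + K₂, fun 𝒢 X hX hX2 n => ?_⟩
  have hX' := hX.stopAt (v + 1)
  have hmart := norm_integral_expMart_sub_one_le hK hX'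
    (fun k ω => quadVar_stopAt_le (by linarith) X k ω) n
  have hcube : ∑ k ∈ Finset.range n, ∫ ω, |stopAt (v + 1) X k ω| ^ 3 ∂μ
      ≤ ∑ k ∈ Finset.range n, ∫ ω, |X k ω| ^ 3 ∂μ := by
    refine Finset.sum_le_sum fun k _ => integral_mono (hX'.cube k) (hX.cube k) fun ω => ?_
    exact pow_le_pow_left₀ (abs_nonneg _) (abs_stopAt_le (v + 1) X k ω) 3
  have hqm : AEStronglyMeasurable (quadVar X n) μ :=
    aestronglyMeasurable_quadVar fun i _ => hX.aesm i
  have hqi : Integrable (quadVar X n) μ := by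
    refine Integrable.of_bound hqm n (Eventually.of_forall fun ω => ?_)
    rw [Real.norm_of_nonneg (quadVar_nonneg X n ω)]
    refine (Finset.sum_le_card_nsmul _ _ 1 fun i _ => min_le_right _ _).trans ?_
    simp
  have hsum2 : Integrable (fun ω => ∑ i ∈ Finset.range n, X i ω ^ 2) μ :=
    integrable_finsetSum _ fun i _ => hX2 i
  have hsum3 : Integrable (fun ω => ∑ i ∈ Finset.range n, |X i ω| ^ 3) μ :=
    integrable_finsetSum _ fun i _ => hX.cube i
  -- The truncation error of a square is dominated by the cube.
  have hquad : ∫ ω, |quadVar X n ω - v| ∂μ ≤ ∫ ω, |∑ i ∈ Finset.range n, X i ω ^ 2 - v| ∂μ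
      + ∑ i ∈ Finset.range n, ∫ ω, |X i ω| ^ 3 ∂μ := by
    have hsub : Integrable (fun ω => |∑ i ∈ Finset.range n, X i ω ^ 2 - v|) μ :=
      (hsum2.sub (integrable_const v)).abs
    rw [← integral_finsetSum _ fun i _ => hX.cube i, ← integral_add hsub hsum3]
    refine integral_mono (hqi.sub (integrable_const v)).abs
      (hsub.add hsum3) fun ω => ?_
    have h1 : |quadVar X n ω - ∑ i ∈ Finset.range n, X i ω ^ 2|
        ≤ ∑ i ∈ Finset.range n, |X i ω| ^ 3 := by
      unfold quadVar
      rw [← Finset.sum_sub_distrib]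
      refine (Finset.abs_sum_le_sum_abs _ _).trans (Finset.sum_le_sum fun i _ => ?_)
      rcases le_total (X i ω ^ 2) 1 with h | h
      · rw [min_eq_left h, sub_self, abs_zero]; positivity
      · rw [min_eq_right h, abs_sub_comm, abs_of_nonneg (by linarith)]
        have h2 : 1 ≤ |X i ω| := (one_le_sq_iff_one_le_abs _).1 h
        have h3 : X i ω ^ 2 = |X i ω| ^ 2 := (sq_abs _).symm
        have h4 : |X i ω| ^ 2 ≤ |X i ω| ^ 3 := pow_le_pow_right₀ h2 (by norm_num)
        linarith
    have h2 := abs_sub_le (quadVar X n ω) (∑ i ∈ Finset.range n, X i ω ^ 2) v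
    simp only
    linarith
  have hSm : AEStronglyMeasurable (fun ω => ∑ i ∈ Finset.range n, X i ω) μ :=
    aestronglyMeasurable_fun_sum _ fun i _ => hX.aesm i
  have hEi : Integrable (fun ω =>
      Complex.exp (t * (∑ i ∈ Finset.range n, X i ω : ℝ) * Complex.I)) μ := by
    have hc : Continuous fun x : ℝ => Complex.exp (t * x * Complex.I) := by fun_prop
    refine Integrable.of_bound (hc.comp_aestronglyMeasurable hSm) 1
      (Eventually.of_forall fun ω => ?_)
    rw [← Complex.ofReal_mul, Complex.norm_exp_ofReal_mul_I]
  have hMi : Integrable (expMart (stopAt (v + 1) X) t n) μ := by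
    refine Integrable.of_bound (aestronglyMeasurable_expMart fun i _ => hX'.aesm i)
      (Real.exp (t ^ 2 * (v + 1 + 1) / 2)) (Eventually.of_forall fun ω => ?_)
    rw [norm_expMart]
    have := quadVar_stopAt_le (by linarith : 0 ≤ v + 1) X n ω
    gcongr
  set c : ℂ := Complex.exp ((-(t ^ 2 * v / 2) : ℝ)) with hc
  have hc1 : ‖c‖ ≤ 1 := by
    rw [hc, Complex.norm_exp, Complex.ofReal_re, Real.exp_le_one_iff]
    have : 0 ≤ t ^ 2 * v / 2 := by positivity
    linarith
  have hdiff : ‖∫ ω, Complex.exp (t * (∑ i ∈ Finset.range n, X i ω : ℝ) * Complex.I) ∂μ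
      - c * ∫ ω, expMart (stopAt (v + 1) X) t n ω ∂μ‖ ≤ K₁ * ∫ ω, |quadVar X n ω - v| ∂μ := by
    rw [← integral_const_mul, ← integral_sub hEi (hMi.const_mul c), ← integral_const_mul]
    exact norm_integral_le_of_norm_le ((hqi.sub (integrable_const v)).abs.const_mul _)
      (Eventually.of_forall fun ω => norm_exp_sub_expMart_stopAt_le hv t X n ω)
  have e : ∫ ω, Complex.exp (t * (∑ i ∈ Finset.range n, X i ω : ℝ) * Complex.I) ∂μ - c
      = (∫ ω, Complex.exp (t * (∑ i ∈ Finset.range n, X i ω : ℝ) * Complex.I) ∂μ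
        - c * ∫ ω, expMart (stopAt (v + 1) X) t n ω ∂μ)
        + c * (∫ ω, expMart (stopAt (v + 1) X) t n ω ∂μ - 1) := by ring
  rw [e]
  refine (norm_add_le _ _).trans ?_
  rw [norm_mul]
  set a := ∫ ω, |∑ i ∈ Finset.range n, X i ω ^ 2 - v| ∂μ with ha
  set b := ∑ i ∈ Finset.range n, ∫ ω, |X i ω| ^ 3 ∂μ with hb
  have ha0 : 0 ≤ a := integral_nonneg fun ω => abs_nonneg _
  have h1 : ‖c‖ * ‖∫ ω, expMart (stopAt (v + 1) X) t n ω ∂μ - 1‖ ≤ K₂ * b := by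
    refine (mul_le_of_le_one_left (norm_nonneg _) hc1).trans (hmart.trans ?_)
    exact mul_le_mul_of_nonneg_left hcube hK₂0
  have h2 := mul_le_mul_of_nonneg_left hquad hK₁0
  nlinarith [mul_nonneg hK₂0 ha0]

end CLT

/-! ### Reversed martingale differences along a transformation -/

section Reversed

variable {Ω : Type*}

/-- The sum of `g` along the first `k` points of the orbit under `V`, without the starting
point. -/
def vSum (V : Ω → Ω) (g : Ω → ℝ) (k : ℕ) (ω : Ω) : ℝ := ∑ p ∈ Finset.range k, g (V^[p + 1] ω)

/-- The part of the product `vSum V g k * vSum V h k` in which the index belonging to `g` is smaller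
than the one belonging to `h`, sorted by the index of `g`. -/
def crossSum (V : Ω → Ω) (g h : Ω → ℝ) (k : ℕ) (ω : Ω) : ℝ :=
  ∑ l ∈ Finset.range k, g (V^[l + 1] ω) * vSum V h (k - 1 - l) (V^[l + 1] ω)

lemma vSum_succ (V : Ω → Ω) (g : Ω → ℝ) (k : ℕ) (ω : Ω) :
    vSum V g (k + 1) ω = g (V ω) + vSum V g k (V ω) := by
  simp only [vSum]
  rw [Finset.sum_range_succ', add_comm]
  rfl

lemma crossSum_succ (V : Ω → Ω) (g h : Ω → ℝ) (k : ℕ) (ω : Ω) :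
    crossSum V g h (k + 1) ω = g (V ω) * vSum V h k (V ω) + crossSum V g h k (V ω) := by
  simp only [crossSum]
  rw [Finset.sum_range_succ', add_comm]
  congr 1
  refine Finset.sum_congr rfl fun l _ => ?_
  rw [show k + 1 - 1 - (l + 1) = k - 1 - l by omega]
  rfl

lemma vSum_mul_vSum (V : Ω → Ω) (g h : Ω → ℝ) (k : ℕ) (ω : Ω) :
    vSum V g k ω * vSum V h k ω
      = vSum V (fun ω => g ω * h ω) k ω + crossSum V g h k ω + crossSum V h g k ω := by
  induction k generalizing ω with
  | zero => simp [vSum, crossSum]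
  | succ k ih =>
    simp only [vSum_succ, crossSum_succ]
    linear_combination ih (V ω)

lemma vSum_comp_of_commute {U V : Ω → Ω} (hUV : Function.Commute U V) (g : Ω → ℝ) (k : ℕ) (ω : Ω) :
    vSum V g k (U ω) = vSum V (fun ω => g (U ω)) k ω := by
  simp only [vSum]
  refine Finset.sum_congr rfl fun p _ => ?_
  rw [show V^[p + 1] (U ω) = U (V^[p + 1] ω) from ((hUV.iterate_right (p + 1)) ω).symm]

variable {𝒬 mΩ : MeasurableSpace Ω} {μ : Measure Ω} {V : Ω → Ω}

/-- The functions `g ∘ V^d`, `d ≥ 1`, belong to the past `𝒬`, while `g ∈ L⁴` is orthogonal to it. -/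
structure RowDiff (μ : Measure Ω) (V : Ω → Ω) (𝒬 : MeasurableSpace Ω) (g : Ω → ℝ) : Prop where
  memLp : MemLp g 4 μ
  past : ∀ d, AEStronglyMeasurable[𝒬] (fun ω => g (V^[d + 1] ω)) μ
  orth : ∀ W : Ω → ℝ, AEStronglyMeasurable[𝒬] W μ → Integrable (fun ω => W ω * g ω) μ →
    ∫ ω, W ω * g ω ∂μ = 0

/-- The square integrable analogue of `RowDiff`. -/
structure Innovation (μ : Measure Ω) (V : Ω → Ω) (𝒬 : MeasurableSpace Ω) (g : Ω → ℝ) : Prop where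
  memLp : MemLp g 2 μ
  past : ∀ d, AEStronglyMeasurable[𝒬] (fun ω => g (V^[d + 1] ω)) μ
  orth : ∀ W : Ω → ℝ, AEStronglyMeasurable[𝒬] W μ → MemLp W 2 μ → ∫ ω, W ω * g ω ∂μ = 0

lemma memLp_vSum (hV : MeasurePreserving V μ μ) {g : Ω → ℝ} {p : ℝ≥0∞} (hg : MemLp g p μ) (k : ℕ) :
    MemLp (vSum V g k) p μ :=
  memLp_finsetSum _ fun _ _ => memLp_comp (hV.iterate _) hg

lemma RowDiff.aestronglyMeasurable_vSum {g : Ω → ℝ} (hg : RowDiff μ V 𝒬 g) (k : ℕ) :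
    AEStronglyMeasurable[𝒬] (vSum V g k) μ :=
  aestronglyMeasurable_fun_sum _ fun p _ => hg.past p

lemma RowDiff.aestronglyMeasurable_vSum_comp {g : Ω → ℝ} (hg : RowDiff μ V 𝒬 g) (k d : ℕ) :
    AEStronglyMeasurable[𝒬] (fun ω => vSum V g k (V^[d + 1] ω)) μ := by
  refine aestronglyMeasurable_fun_sum _ fun p _ => ?_
  simp only [← Function.iterate_add_apply]
  exact hg.past (p + 1 + d)

lemma RowDiff.innovation_mul_vSum (hV : MeasurePreserving V μ μ) {g h : Ω → ℝ}
    (hg : RowDiff μ V 𝒬 g) (hh : RowDiff μ V 𝒬 h) (k : ℕ) :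
    Innovation μ V 𝒬 (fun ω => g ω * vSum V h k ω) := by
  have h2 := memLp_mul_of_memLp_four hg.memLp (memLp_vSum hV hh.memLp k)
  refine ⟨h2, fun d => (hg.past d).mul (hh.aestronglyMeasurable_vSum_comp k d), fun W hW hW2 => ?_⟩
  have e : ∀ ω, W ω * (g ω * vSum V h k ω) = W ω * vSum V h k ω * g ω := fun ω => by ring
  have hi := integrable_mul_of_memLp_two hW2 h2
  simp only [e] at hi ⊢
  exact hg.orth _ (hW.mul (hh.aestronglyMeasurable_vSum k)) hi

lemma Innovation.sum {ι : Type*} (s : Finset ι) {g : ι → Ω → ℝ}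
    (hg : ∀ i ∈ s, Innovation μ V 𝒬 (g i)) : Innovation μ V 𝒬 (fun ω => ∑ i ∈ s, g i ω) := by
  refine ⟨memLp_finsetSum _ fun i hi => (hg i hi).memLp,
    fun d => aestronglyMeasurable_fun_sum _ fun i hi => (hg i hi).past d, fun W hW hW2 => ?_⟩
  simp only [Finset.mul_sum]
  rw [integral_finsetSum _ fun i hi => integrable_mul_of_memLp_two hW2 (hg i hi).memLp]
  exact Finset.sum_eq_zero fun i hi => (hg i hi).orth W hW hW2

lemma Innovation.const_mul {g : Ω → ℝ} (hg : Innovation μ V 𝒬 g) (c : ℝ) :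
    Innovation μ V 𝒬 (fun ω => c * g ω) := by
  refine ⟨hg.memLp.const_mul c, fun d => (hg.past d).const_mul c, fun W hW hW2 => ?_⟩
  simp only [mul_left_comm _ c, integral_const_mul, hg.orth W hW hW2, mul_zero]

lemma Innovation.integral_comp_mul_comp_of_lt (hV : MeasurePreserving V μ μ) {g h : Ω → ℝ}
    (hg : Innovation μ V 𝒬 g) (hh : Innovation μ V 𝒬 h) {l l' : ℕ} (hl : l < l') :
    ∫ ω, g (V^[l] ω) * h (V^[l'] ω) ∂μ = 0 := by
  obtain ⟨d, rfl⟩ : ∃ d, l' = d + 1 + l := ⟨l' - l - 1, by omega⟩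
  have hhd := memLp_comp (hV.iterate (d + 1)) hh.memLp
  have h1 := integral_comp' (hV.iterate l) (g := fun ω => h (V^[d + 1] ω) * g ω)
    (hhd.1.mul hg.memLp.1)
  rw [hg.orth _ (hh.past d) hhd] at h1
  rw [← h1]
  simp only [← Function.iterate_add_apply, mul_comm]

/-- Sums of innovations at different times are orthogonal term by term. -/
lemma integral_sum_comp_mul_sum_comp (hV : MeasurePreserving V μ μ) {g h : ℕ → Ω → ℝ} {k k' : ℕ}
    (hk : k ≤ k') (hg : ∀ l, Innovation μ V 𝒬 (g l)) (hh : ∀ l, Innovation μ V 𝒬 (h l)) :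
    ∫ ω, (∑ l ∈ Finset.range k, g l (V^[l + 1] ω)) * (∑ l ∈ Finset.range k', h l (V^[l + 1] ω)) ∂μ
      = ∑ l ∈ Finset.range k, ∫ ω, g l ω * h l ω ∂μ := by
  simp only [Finset.sum_mul_sum]
  have hi : ∀ l l', Integrable (fun ω => g l (V^[l + 1] ω) * h l' (V^[l' + 1] ω)) μ := fun l l' =>
    integrable_mul_of_memLp_two (memLp_comp (hV.iterate _) (hg l).memLp)
      (memLp_comp (hV.iterate _) (hh l').memLp)
  rw [integral_finsetSum _ fun l _ => integrable_finsetSum _ fun l' _ => hi l l']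
  refine Finset.sum_congr rfl fun l hl => ?_
  rw [integral_finsetSum _ fun l' _ => hi l l', Finset.sum_eq_single l]
  · exact integral_comp' (hV.iterate (l + 1)) (g := fun ω => g l ω * h l ω)
      ((hg l).memLp.1.mul (hh l).memLp.1)
  · intro l' _ hne
    rcases lt_or_gt_of_ne hne with hlt | hlt
    · simp only [mul_comm (g l _)]
      exact (hh l').integral_comp_mul_comp_of_lt hV (hg l) (by omega)
    · exact (hg l).integral_comp_mul_comp_of_lt hV (hh l') (by omega)
  · intro hn
    exact absurd (Finset.mem_range.2 ((Finset.mem_range.1 hl).trans_le hk)) hn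

/-- The fourth moment of a sum of `k` martingale differences is of order `k²`. -/
theorem RowDiff.integral_vSum_pow_four_le (hV : MeasurePreserving V μ μ) {g : Ω → ℝ}
    (hg : RowDiff μ V 𝒬 g) (k : ℕ) :
    ∫ ω, vSum V g k ω ^ 4 ∂μ ≤ 16 * (k : ℝ) ^ 2 * ∫ ω, g ω ^ 4 ∂μ := by
  set e := ∫ ω, g ω ^ 4 ∂μ with he
  have he0 : 0 ≤ e := integral_nonneg fun ω => by positivity
  induction k with
  | zero => simp [vSum]
  | succ k ih =>
    set T := vSum V g k with hT
    have hT4 : MemLp T 4 μ := memLp_vSum hV hg.memLp k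
    have hgT := memLp_mul_of_memLp_four hg.memLp hT4
    have hsum : MemLp (fun ω => g ω + T ω) 4 μ := memLp_fun_add hg.memLp hT4
    have e1 : ∫ ω, vSum V g (k + 1) ω ^ 4 ∂μ = ∫ ω, (g ω + T ω) ^ 4 ∂μ := by
      simp only [vSum_succ]
      exact integral_comp' hV (g := fun ω => (g ω + T ω) ^ 4) (hsum.1.pow 4)
    have hcube : Integrable (fun ω => T ω ^ 3 * g ω) μ := by
      refine (integrable_mul_of_memLp_two hgT (memLp_sq_of_memLp_four hT4)).congr
        (Eventually.of_forall fun ω => ?_)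
      simp only; ring
    have hzero : ∫ ω, T ω ^ 3 * g ω ∂μ = 0 :=
      hg.orth _ ((hg.aestronglyMeasurable_vSum k).pow 3) hcube
    have i1 := (integrable_pow_four hg.memLp).const_mul 3
    have i2 := hgT.integrable_sq.const_mul 8
    have i3 := hcube.const_mul 4
    have i4 := integrable_pow_four hT4
    have e2 : ∫ ω, (g ω + T ω) ^ 4 ∂μ
        ≤ ∫ ω, (3 * g ω ^ 4 + (8 * (g ω * T ω) ^ 2 + (4 * (T ω ^ 3 * g ω) + T ω ^ 4))) ∂μ := by
      refine integral_mono (integrable_pow_four hsum) (i1.fun_add (i2.fun_add (i3.fun_add i4)))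
        fun ω => ?_
      simp only
      nlinarith [sq_nonneg (g ω * (g ω - T ω))]
    rw [integral_add i1 (i2.fun_add (i3.fun_add i4)), integral_add i2 (i3.fun_add i4),
      integral_add i3 i4, integral_const_mul, integral_const_mul, integral_const_mul, hzero] at e2
    have h3 : ∫ ω, (g ω * T ω) ^ 2 ∂μ ≤ 4 * k * e := by
      refine abs_le_of_sq_le_sq' ?_ (by positivity) |>.2
      refine (sq_integral_sq_mul_le hg.memLp hT4).trans ?_
      calc e * ∫ ω, T ω ^ 4 ∂μ ≤ e * (16 * (k : ℝ) ^ 2 * e) := by gcongr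
        _ = (4 * k * e) ^ 2 := by ring
    rw [e1]
    push_cast
    nlinarith

lemma RowDiff.integral_sq_mul_vSum_le (hV : MeasurePreserving V μ μ) {g h : Ω → ℝ} {e : ℝ}
    (hg : RowDiff μ V 𝒬 g) (hh : RowDiff μ V 𝒬 h) (hge : ∫ ω, g ω ^ 4 ∂μ ≤ e)
    (hhe : ∫ ω, h ω ^ 4 ∂μ ≤ e) (k : ℕ) :
    ∫ ω, (g ω * vSum V h k ω) ^ 2 ∂μ ≤ 4 * k * e := by
  have he0 : 0 ≤ e := (integral_nonneg fun ω => by positivity).trans hge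
  refine abs_le_of_sq_le_sq' ?_ (by positivity) |>.2
  refine (sq_integral_sq_mul_le hg.memLp (memLp_vSum hV hh.memLp k)).trans ?_
  have h1 := hh.integral_vSum_pow_four_le hV k
  have h0 : 0 ≤ ∫ ω, vSum V h k ω ^ 4 ∂μ := integral_nonneg fun ω => by positivity
  calc _ ≤ e * (16 * (k : ℝ) ^ 2 * e) :=
        mul_le_mul hge (h1.trans (by gcongr)) h0 he0
    _ = (4 * k * e) ^ 2 := by ring

lemma memLp_crossSum (hV : MeasurePreserving V μ μ) {g h : Ω → ℝ} (hg : RowDiff μ V 𝒬 g)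
    (hh : RowDiff μ V 𝒬 h) (k : ℕ) : MemLp (crossSum V g h k) 2 μ :=
  memLp_finsetSum _ fun _ _ =>
    memLp_comp (hV.iterate _) (hg.innovation_mul_vSum hV hh _).memLp

lemma abs_integral_crossSum_mul_le (hV : MeasurePreserving V μ μ) {g h : Ω → ℝ} {e : ℝ}
    (hg : RowDiff μ V 𝒬 g) (hh : RowDiff μ V 𝒬 h) (hge : ∫ ω, g ω ^ 4 ∂μ ≤ e)
    (hhe : ∫ ω, h ω ^ 4 ∂μ ≤ e) {k k' : ℕ} (hk : k ≤ k') :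
    |∫ ω, crossSum V g h k ω * crossSum V g h k' ω ∂μ| ≤ k * (4 * e * √(k * k')) := by
  have he0 : 0 ≤ e := (integral_nonneg fun ω => by positivity).trans hge
  have h1 := integral_sum_comp_mul_sum_comp hV hk
    (fun l => hg.innovation_mul_vSum hV hh (k - 1 - l))
    (fun l => hg.innovation_mul_vSum hV hh (k' - 1 - l))
  have h2 : ∫ ω, crossSum V g h k ω * crossSum V g h k' ω ∂μ
      = ∑ l ∈ Finset.range k, ∫ ω, g ω * vSum V h (k - 1 - l) ω *
        (g ω * vSum V h (k' - 1 - l) ω) ∂μ := h1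
  rw [h2]
  refine (Finset.abs_sum_le_sum_abs _ _).trans ?_
  refine (Finset.sum_le_card_nsmul _ _ (4 * e * √(k * k')) fun l _ => ?_).trans (by simp)
  refine abs_le_of_sq_le_sq ?_ (by positivity)
  refine (sq_integral_mul_le (hg.innovation_mul_vSum hV hh _).memLp
    (hg.innovation_mul_vSum hV hh _).memLp).trans ?_
  have h3 := hg.integral_sq_mul_vSum_le hV hh hge hhe (k - 1 - l)
  have h4 := hg.integral_sq_mul_vSum_le hV hh hge hhe (k' - 1 - l)
  have h5 : ((k - 1 - l : ℕ) : ℝ) ≤ k := by exact_mod_cast (by omega)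
  have h6 : ((k' - 1 - l : ℕ) : ℝ) ≤ k' := by exact_mod_cast (by omega)
  have h7 : 0 ≤ ∫ ω, (g ω * vSum V h (k' - 1 - l) ω) ^ 2 ∂μ := integral_nonneg fun ω => sq_nonneg _
  calc _ ≤ (4 * k * e) * (4 * k' * e) := by
        refine mul_le_mul (h3.trans (by gcongr)) (h4.trans (by gcongr)) h7 (by positivity)
    _ = (4 * e * √(k * k')) ^ 2 := by
        rw [mul_pow, Real.sq_sqrt (by positivity)]; ring

end Reversed

/-! ### Weak convergence of the off-diagonal sums -/

section WeakNull

/-- A bounded sequence in a Hilbert space that is asymptotically orthogonal to each of its members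
converges weakly to zero. -/
lemma tendsto_inner_of_asymptotically_orthogonal {E : Type*} [NormedAddCommGroup E]
    [InnerProductSpace ℝ E] [CompleteSpace E] {x : ℕ → E} {C : ℝ} (hC : ∀ k, ‖x k‖ ≤ C)
    (h : ∀ k, Tendsto (fun k' => inner ℝ (x k) (x k')) atTop (𝓝 0)) (y : E) :
    Tendsto (fun k => inner ℝ y (x k)) atTop (𝓝 0) := by
  have hC0 : 0 ≤ C := (norm_nonneg _).trans (hC 0)
  let M : Submodule ℝ E :=
    { carrier := {y | Tendsto (fun k => inner ℝ y (x k)) atTop (𝓝 0)}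
      add_mem' := fun {a b} ha hb => by
        have := Tendsto.add ha hb
        simpa only [Set.mem_ofPred_eq, inner_add_left, add_zero] using this
      zero_mem' := by simp
      smul_mem' := fun c a ha => by
        have := Tendsto.const_mul c ha
        simpa only [Set.mem_ofPred_eq, real_inner_smul_left, mul_zero] using this }
  have hMc : IsClosed (M : Set E) := by
    refine isClosed_of_closure_subset fun z hz => ?_
    change Tendsto (fun k => inner ℝ z (x k)) atTop (𝓝 0)
    rw [Metric.tendsto_atTop]
    intro ε hε
    obtain ⟨w, hw, hzw⟩ := Metric.mem_closure_iff.1 hz (ε / (2 * (C + 1))) (by positivity)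
    have hw' : Tendsto (fun k => inner ℝ w (x k)) atTop (𝓝 0) := hw
    obtain ⟨N, hN⟩ := Metric.tendsto_atTop.1 hw' (ε / 2) (by positivity)
    refine ⟨N, fun k hk => ?_⟩
    have h1 := hN k hk
    rw [Real.dist_eq, sub_zero] at h1 ⊢
    have h2 : inner ℝ z (x k) = inner ℝ (z - w) (x k) + inner ℝ w (x k) := by
      rw [← inner_add_left, sub_add_cancel]
    have h3 : |inner ℝ (z - w) (x k)| ≤ ε / 2 := by
      refine (abs_real_inner_le_norm _ _).trans ?_
      rw [dist_eq_norm] at hzw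
      calc ‖z - w‖ * ‖x k‖ ≤ ε / (2 * (C + 1)) * (C + 1) := by
            gcongr
            linarith [hC k]
        _ = ε / 2 := by field_simp
    rw [h2]
    linarith [abs_add_le (inner ℝ (z - w) (x k)) (inner ℝ w (x k))]
  have hxM : ∀ k, x k ∈ M := fun k => h k
  have : CompleteSpace M := hMc.completeSpace_coe
  have hy : ∀ k, inner ℝ y (x k) = inner ℝ (M.starProjection y) (x k) := by
    intro k
    have h1 : inner ℝ (y - M.starProjection y) (x k) = 0 :=
      M.starProjection_inner_eq_zero y (x k) (hxM k)
    rw [inner_sub_left] at h1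
    linarith
  simp only [hy]
  exact M.starProjection_apply_mem y

variable {Ω : Type*} {𝒬 mΩ : MeasurableSpace Ω} {μ : Measure Ω}

lemma integral_mul_eq_inner_toLp {f g : Ω → ℝ} (hf : MemLp f 2 μ) (hg : MemLp g 2 μ) :
    ∫ ω, f ω * g ω ∂μ = inner ℝ (hf.toLp f) (hg.toLp g) := by
  rw [L2.inner_def]
  refine integral_congr_ae ?_
  filter_upwards [hf.coeFn_toLp, hg.coeFn_toLp] with ω h1 h2
  simp [h1, h2, mul_comm]

/-- The normalized off-diagonal sums converge to zero weakly in `L²`. -/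
theorem tendsto_integral_mul_crossSum {V : Ω → Ω}
    (hV : MeasurePreserving V μ μ) {g h : Ω → ℝ} (hg : RowDiff μ V 𝒬 g) (hh : RowDiff μ V 𝒬 h)
    {y : Ω → ℝ} (hy : MemLp y 2 μ) :
    Tendsto (fun k : ℕ => (k : ℝ)⁻¹ * ∫ ω, y ω * crossSum V g h k ω ∂μ) atTop (𝓝 0) := by
  set e := max (∫ ω, g ω ^ 4 ∂μ) (∫ ω, h ω ^ 4 ∂μ) with he
  have he0 : 0 ≤ e := (integral_nonneg fun ω => by positivity).trans (le_max_left _ _)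
  have hm : ∀ k : ℕ, MemLp (fun ω => (k : ℝ)⁻¹ * crossSum V g h k ω) 2 μ := fun k =>
    (memLp_crossSum hV hg hh k).const_mul _
  have hin : ∀ k k' : ℕ, inner ℝ ((hm k).toLp _) ((hm k').toLp _)
      = (k : ℝ)⁻¹ * (k' : ℝ)⁻¹ * ∫ ω, crossSum V g h k ω * crossSum V g h k' ω ∂μ := by
    intro k k'
    rw [← integral_mul_eq_inner_toLp, ← integral_const_mul]
    congr 1; ext ω; ring
  have hb : ∀ k k' : ℕ, k ≤ k' → |inner ℝ ((hm k).toLp _) ((hm k').toLp _)|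
      ≤ 4 * e * √k * (√k')⁻¹ := by
    intro k k' hk
    rcases Nat.eq_zero_or_pos k with rfl | hk0
    · rw [hin]; simp
    have hk0' : (0 : ℝ) < k := by exact_mod_cast hk0
    have hk1' : (0 : ℝ) < k' := by exact_mod_cast hk0.trans_le hk
    have h1 := abs_integral_crossSum_mul_le hV hg hh (le_max_left _ _) (le_max_right _ _) hk
    rw [hin, abs_mul, abs_of_pos (by positivity : 0 < (k : ℝ)⁻¹ * (k' : ℝ)⁻¹)]
    calc _ ≤ (k : ℝ)⁻¹ * (k' : ℝ)⁻¹ * (k * (4 * e * √(k * k'))) := by gcongr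
      _ = 4 * e * √k * (√k')⁻¹ := by
        rw [Real.sqrt_mul hk0'.le]
        have : (k' : ℝ) = √k' * √k' := (Real.mul_self_sqrt hk1'.le).symm
        have h2 : √(k' : ℝ) ≠ 0 := by positivity
        field_simp
        rw [Real.sq_sqrt hk1'.le]; ring
  have hC : ∀ k : ℕ, ‖(hm k).toLp _‖ ≤ √(4 * e) := by
    intro k
    refine Real.le_sqrt_of_sq_le ?_
    rw [← real_inner_self_eq_norm_sq]
    refine (le_abs_self _).trans ((hb k k le_rfl).trans ?_)
    rw [mul_assoc]
    refine mul_le_of_le_one_right (by positivity) ?_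
    exact mul_inv_le_one
  have hlim : ∀ k : ℕ, Tendsto (fun k' : ℕ => inner ℝ ((hm k).toLp _) ((hm k').toLp _)) atTop
      (𝓝 0) := by
    intro k
    have h1 : Tendsto (fun k' : ℕ => 4 * e * √k * (√k')⁻¹) atTop (𝓝 0) := by
      have := (Real.tendsto_sqrt_atTop.comp tendsto_natCast_atTop_atTop).inv_tendsto_atTop
      simpa using this.const_mul (4 * e * √k)
    refine squeeze_zero_norm' ?_ h1
    filter_upwards [eventually_ge_atTop k] with k' hk'
    exact hb k k' hk'
  refine (tendsto_inner_of_asymptotically_orthogonal hC hlim (hy.toLp y)).congr fun k => ?_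
  rw [← integral_mul_eq_inner_toLp, ← integral_const_mul]
  congr 1; ext ω; ring

end WeakNull

/-! ### The quadratic variation -/

section QuadraticVariation

variable {Ω : Type*} {𝒬 mΩ : MeasurableSpace Ω} {μ : Measure Ω} {U V : Ω → Ω} {f : Ω → ℝ}

lemma integral_sq_avg_comp_le (hU : MeasurePreserving U μ μ) {x : Ω → ℝ}
    (hx : MemLp x 2 μ) (m : ℕ) :
    ∫ ω, ((m : ℝ)⁻¹ * ∑ i ∈ Finset.range m, x (U^[i] ω)) ^ 2 ∂μ ≤ ∫ ω, x ω ^ 2 ∂μ := by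
  have hi : ∀ i, Integrable (fun ω => x (U^[i] ω) ^ 2) μ := fun i =>
    (memLp_comp (hU.iterate i) hx).integrable_sq
  refine (integral_mono (memLp_avg hU hx m).integrable_sq
    ((integrable_finsetSum _ fun i _ => hi i).const_mul _)
    fun ω => sq_avg_le m fun i => x (U^[i] ω)).trans ?_
  rw [integral_const_mul, integral_finsetSum _ fun i _ => hi i]
  refine avg_le_of_le (integral_nonneg fun ω => sq_nonneg _) fun i _ => ?_
  rw [integral_comp' (g := fun ω => x ω ^ 2) (hU.iterate i) (hx.1.pow 2)]

/-- Long ergodic averages of a function are hardly larger in `L²` than short ones. -/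
lemma integral_sq_avg_le_add (hU : MeasurePreserving U μ μ) {x : Ω → ℝ}
    (hx : MemLp x 2 μ) {m₀ : ℕ} (hm₀ : 0 < m₀) (m : ℕ) :
    ∫ ω, ((m : ℝ)⁻¹ * ∑ i ∈ Finset.range m, x (U^[i] ω)) ^ 2 ∂μ
      ≤ 2 * ∫ ω, ((m₀ : ℝ)⁻¹ * ∑ i ∈ Finset.range m₀, x (U^[i] ω)) ^ 2 ∂μ
        + 2 * (2 * m₀ / m) ^ 2 * ∫ ω, x ω ^ 2 ∂μ := by
  let L : Lp ℝ 2 μ →ₗ[ℝ] Lp ℝ 2 μ := (Lp.compMeasurePreservingₗᵢ ℝ U hU).toLinearMap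
  have hL : ∀ y, L y = Lp.compMeasurePreserving U hU y := fun y => rfl
  have hLn : ∀ y, ‖L y‖ ≤ ‖y‖ := fun y => (LinearIsometry.norm_map _ y).le
  have hpow : ∀ i : ℕ, (L ^ i) (hx.toLp x)
      = (memLp_comp (hU.iterate i) hx).toLp (fun ω => x (U^[i] ω)) := by
    intro i
    induction i with
    | zero => rfl
    | succ i ih =>
      rw [pow_succ', Module.End.mul_apply, ih, hL, Lp.toLp_compMeasurePreserving]
      rfl
  have havg : ∀ n : ℕ, opAvg L n (hx.toLp x) = (memLp_avg hU hx n).toLp _ := by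
    intro n
    simp only [opAvg_apply, hpow]
    refine Lp.ext ?_
    refine (Lp.coeFn_smul _ _).trans ?_
    refine EventuallyEq.trans ?_ (memLp_avg hU hx n).coeFn_toLp.symm
    have h1 : ∀ᵐ ω ∂μ, ∀ i : ℕ, (memLp_comp (hU.iterate i) hx).toLp
        (fun ω => x (U^[i] ω)) ω = x (U^[i] ω) :=
      ae_all_iff.2 fun i => (memLp_comp (hU.iterate i) hx).coeFn_toLp
    filter_upwards [h1, Lp.coeFn_finsetSum (Finset.range n) (fun i =>
      (memLp_comp (hU.iterate i) hx).toLp (fun ω => x (U^[i] ω)))] with ω h2 h3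
    rw [Pi.smul_apply, h3]
    simp [h2]
  have h := norm_opAvg_le_add hLn hm₀ m (hx.toLp x)
  rw [integral_sq_eq_norm_toLp (memLp_avg hU hx m), integral_sq_eq_norm_toLp (memLp_avg hU hx m₀),
    integral_sq_eq_norm_toLp hx, ← havg, ← havg]
  have h0 := norm_nonneg (opAvg L m (hx.toLp x))
  calc _ ≤ (‖opAvg L m₀ (hx.toLp x)‖ + 2 * m₀ / m * ‖hx.toLp x‖) ^ 2 := by gcongr
    _ ≤ _ := by
      nlinarith [sq_nonneg (‖opAvg L m₀ (hx.toLp x)‖ - 2 * m₀ / m * ‖hx.toLp x‖)]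

/-- The correlation of two innovations `g · vSum h k`, normalized by `k`, converges to a relative
correlation: only the diagonal terms contribute. -/
lemma tendsto_integral_mul_vSum_mul [IsProbabilityMeasure μ] (hV : MeasurePreserving V μ μ)
    {g h : Ω → ℝ} (hg : RowDiff μ V 𝒬 g) (hh : RowDiff μ V 𝒬 h) :
    Tendsto (fun k : ℕ => (k : ℝ)⁻¹ * ∫ ω, (g ω * vSum V g k ω) * (h ω * vSum V h k ω) ∂μ) atTop
      (𝓝 (∫ ω, relExp μ V (fun ω => g ω * h ω) ω ^ 2 ∂μ)) := by
  have hy : MemLp (fun ω => g ω * h ω) 2 μ := memLp_mul_of_memLp_four hg.memLp hh.memLp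
  have h1 := tendsto_avg_integral_mul_comp hV hy (memLp_comp hV hy)
  have hinv : (μ[fun ω => g (V ω) * h (V ω) | MeasurableSpace.invariants V])
      =ᵐ[μ] relExp μ V (fun ω => g ω * h ω) := by
    refine (condExp_invariants_comp_comm hV hV (fun _ => rfl) hy).symm.trans ?_
    exact Eventually.of_forall fun ω =>
      comp_eq_of_stronglyMeasurable_invariants stronglyMeasurable_condExp ω
  have e1 : ∫ ω, (g ω * h ω) *
      (μ[fun ω => g (V ω) * h (V ω) | MeasurableSpace.invariants V]) ω ∂μ
      = ∫ ω, relExp μ V (fun ω => g ω * h ω) ω ^ 2 ∂μ := by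
    have : ∫ ω, (g ω * h ω) *
      (μ[fun ω => g (V ω) * h (V ω) | MeasurableSpace.invariants V]) ω ∂μ
      = ∫ ω, (g ω * h ω) * relExp μ V (fun ω => g ω * h ω) ω ∂μ := by
      refine integral_congr_ae ?_
      filter_upwards [hinv] with ω hω
      rw [hω]
    rw [this, integral_mul_relExp hy hy]
    simp only [sq]
  rw [e1] at h1
  have h2 := (h1.add (tendsto_integral_mul_crossSum hV hg hh hy)).add
    (tendsto_integral_mul_crossSum hV hh hg hy)
  simp only [add_zero] at h2
  refine h2.congr fun k => ?_
  have hc1 := integrable_mul_of_memLp_two hy (memLp_crossSum hV hg hh k)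
  have hc2 := integrable_mul_of_memLp_two hy (memLp_crossSum hV hh hg k)
  have hi : ∀ p, Integrable (fun ω => g ω * h ω * (g (V^[p + 1] ω) * h (V^[p + 1] ω))) μ :=
    fun p => integrable_mul_of_memLp_two hy (memLp_comp (hV.iterate (p + 1)) hy)
  have e2 : ∀ ω, (g ω * vSum V g k ω) * (h ω * vSum V h k ω)
      = (∑ p ∈ Finset.range k, g ω * h ω * (g (V^[p + 1] ω) * h (V^[p + 1] ω))
        + g ω * h ω * crossSum V g h k ω) + g ω * h ω * crossSum V h g k ω := by
    intro ω
    have := vSum_mul_vSum V g h k ω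
    rw [← Finset.mul_sum]
    change _ = (g ω * h ω * vSum V (fun ω => g ω * h ω) k ω + _) + _
    linear_combination (g ω * h ω) * this
  simp only [e2]
  rw [integral_add ((integrable_finsetSum _ fun p _ => hi p).fun_add hc1) hc2,
    integral_add (integrable_finsetSum _ fun p _ => hi p) hc1,
    integral_finsetSum _ fun p _ => hi p]
  simp only [Function.iterate_succ_apply']
  ring

lemma sum_sum_dist_le (b : ℕ → ℝ) (hb : ∀ r, 0 ≤ b r) (m : ℕ) :
    ∑ i ∈ Finset.range m, ∑ j ∈ Finset.range m, b ((j - i) + (i - j))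
      ≤ 2 * m * ∑ r ∈ Finset.range m, b r := by
  have h : ∀ i ∈ Finset.range m, ∑ j ∈ Finset.range m, b ((j - i) + (i - j))
      ≤ 2 * ∑ r ∈ Finset.range m, b r := by
    intro i hi
    have hi' : i < m := Finset.mem_range.1 hi
    obtain ⟨d, rfl⟩ : ∃ d, m = i + d := ⟨m - i, by omega⟩
    rw [Finset.sum_range_add, two_mul]
    refine add_le_add ?_ ?_
    · have e : ∑ j ∈ Finset.range i, b ((j - i) + (i - j))
          = ∑ j ∈ Finset.range i, b (i - 1 - j + 1) :=
        Finset.sum_congr rfl fun j hj => by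
          congr 1
          have := Finset.mem_range.1 hj
          omega
      rw [e, Finset.sum_range_reflect (fun j => b (j + 1))]
      refine le_trans ?_ (Finset.sum_le_sum_of_subset_of_nonneg
        (Finset.range_mono (show i + 1 ≤ i + d by omega)) fun r _ _ => hb r)
      rw [Finset.sum_range_succ']
      linarith [hb 0]
    · have e : ∑ x ∈ Finset.range d, b ((i + x - i) + (i - (i + x)))
          = ∑ x ∈ Finset.range d, b x :=
        Finset.sum_congr rfl fun x _ => by congr 1; omega
      rw [e]
      exact Finset.sum_le_sum_of_subset_of_nonneg (Finset.range_mono (by omega)) fun r _ _ => hb r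
  refine (Finset.sum_le_sum h).trans (le_of_eq ?_)
  simp only [Finset.sum_const, Finset.card_range, nsmul_eq_mul]
  ring

/-- The relative correlations are stationary. -/
lemma integral_sq_relExp_comp [IsProbabilityMeasure μ] (hU : MeasurePreserving U μ μ)
    (hV : MeasurePreserving V μ μ) (hUV : Function.Commute U V) (hf : MemLp f 4 μ) (i j : ℕ) :
    ∫ ω, relExp μ V (fun ω => f (U^[i] ω) * f (U^[j] ω)) ω ^ 2 ∂μ
      = ∫ ω, relExp μ V (fun ω => f (U^[(j - i) + (i - j)] ω) * f ω) ω ^ 2 ∂μ := by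
  wlog hij : i ≤ j generalizing i j
  · have := this j i (by omega)
    simp only [mul_comm (f (U^[i] _))]
    rw [this, add_comm]
  obtain ⟨r, rfl⟩ := Nat.exists_eq_add_of_le' hij
  have e : r + i - i + (i - (r + i)) = r := by omega
  rw [e]
  have hy : MemLp (fun ω => f (U^[r] ω) * f ω) 2 μ :=
    memLp_mul_of_memLp_four (memLp_comp (hU.iterate r) hf) hf
  have h := condExp_invariants_comp_comm (hU.iterate i) hV (hUV.iterate_left i) hy
  rw [← integral_comp' (hU.iterate i) (memLp_relExp (V := V) hy).integrable_sq.1]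
  refine integral_congr_ae ?_
  filter_upwards [h] with ω hω
  refine congrArg (· ^ 2) (Eq.trans ?_ hω.symm)
  simp only [Function.iterate_add_apply, mul_comm]

/-- The ergodic average in the direction `U` of the innovations `f · vSum f k`. -/
noncomputable def innovAvg (U V : Ω → Ω) (f : Ω → ℝ) (m k : ℕ) (ω : Ω) : ℝ :=
  (m : ℝ)⁻¹ * ∑ i ∈ Finset.range m, f (U^[i] ω) * vSum V (fun ω => f (U^[i] ω)) k ω

lemma innovation_innovAvg (hV : MeasurePreserving V μ μ)
    (hrow : ∀ i, RowDiff μ V 𝒬 (fun ω => f (U^[i] ω))) (m k : ℕ) :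
    Innovation μ V 𝒬 (innovAvg U V f m k) :=
  (Innovation.sum _ fun i _ => (hrow i).innovation_mul_vSum hV (hrow i) k).const_mul _

lemma innovAvg_eq (hUV : Function.Commute U V) (m k : ℕ) (ω : Ω) :
    innovAvg U V f m k ω
      = (m : ℝ)⁻¹ * ∑ i ∈ Finset.range m, (fun ω => f ω * vSum V f k ω) (U^[i] ω) := by
  simp only [innovAvg, vSum_comp_of_commute (hUV.iterate_left _)]

lemma integral_sq_innovAvg_le (hU : MeasurePreserving U μ μ) (hV : MeasurePreserving V μ μ)
    (hUV : Function.Commute U V) (hrow : ∀ i, RowDiff μ V 𝒬 (fun ω => f (U^[i] ω))) (m k : ℕ) :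
    ∫ ω, innovAvg U V f m k ω ^ 2 ∂μ ≤ 4 * k * ∫ ω, f ω ^ 4 ∂μ := by
  have h0 : RowDiff μ V 𝒬 f := hrow 0
  simp only [innovAvg_eq hUV]
  exact (integral_sq_avg_comp_le hU (h0.innovation_mul_vSum hV h0 k).memLp m).trans
    (h0.integral_sq_mul_vSum_le hV h0 le_rfl le_rfl k)

/-- The averaged innovations are negligible: their variance is `o(k)` as both the length `m` of the
average and the number `k` of summands tend to infinity. -/
theorem exists_forall_integral_sq_innovAvg_le [IsProbabilityMeasure μ]
    (hU : MeasurePreserving U μ μ) (hV : MeasurePreserving V μ μ)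
    (hUV : Function.Commute U V) (hrow : ∀ i, RowDiff μ V 𝒬 (fun ω => f (U^[i] ω)))
    (hβ : Tendsto (fun m : ℕ => (m : ℝ)⁻¹ * ∑ r ∈ Finset.range m,
      ∫ ω, relExp μ V (fun ω => f (U^[r] ω) * f ω) ω ^ 2 ∂μ) atTop (𝓝 0)) {ε : ℝ} (hε : 0 < ε) :
    ∃ M : ℕ, ∀ m k, M ≤ m → M ≤ k → ∫ ω, innovAvg U V f m k ω ^ 2 ∂μ ≤ ε * k := by
  have h0 : RowDiff μ V 𝒬 f := hrow 0
  set e := ∫ ω, f ω ^ 4 ∂μ with he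
  have he0 : 0 ≤ e := integral_nonneg fun ω => by positivity
  set β : ℕ → ℝ := fun r => ∫ ω, relExp μ V (fun ω => f (U^[r] ω) * f ω) ω ^ 2 ∂μ with hβd
  have hβ0 : ∀ r, 0 ≤ β r := fun r => integral_nonneg fun ω => sq_nonneg _
  obtain ⟨m₀, hm₀, hm₀β⟩ : ∃ m₀ : ℕ, 0 < m₀ ∧
      (m₀ : ℝ)⁻¹ * ∑ r ∈ Finset.range m₀, β r < ε / 8 := by
    have := (hβ.eventually (gt_mem_nhds (show (0 : ℝ) < ε / 8 by positivity))).and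
      (eventually_gt_atTop 0)
    obtain ⟨m₀, h1, h2⟩ := this.exists
    exact ⟨m₀, h2, h1⟩
  have hm₀' : (0 : ℝ) < m₀ := by exact_mod_cast hm₀
  -- For a fixed length of the average, the normalized variance converges.
  have hlim : Tendsto (fun k : ℕ => (k : ℝ)⁻¹ * ∫ ω, innovAvg U V f m₀ k ω ^ 2 ∂μ) atTop
      (𝓝 ((m₀ : ℝ)⁻¹ ^ 2 * ∑ i ∈ Finset.range m₀, ∑ j ∈ Finset.range m₀,
        β ((j - i) + (i - j)))) := by
    have h1 := (tendsto_finsetSum (Finset.range m₀) fun i _ =>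
      tendsto_finsetSum (Finset.range m₀) fun j _ =>
        tendsto_integral_mul_vSum_mul hV (hrow i) (hrow j)).const_mul ((m₀ : ℝ)⁻¹ ^ 2)
    simp only [integral_sq_relExp_comp hU hV hUV h0.memLp] at h1
    refine h1.congr fun k => ?_
    simp only [innovAvg, mul_pow]
    rw [integral_const_mul, integral_sq_sum _ fun i =>
      ((hrow i).innovation_mul_vSum hV (hrow i) k).memLp]
    simp only [Finset.mul_sum]
    refine Finset.sum_congr rfl fun i _ => Finset.sum_congr rfl fun j _ => ?_
    ring
  have hlt : (m₀ : ℝ)⁻¹ ^ 2 * ∑ i ∈ Finset.range m₀, ∑ j ∈ Finset.range m₀,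
      β ((j - i) + (i - j)) < ε / 4 := by
    calc _ ≤ (m₀ : ℝ)⁻¹ ^ 2 * (2 * m₀ * ∑ r ∈ Finset.range m₀, β r) := by
          gcongr
          exact sum_sum_dist_le β hβ0 m₀
      _ = 2 * ((m₀ : ℝ)⁻¹ * ∑ r ∈ Finset.range m₀, β r) := by field_simp
      _ < ε / 4 := by linarith
  obtain ⟨K, hK⟩ := eventually_atTop.1 (hlim.eventually (gt_mem_nhds hlt))
  have hlim2 : Tendsto (fun m : ℕ => 2 * (2 * m₀ / (m : ℝ)) ^ 2 * (4 * e)) atTop (𝓝 0) := by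
    have h1 : Tendsto (fun m : ℕ => (2 * m₀ / (m : ℝ))) atTop (𝓝 0) :=
      tendsto_const_nhds.div_atTop tendsto_natCast_atTop_atTop
    simpa using ((h1.pow 2).const_mul 2).mul_const (4 * e)
  obtain ⟨K', hK'⟩ := eventually_atTop.1
    (hlim2.eventually (gt_mem_nhds (show (0 : ℝ) < ε / 2 by positivity)))
  refine ⟨max (max K K') 1, fun m k hm hk => ?_⟩
  have hk0 : (0 : ℝ) < k := by exact_mod_cast (le_of_max_le_right hk)
  have a1 := hK k (le_of_max_le_left (le_of_max_le_left hk))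
  have a2 := hK' m (le_of_max_le_right (le_of_max_le_left hm))
  rw [inv_mul_lt_iff₀ hk0] at a1
  have a3 := integral_sq_avg_le_add hU (h0.innovation_mul_vSum hV h0 k).memLp hm₀ m
  have a4 := h0.integral_sq_mul_vSum_le hV h0 le_rfl le_rfl k
  simp only [innovAvg_eq hUV] at a1 ⊢
  refine a3.trans ?_
  have a5 : 2 * (2 * m₀ / (m : ℝ)) ^ 2 * ∫ ω, (f ω * vSum V f k ω) ^ 2 ∂μ
      ≤ 2 * (2 * m₀ / (m : ℝ)) ^ 2 * (4 * k * e) := by gcongr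
  nlinarith

/-- The off-diagonal part of the quadratic variation is negligible: it is a sum of orthogonal
innovations. -/
theorem exists_forall_integral_sq_avg_crossSum_le [IsProbabilityMeasure μ]
    (hU : MeasurePreserving U μ μ) (hV : MeasurePreserving V μ μ)
    (hUV : Function.Commute U V) (hrow : ∀ i, RowDiff μ V 𝒬 (fun ω => f (U^[i] ω)))
    (hβ : Tendsto (fun m : ℕ => (m : ℝ)⁻¹ * ∑ r ∈ Finset.range m,
      ∫ ω, relExp μ V (fun ω => f (U^[r] ω) * f ω) ω ^ 2 ∂μ) atTop (𝓝 0)) {ε : ℝ} (hε : 0 < ε) :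
    ∃ M : ℕ, ∀ m n, M ≤ m → M ≤ n → ∫ ω, ((n : ℝ)⁻¹ * ((m : ℝ)⁻¹ * ∑ i ∈ Finset.range m,
      crossSum V (fun ω => f (U^[i] ω)) (fun ω => f (U^[i] ω)) n ω)) ^ 2 ∂μ ≤ ε := by
  obtain ⟨M, hM⟩ := exists_forall_integral_sq_innovAvg_le hU hV hUV hrow hβ
    (show 0 < ε / 2 by positivity)
  set e := ∫ ω, f ω ^ 4 ∂μ with he
  have he0 : 0 ≤ e := integral_nonneg fun ω => by positivity
  obtain ⟨N, hN⟩ := exists_nat_gt (4 * M * e / (ε / 2))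
  refine ⟨max (max M N) 1, fun m n hm hn => ?_⟩
  have hn0 : (0 : ℝ) < n := by exact_mod_cast (le_of_max_le_right hn)
  have hnN : (N : ℝ) ≤ n := by exact_mod_cast le_of_max_le_right (le_of_max_le_left hn)
  have e1 : ∀ ω, (m : ℝ)⁻¹ * ∑ i ∈ Finset.range m,
      crossSum V (fun ω => f (U^[i] ω)) (fun ω => f (U^[i] ω)) n ω
      = ∑ l ∈ Finset.range n, innovAvg U V f m (n - 1 - l) (V^[l + 1] ω) := by
    intro ω
    simp only [crossSum, innovAvg, Finset.mul_sum]
    exact Finset.sum_comm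
  simp only [e1, mul_pow]
  have h1 := integral_sum_comp_mul_sum_comp hV (le_refl n)
    (fun l => innovation_innovAvg hV hrow m (n - 1 - l))
    (fun l => innovation_innovAvg hV hrow m (n - 1 - l))
  simp only [← sq] at h1
  rw [integral_const_mul, h1,
    Finset.sum_range_reflect (fun k => ∫ ω, innovAvg U V f m k ω ^ 2 ∂μ)]
  have h2 : ∀ k ∈ Finset.range n, ∫ ω, innovAvg U V f m k ω ^ 2 ∂μ ≤ 4 * M * e + ε / 2 * n := by
    intro k hk
    have hkn : (k : ℝ) ≤ n := by exact_mod_cast (Finset.mem_range.1 hk).le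
    rcases le_total M k with hMk | hMk
    · have := hM m k (le_of_max_le_left (le_of_max_le_left hm)) hMk
      have h3 : ε / 2 * k ≤ ε / 2 * n := by gcongr
      have h4 : 0 ≤ 4 * M * e := by positivity
      linarith
    · have := integral_sq_innovAvg_le hU hV hUV hrow m k
      have h3 : 4 * (k : ℝ) * e ≤ 4 * M * e := by gcongr
      have h4 : 0 ≤ ε / 2 * n := by positivity
      linarith
  have h3 : ∑ k ∈ Finset.range n, ∫ ω, innovAvg U V f m k ω ^ 2 ∂μ
      ≤ n * (4 * M * e + ε / 2 * n) := by
    refine (Finset.sum_le_card_nsmul _ _ _ h2).trans (le_of_eq ?_)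
    rw [Finset.card_range, nsmul_eq_mul]
  have h4 : 4 * M * e ≤ ε / 2 * n := by
    rw [div_lt_iff₀ (by positivity)] at hN
    nlinarith
  calc (n : ℝ)⁻¹ ^ 2 * ∑ k ∈ Finset.range n, ∫ ω, innovAvg U V f m k ω ^ 2 ∂μ
      ≤ (n : ℝ)⁻¹ ^ 2 * (n * (ε / 2 * n + ε / 2 * n)) := by
        gcongr
        refine h3.trans ?_
        gcongr
    _ = ε := by field_simp; ring

/-- The mean ergodic theorem for two commuting transformations with trivial joint invariants. -/
theorem exists_forall_integral_sq_avg_avg_sub_le [IsProbabilityMeasure μ]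
    (hU : MeasurePreserving U μ μ) (hV : MeasurePreserving V μ μ) (hUV : Function.Commute U V)
    (herg : ∀ h : Ω → ℝ, MemLp h 2 μ → (fun ω => h (U ω)) =ᵐ[μ] h → (fun ω => h (V ω)) =ᵐ[μ] h →
      h =ᵐ[μ] fun _ => ∫ ω, h ω ∂μ)
    {g : Ω → ℝ} (hg : MemLp g 2 μ) {ε : ℝ} (hε : 0 < ε) :
    ∃ M : ℕ, ∀ m n, M ≤ m → M ≤ n → ∫ ω, ((m : ℝ)⁻¹ * ∑ i ∈ Finset.range m,
      ((n : ℝ)⁻¹ * ∑ p ∈ Finset.range n, g (U^[i] (V^[p] ω))) - ∫ ω, g ω ∂μ) ^ 2 ∂μ ≤ ε := by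
  set P := relExp μ V g with hP
  have hP2 : MemLp P 2 μ := memLp_relExp hg
  set E := relExp μ U P with hE
  have hE2 : MemLp E 2 μ := memLp_relExp hP2
  have hconst : E =ᵐ[μ] fun _ => ∫ ω, g ω ∂μ := by
    have h1 := herg E hE2 (Eventually.of_forall fun ω =>
      comp_eq_of_stronglyMeasurable_invariants stronglyMeasurable_condExp ω) ?_
    · have h2 : ∫ ω, E ω ∂μ = ∫ ω, g ω ∂μ := by
        rw [hE, integral_condExp (MeasurableSpace.invariants_le U), hP,
          integral_condExp (MeasurableSpace.invariants_le V)]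
      rwa [h2] at h1
    · refine (condExp_invariants_comp_comm hV hU hUV.symm hP2).trans ?_
      have : (fun ω => P (V ω)) = P := funext fun ω =>
        comp_eq_of_stronglyMeasurable_invariants stronglyMeasurable_condExp ω
      rw [this]
  have t1 := tendsto_integral_sq_avg_sub_condExp hV hg
  have t2 := tendsto_integral_sq_avg_sub_condExp hU hP2
  obtain ⟨N₁, hN₁⟩ := eventually_atTop.1 (t1.eventually (gt_mem_nhds (show 0 < ε / 4 by positivity)))
  obtain ⟨N₂, hN₂⟩ := eventually_atTop.1 (t2.eventually (gt_mem_nhds (show 0 < ε / 4 by positivity)))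
  refine ⟨max N₁ N₂, fun m n hm hn => ?_⟩
  have b1 := hN₁ n (le_of_max_le_left hn)
  have b2 := hN₂ m (le_of_max_le_right hm)
  set D : Ω → ℝ := fun ω => (n : ℝ)⁻¹ * ∑ p ∈ Finset.range n, g (V^[p] ω) - P ω with hD
  have hD2 : MemLp D 2 μ := memLp_fun_sub (memLp_avg hV hg n) hP2
  have b3 := integral_sq_avg_comp_le hU hD2 m
  have hA := memLp_avg hU hD2 m
  have hB : MemLp (fun ω => (m : ℝ)⁻¹ * ∑ i ∈ Finset.range m, P (U^[i] ω) - E ω) 2 μ :=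
    memLp_fun_sub (memLp_avg hU hP2 m) hE2
  have hle : ∫ ω, ((m : ℝ)⁻¹ * ∑ i ∈ Finset.range m,
      ((n : ℝ)⁻¹ * ∑ p ∈ Finset.range n, g (U^[i] (V^[p] ω))) - ∫ ω, g ω ∂μ) ^ 2 ∂μ
      ≤ ∫ ω, (2 * ((m : ℝ)⁻¹ * ∑ i ∈ Finset.range m, D (U^[i] ω)) ^ 2
        + 2 * ((m : ℝ)⁻¹ * ∑ i ∈ Finset.range m, P (U^[i] ω) - E ω) ^ 2) ∂μ := by
    refine integral_mono_of_nonneg (Eventually.of_forall fun ω => sq_nonneg _)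
      ((hA.integrable_sq.const_mul 2).add (hB.integrable_sq.const_mul 2)) ?_
    filter_upwards [hconst] with ω hω
    have e1 : (m : ℝ)⁻¹ * ∑ i ∈ Finset.range m,
        ((n : ℝ)⁻¹ * ∑ p ∈ Finset.range n, g (U^[i] (V^[p] ω))) - ∫ ω, g ω ∂μ
        = (m : ℝ)⁻¹ * ∑ i ∈ Finset.range m, D (U^[i] ω)
          + ((m : ℝ)⁻¹ * ∑ i ∈ Finset.range m, P (U^[i] ω) - E ω) := by
      have e2 : ∀ i p, V^[p] (U^[i] ω) = U^[i] (V^[p] ω) := fun i p =>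
        (((hUV.iterate_left i).iterate_right p) ω).symm
      rw [hω]
      simp only [hD, Finset.sum_sub_distrib, e2]
      ring
    rw [e1]
    nlinarith [sq_nonneg ((m : ℝ)⁻¹ * ∑ i ∈ Finset.range m, D (U^[i] ω)
      - ((m : ℝ)⁻¹ * ∑ i ∈ Finset.range m, P (U^[i] ω) - E ω))]
  refine hle.trans ?_
  rw [integral_add (hA.integrable_sq.const_mul 2) (hB.integrable_sq.const_mul 2),
    integral_const_mul, integral_const_mul]
  linarith

/-- The law of large numbers for the quadratic variation. -/
theorem exists_forall_integral_abs_quadratic_le [IsProbabilityMeasure μ]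
    (hU : MeasurePreserving U μ μ) (hV : MeasurePreserving V μ μ)
    (hUV : Function.Commute U V) (hrow : ∀ i, RowDiff μ V 𝒬 (fun ω => f (U^[i] ω)))
    (hβ : Tendsto (fun m : ℕ => (m : ℝ)⁻¹ * ∑ r ∈ Finset.range m,
      ∫ ω, relExp μ V (fun ω => f (U^[r] ω) * f ω) ω ^ 2 ∂μ) atTop (𝓝 0))
    (herg : ∀ h : Ω → ℝ, MemLp h 2 μ → (fun ω => h (U ω)) =ᵐ[μ] h → (fun ω => h (V ω)) =ᵐ[μ] h →
      h =ᵐ[μ] fun _ => ∫ ω, h ω ∂μ) {ε : ℝ} (hε : 0 < ε) :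
    ∃ M : ℕ, ∀ m n, M ≤ m → M ≤ n → ∫ ω, |(m : ℝ)⁻¹ * ∑ i ∈ Finset.range m,
      ((n : ℝ)⁻¹ * vSum V (fun ω => f (U^[i] ω)) n ω ^ 2) - ∫ ω, f ω ^ 2 ∂μ| ∂μ ≤ ε := by
  have h0 : RowDiff μ V 𝒬 f := hrow 0
  have hg : MemLp (fun ω => f ω ^ 2) 2 μ := memLp_sq_of_memLp_four h0.memLp
  obtain ⟨M₁, hM₁⟩ := exists_forall_integral_sq_avg_crossSum_le hU hV hUV hrow hβ
    (show 0 < ε ^ 2 / 16 by positivity)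
  obtain ⟨M₂, hM₂⟩ := exists_forall_integral_sq_avg_avg_sub_le hU hV hUV herg hg
    (show 0 < ε ^ 2 / 4 by positivity)
  refine ⟨max M₁ M₂, fun m n hm hn => ?_⟩
  have b1 := hM₁ m n (le_of_max_le_left hm) (le_of_max_le_left hn)
  have b2 := hM₂ m n (le_of_max_le_right hm) (le_of_max_le_right hn)
  set v := ∫ ω, f ω ^ 2 ∂μ with hv
  set A : Ω → ℝ := fun ω => (m : ℝ)⁻¹ * ∑ i ∈ Finset.range m,
      ((n : ℝ)⁻¹ * ∑ p ∈ Finset.range n, f (U^[i] (V^[p] ω)) ^ 2) - v with hA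
  set C : Ω → ℝ := fun ω => (n : ℝ)⁻¹ * ((m : ℝ)⁻¹ * ∑ i ∈ Finset.range m,
      crossSum V (fun ω => f (U^[i] ω)) (fun ω => f (U^[i] ω)) n ω) with hC
  have hA2 : MemLp A 2 μ := by
    have h1 : ∀ i, MemLp (fun ω => f (U^[i] ω) ^ 2) 2 μ := fun i => memLp_comp (hU.iterate i) hg
    exact memLp_fun_sub ((memLp_finsetSum _ fun i _ => memLp_avg hV (h1 i) n).const_mul _)
      (memLp_const v)
  have hAV := memLp_comp hV hA2
  have hC2 : MemLp C 2 μ :=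
    ((memLp_finsetSum _ fun i _ => memLp_crossSum hV (hrow i) (hrow i) n).const_mul _).const_mul _
  have e1 : ∀ ω, (m : ℝ)⁻¹ * ∑ i ∈ Finset.range m,
      ((n : ℝ)⁻¹ * vSum V (fun ω => f (U^[i] ω)) n ω ^ 2) - v = A (V ω) + 2 * C ω := by
    intro ω
    simp only [sq (vSum V _ n ω), vSum_mul_vSum]
    simp only [hA, hC, vSum, Function.iterate_succ_apply, mul_add, Finset.sum_add_distrib, ← sq]
    simp only [Finset.mul_sum]
    rw [show ∀ a b c : ℝ, a + b + b - c = a - c + 2 * b from fun a b c => by ring]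
    simp only [Finset.mul_sum]
    congr 1
    refine Finset.sum_congr rfl fun i _ => ?_
    ring
  have hT2 : MemLp (fun ω => A (V ω) + 2 * C ω) 2 μ := memLp_fun_add hAV (hC2.const_mul 2)
  simp only [e1]
  refine integral_abs_le_of_sq hT2 hε.le ?_
  have hle : ∫ ω, (A (V ω) + 2 * C ω) ^ 2 ∂μ ≤ ∫ ω, (2 * A (V ω) ^ 2 + 8 * C ω ^ 2) ∂μ :=
    integral_mono hT2.integrable_sq
      ((hAV.integrable_sq.const_mul 2).add (hC2.integrable_sq.const_mul 8)) fun ω => by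
        simp only
        nlinarith [sq_nonneg (A (V ω) - 2 * C ω)]
  rw [integral_add (hAV.integrable_sq.const_mul 2) (hC2.integrable_sq.const_mul 8),
    integral_const_mul, integral_const_mul,
    integral_comp' (g := fun ω => A ω ^ 2) hV (hA2.1.pow 2)] at hle
  linarith

end QuadraticVariation

/-! ### The action and the filtration -/

section Field

variable {Ω : Type*}

lemma sum_Icc_one_eq_sum_range {M : Type*} [AddCommMonoid M] (g : ℕ → M) (n : ℕ) :
    ∑ j ∈ Finset.Icc 1 n, g j = ∑ j ∈ Finset.range n, g (j + 1) := by
  induction n with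
  | zero => simp
  | succ n ih => rw [Finset.sum_Icc_succ_top (by omega), ih, Finset.sum_range_succ]

section Action

variable [AddAction (ℤ × ℤ) Ω]

lemma act_act (i j k l : ℤ) (ω : Ω) : act i j (act k l ω) = act (i + k) (j + l) ω := by
  simp only [act, ← add_vadd, Prod.mk_add_mk]

lemma act_zero (ω : Ω) : act 0 0 ω = ω := zero_vadd (ℤ × ℤ) ω

lemma act_iterate (k l : ℤ) (s : ℕ) (ω : Ω) : (act k l)^[s] ω = act (s * k) (s * l) ω := by
  induction s generalizing ω with
  | zero => simp [act_zero]
  | succ s ih =>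
    rw [Function.iterate_succ_apply, ih, act_act]
    push_cast
    congr 1 <;> ring

lemma act_commute (i j k l : ℤ) : Function.Commute (act (Ω := Ω) i j) (act k l) := fun ω => by
  simp only [act_act, add_comm]

end Action

variable {m m' mΩ : MeasurableSpace Ω} {μ : Measure Ω} {F : ℤ → ℤ → MeasurableSpace Ω} {f : Ω → ℝ}

lemma abs_pow_three_le (x : ℝ) : |x| ^ 3 ≤ 1 + x ^ 4 := by
  have h1 : x ^ 4 = |x| ^ 4 := by
    rw [show (4 : ℕ) = 2 * 2 by norm_num, pow_mul, pow_mul, sq_abs]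
  rw [h1]
  rcases le_total |x| 1 with h | h
  · have : |x| ^ 3 ≤ 1 := pow_le_one₀ (abs_nonneg x) h
    have : 0 ≤ |x| ^ 4 := by positivity
    linarith
  · have : |x| ^ 3 ≤ |x| ^ 4 := pow_le_pow_right₀ h (by norm_num)
    linarith

lemma integrable_abs_pow_three [IsProbabilityMeasure μ] {g : Ω → ℝ} (hg : MemLp g 4 μ) :
    Integrable (fun ω => |g ω| ^ 3) μ := by
  refine ((integrable_const 1).add (integrable_pow_four hg)).mono' (hg.1.norm.pow 3)
    (Eventually.of_forall fun ω => ?_)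
  rw [Real.norm_of_nonneg (by positivity)]
  exact abs_pow_three_le (g ω)

/-- An integral against a function measurable for a sub-σ-algebra is controlled by the conditional
expectation. -/
lemma abs_integral_mul_le_of_condExp [IsProbabilityMeasure μ] (hm : m ≤ mΩ) (hf : MemLp f 2 μ)
    {W : Ω → ℝ} {C : ℝ} (hWm : AEStronglyMeasurable[m] W μ) (hWb : BddBy μ C W) :
    |∫ ω, f ω * W ω ∂μ| ≤ (eLpNorm (μ[f | m]) 2 μ).toReal * |C| := by
  have hE : MemLp (μ[f | m]) 2 μ := hf.condExp one_le_two
  have hWf : Integrable (fun ω => W ω * f ω) μ := integrable_mul_of_memLp_two hWb.memLp hf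
  have e : ∫ ω, f ω * W ω ∂μ = ∫ ω, W ω * (μ[f | m]) ω ∂μ := by
    simp only [mul_comm (f _)]
    rw [← integral_condExp hm]
    exact integral_congr_ae (condExp_mul_of_aestronglyMeasurable_left hWm hWf
      (hf.integrable one_le_two))
  rw [e]
  refine abs_le_of_sq_le_sq ?_ (by positivity)
  refine (sq_integral_mul_le hWb.memLp hE).trans ?_
  rw [mul_pow, sq_abs, mul_comm, integral_sq_eq_norm_toLp hE, Lp.norm_toLp]
  have := hWb.integral_sq_le
  gcongr

variable [AddAction (ℤ × ℤ) Ω]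

lemma comap_act (hF : IsCompletelyCommutingInvariant μ F) (i j k l : ℤ) :
    (F i j).comap (act k l) = F (i + k) (j + l) := by
  rw [hF.invariant i j, hF.invariant (i + k), MeasurableSpace.comap_comp]
  congr 1
  ext ω
  exact act_act i j k l ω

lemma comap_act_rowLimit (hF : IsCompletelyCommutingInvariant μ F) (j k l : ℤ) :
    (rowLimit F j).comap (act k l) ≤ rowLimit F (j + l) := by
  rw [rowLimit, MeasurableSpace.comap_iSup]
  refine iSup_le fun i => ?_
  rw [comap_act hF]
  exact le_iSup (fun i => F i (j + l)) (i + k)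

lemma comap_act_colLimit (hF : IsCompletelyCommutingInvariant μ F) (i k l : ℤ) :
    (colLimit F i).comap (act k l) ≤ colLimit F (i + k) := by
  rw [colLimit, MeasurableSpace.comap_iSup]
  refine iSup_le fun j => ?_
  rw [comap_act hF]
  exact le_iSup (fun j => F (i + k) j) (j + l)

/-- Complete commutation makes the filtration increasing up to null sets. -/
lemma aestronglyMeasurable_of_le [IsProbabilityMeasure μ]
    (hF : IsCompletelyCommutingInvariant μ F) {g : Ω → ℝ}
    (hg : Integrable g μ) {i i' j j' : ℤ} (hi : i ≤ i') (hj : j ≤ j')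
    (hgm : AEStronglyMeasurable[F i j] g μ) : AEStronglyMeasurable[F i' j'] g μ := by
  have h1 : μ[g | F i j] =ᵐ[μ] g := condExp_of_aestronglyMeasurable' (hF.le i j) hgm hg
  have h2 := hF.commute i j i' j' g hg
  rw [min_eq_left hi, min_eq_left hj] at h2
  refine AEStronglyMeasurable.congr ?_ (h2.trans h1)
  exact stronglyMeasurable_condExp.aestronglyMeasurable

lemma rowLimit_le (hF : IsCompletelyCommutingInvariant μ F) (j : ℤ) : rowLimit F j ≤ mΩ :=
  iSup_le fun i => hF.le i j

lemma colLimit_le (hF : IsCompletelyCommutingInvariant μ F) (i : ℤ) : colLimit F i ≤ mΩ :=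
  iSup_le fun j => hF.le i j

variable [MeasurableConstVAdd (ℤ × ℤ) Ω]

lemma measurePreserving_act [VAddInvariantMeasure (ℤ × ℤ) Ω μ] (i j : ℤ) :
    MeasurePreserving (act (Ω := Ω) i j) μ μ := measurePreserving_vadd ((i, j) : ℤ × ℤ) μ

/-- A function that is almost surely invariant under two generators of the action is almost surely
constant, by ergodicity. -/
lemma ae_eq_integral_of_invariant [IsProbabilityMeasure μ] [ErgodicVAdd (ℤ × ℤ) Ω μ]
    {h : Ω → ℝ} (hh : MemLp h 2 μ) (h₁ : (fun ω => h (act 1 0 ω)) =ᵐ[μ] h)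
    (h₂ : (fun ω => h (act 0 (-1) ω)) =ᵐ[μ] h) : h =ᵐ[μ] fun _ => ∫ ω, h ω ∂μ := by
  let S : AddSubgroup (ℤ × ℤ) :=
    { carrier := {g | (fun ω => h (g +ᵥ ω)) =ᵐ[μ] h}
      add_mem' := fun {a b} ha hb => by
        have hb' : (fun ω => h (b +ᵥ ω)) =ᵐ[μ] h := hb
        have := (measurePreserving_vadd b μ).quasiMeasurePreserving.ae_eq_comp ha
        refine EventuallyEq.trans (Eventually.of_forall fun ω => ?_) (this.trans hb')
        simp [Function.comp, add_vadd]
      zero_mem' := by simp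
      neg_mem' := fun {a} ha => by
        have := (measurePreserving_vadd (-a) μ).quasiMeasurePreserving.ae_eq_comp ha
        refine EventuallyEq.trans this.symm (Eventually.of_forall fun ω => ?_)
        simp [Function.comp] }
  have hS : ∀ g : ℤ × ℤ, (fun ω => h (g +ᵥ ω)) =ᵐ[μ] h := by
    rintro ⟨i, j⟩
    have m1 : ((1, 0) : ℤ × ℤ) ∈ S := h₁
    have m2 : ((0, -1) : ℤ × ℤ) ∈ S := h₂
    have e : ((i, j) : ℤ × ℤ) = i • ((1, 0) : ℤ × ℤ) + (-j) • ((0, -1) : ℤ × ℤ) := by simp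
    have m3 : ((i, j) : ℤ × ℤ) ∈ S := by
      rw [e]; exact S.add_mem (S.zsmul_mem m1 i) (S.zsmul_mem m2 (-j))
    exact m3
  obtain ⟨h', hh', hhh'⟩ := hh.1
  have hS' : ∀ g : ℤ × ℤ, (fun ω => h' (g +ᵥ ω)) =ᵐ[μ] h' := fun g =>
    (((measurePreserving_vadd g μ).quasiMeasurePreserving.ae_eq_comp hhh').symm.trans
      (hS g)).trans hhh'
  obtain ⟨c, hc⟩ : ∃ c, h' =ᵐ[μ] Function.const Ω c :=
    exists_eventuallyEq_const_of_forall_separating MeasurableSet fun U hU => by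
      have := ErgodicVAdd.aeconst_of_forall_preimage_vadd_ae_eq (G := ℤ × ℤ) (μ := μ)
        (s := h' ⁻¹' U) (hh'.measurable hU) fun g => by
          filter_upwards [hS' g] with ω hω
          change (h' (g +ᵥ ω) ∈ U) = (h' ω ∈ U)
          rw [hω]
      exact eventuallyConst_set.1 this
  have hhc := hhh'.trans hc
  have hint : ∫ ω, h ω ∂μ = c := by
    rw [integral_congr_ae hhc]
    simp
  rw [hint]
  exact hhc

section Invariance

variable [VAddInvariantMeasure (ℤ × ℤ) Ω μ]

lemma aestronglyMeasurable_comp_act {k l : ℤ}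
    (hm : m'.comap (act k l) ≤ m) {W : Ω → ℝ} (hW : AEStronglyMeasurable[m'] W μ) :
    AEStronglyMeasurable[m] (fun ω => W (act k l ω)) μ := by
  obtain ⟨W', hW', hWW'⟩ := hW
  refine ⟨fun ω => W' (act k l ω), ?_,
    (measurePreserving_act k l).quasiMeasurePreserving.ae_eq_comp hWW'⟩
  exact hW'.comp_measurable (measurable_iff_comap_le.2 hm)

lemma aestronglyMeasurable_act (hF : IsCompletelyCommutingInvariant μ F)
    (hf : AEStronglyMeasurable[F 0 0] f μ) (i j : ℤ) :
    AEStronglyMeasurable[F i j] (fun ω => f (act i j ω)) μ :=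
  aestronglyMeasurable_comp_act (hF.invariant i j).ge hf

/-- The martingale difference property, transported along the action. -/
lemma integral_mul_act_eq_zero [IsProbabilityMeasure μ] (hm : m ≤ mΩ)
    (hce : μ[f | m] =ᵐ[μ] 0) (hf : Integrable f μ) {i j : ℤ}
    (hmm' : m'.comap (act (-i) (-j)) ≤ m) {W : Ω → ℝ} (hW : AEStronglyMeasurable[m'] W μ)
    (hWf : Integrable (fun ω => W ω * f (act i j ω)) μ) : ∫ ω, W ω * f (act i j ω) ∂μ = 0 := by
  have hT := measurePreserving_act (Ω := Ω) (μ := μ) (-i) (-j)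
  have e : ∀ ω, f (act i j (act (-i) (-j) ω)) = f ω := fun ω => by
    rw [act_act, add_neg_cancel, add_neg_cancel, act_zero]
  have hi : Integrable (fun ω => W (act (-i) (-j) ω) * f ω) μ := by
    have := hT.integrable_comp_of_integrable hWf
    simpa only [Function.comp_def, e] using this
  rw [← integral_comp' hT hWf.1]
  simp only [e]
  rw [← integral_condExp hm]
  have h1 := condExp_mul_of_aestronglyMeasurable_left
    (aestronglyMeasurable_comp_act hmm' hW) hi hf
  refine (integral_congr_ae (h1.trans ?_)).trans (integral_zero Ω ℝ)
  filter_upwards [hce] with ω hω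
  simp [hω]

lemma aestronglyMeasurable_act_rowLimit [IsProbabilityMeasure μ]
    (hF : IsCompletelyCommutingInvariant μ F) (hf : IsMartingaleDifference μ F f) {i j k : ℤ}
    (hjk : j ≤ k) : AEStronglyMeasurable[rowLimit F k] (fun ω => f (act i j ω)) μ :=
  (aestronglyMeasurable_of_le hF
    ((memLp_comp (measurePreserving_act i j) hf.memLp).integrable one_le_two) le_rfl hjk
    (aestronglyMeasurable_act hF hf.adapted i j)).mono (le_iSup (fun i => F i k) i)

lemma aestronglyMeasurable_act_colLimit [IsProbabilityMeasure μ]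
    (hF : IsCompletelyCommutingInvariant μ F) (hf : IsMartingaleDifference μ F f) {i j k : ℤ}
    (hik : i ≤ k) : AEStronglyMeasurable[colLimit F k] (fun ω => f (act i j ω)) μ :=
  (aestronglyMeasurable_of_le hF
    ((memLp_comp (measurePreserving_act i j) hf.memLp).integrable one_le_two) hik le_rfl
    (aestronglyMeasurable_act hF hf.adapted i j)).mono (le_iSup (fun j => F k j) j)

lemma act_iterate_iterate (s d : ℕ) (ω : Ω) :
    (act 1 0)^[s] ((act 0 (-1))^[d] ω) = act (s : ℤ) (-(d : ℤ)) ω := by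
  rw [act_iterate, act_iterate, act_act]
  simp

/-- Along the vertical direction, reversed, the translates of `f` in the horizontal direction are
martingale differences for one and the same past. -/
lemma rowDiff_act [IsProbabilityMeasure μ] (hF : IsCompletelyCommutingInvariant μ F)
    (hf : IsMartingaleDifference μ F f) (hf4 : MemLp f 4 μ) (s : ℕ) :
    RowDiff μ (act 0 (-1)) (rowLimit F (-1)) (fun ω => f ((act 1 0)^[s] ω)) := by
  refine ⟨memLp_comp ((measurePreserving_act 1 0).iterate s) hf4, fun d => ?_, fun W hW hWf => ?_⟩
  · simp only [act_iterate_iterate]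
    exact aestronglyMeasurable_act_rowLimit hF hf (by push_cast; omega)
  · have e : ∀ ω : Ω, (act 1 0)^[s] ω = act (s : ℤ) 0 ω := fun ω => by simp [act_iterate]
    simp only [e] at hWf ⊢
    exact integral_mul_act_eq_zero (rowLimit_le hF _) hf.condExp_row
      (hf.memLp.integrable one_le_two)
      ((comap_act_rowLimit hF _ _ _).trans (by simp)) hW hWf

/-- The tail condition, restated: `f` decorrelates from its truncations in the distant past, even
after multiplication by functions invariant in the horizontal direction. -/
lemma decorrelates_clamp [IsProbabilityMeasure μ] (hF : IsCompletelyCommutingInvariant μ F)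
    (hf : IsMartingaleDifference μ F f)
    (hf_tail : Tendsto (fun ℓ : ℕ => eLpNorm (μ[f | rowLimit F (-(ℓ : ℤ)) ⊔ inv₁]) 2 μ)
      atTop (𝓝 0)) (N : ℕ) :
    Decorrelates μ (act 1 0) (act 0 (-1)) f (fun ω => clamp N (f ω)) := by
  intro R w hw hwR
  have hlim : Tendsto (fun ℓ : ℕ => (eLpNorm (μ[f | rowLimit F (-(ℓ : ℤ)) ⊔ inv₁]) 2 μ).toReal
      * |N * R|) atTop (𝓝 0) := by
    have := ((ENNReal.tendsto_toReal ENNReal.zero_ne_top).comp hf_tail).mul_const |N * R|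
    simpa using this
  refine squeeze_zero_norm (fun j => ?_) hlim
  have hfV : ∀ ω : Ω, f ((act 0 (-1))^[j] ω) = f (act 0 (-(j : ℤ)) ω) := fun ω => by
    simp [act_iterate]
  refine abs_integral_mul_le_of_condExp
    (sup_le (rowLimit_le hF _) (MeasurableSpace.invariants_le _)) hf.memLp ?_
    (((bddBy_clamp hf.memLp.1 N).comp ((measurePreserving_act 0 (-1)).iterate j)).mul
      ⟨((hw j).mono (MeasurableSpace.invariants_le _)).aestronglyMeasurable, hwR j⟩)
  have hwj : StronglyMeasurable[rowLimit F (-(j : ℤ)) ⊔ inv₁] (w j) := (hw j).mono le_sup_right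
  refine AEStronglyMeasurable.mul ?_ hwj.aestronglyMeasurable
  refine (continuous_clamp N).comp_aestronglyMeasurable ?_
  simp only [hfV]
  exact (aestronglyMeasurable_act_rowLimit hF hf le_rfl).mono le_sup_left

/-! ### The normalized sums -/

/-- The contribution of the `i`-th column to the normalized sum, with the rows taken in reversed
order. -/
noncomputable def column (f : Ω → ℝ) (m n i : ℕ) (ω : Ω) : ℝ :=
  (1 / √((m : ℝ) * n)) * vSum (act 0 (-1)) (fun ω => f ((act 1 0)^[i] ω)) n ω

/-- Up to a translation, the normalized sum is the sum of the columns. -/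
lemma normalizedSum_act (m n : ℕ) (ω : Ω) :
    normalizedSum f m n (act (-1) (-(n : ℤ) - 1) ω) = ∑ i ∈ Finset.range m, column f m n i ω := by
  simp only [normalizedSum, column, ← Finset.mul_sum]
  congr 1
  rw [sum_Icc_one_eq_sum_range]
  refine Finset.sum_congr rfl fun i _ => ?_
  rw [sum_Icc_one_eq_sum_range, ← Finset.sum_range_reflect, vSum]
  refine Finset.sum_congr rfl fun p hp => ?_
  rw [act_iterate_iterate, act_act]
  have := Finset.mem_range.1 hp
  congr 2
  · push_cast; ring
  · omega

lemma memLp_vSum_act (hf4 : MemLp f 4 μ) (n i : ℕ) :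
    MemLp (vSum (act 0 (-1)) (fun ω => f ((act 1 0)^[i] ω)) n) 4 μ :=
  memLp_vSum (measurePreserving_act 0 (-1))
    (memLp_comp ((measurePreserving_act 1 0).iterate i) hf4) n

lemma memLp_column (hf4 : MemLp f 4 μ) (m n i : ℕ) : MemLp (column f m n i) 4 μ :=
  (memLp_vSum_act hf4 n i).const_mul _

lemma isMDS_column [IsProbabilityMeasure μ] (hF : IsCompletelyCommutingInvariant μ F)
    (hf : IsMartingaleDifference μ F f) (hf4 : MemLp f 4 μ) (m n : ℕ) :
    IsMDS μ (fun k => colLimit F ((k : ℤ) - 1)) (column f m n) := by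
  have hint : ∀ i, Integrable (column f m n i) μ := fun i =>
    (memLp_column hf4 m n i).integrable (by norm_num)
  refine ⟨fun i => (hint i).1, fun k i hik => ?_, fun k W C hW hW' hC => ?_,
    fun i => integrable_abs_pow_three (memLp_column hf4 m n i), hint⟩
  · refine AEStronglyMeasurable.const_mul (aestronglyMeasurable_fun_sum _ fun p _ => ?_) _
    simp only [act_iterate_iterate]
    exact aestronglyMeasurable_act_colLimit hF hf (by omega)
  · have e : ∀ ω, W ω * column f m n k ω = (1 / √((m : ℝ) * n)) *
        ∑ p ∈ Finset.range n, W ω * f (act (k : ℤ) (-((p + 1 : ℕ) : ℤ)) ω) := by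
      intro ω
      simp only [column, vSum, act_iterate_iterate, ← Finset.mul_sum]
      ring
    have hi : ∀ p : ℕ, Integrable (fun ω => W ω * f (act (k : ℤ) (-((p + 1 : ℕ) : ℤ)) ω)) μ :=
      fun p => ((memLp_comp (measurePreserving_act _ _) hf.memLp).integrable one_le_two).bdd_mul hW
        (Eventually.of_forall hC)
    simp only [e]
    rw [integral_const_mul, integral_finsetSum _ fun p _ => hi p]
    refine mul_eq_zero_of_right _ (Finset.sum_eq_zero fun p _ => ?_)
    exact integral_mul_act_eq_zero (colLimit_le hF _) hf.condExp_col
      (hf.memLp.integrable one_le_two)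
      ((comap_act_colLimit hF _ _ _).trans (le_of_eq (by congr 1; ring))) hW' (hi p)

/-- The third absolute moments of the columns are of order `m ^ (-3 / 2)`. -/
lemma sum_integral_abs_column_le [IsProbabilityMeasure μ] (hF : IsCompletelyCommutingInvariant μ F)
    (hf : IsMartingaleDifference μ F f) (hf4 : MemLp f 4 μ) {m n : ℕ} (hm : 0 < m) (hn : 0 < n) :
    ∑ i ∈ Finset.range m, ∫ ω, |column f m n i ω| ^ 3 ∂μ
      ≤ (1 + 16 * ∫ ω, f ω ^ 4 ∂μ) * (√m)⁻¹ := by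
  have hm' : (0 : ℝ) < m := by exact_mod_cast hm
  have hn' : (0 : ℝ) < n := by exact_mod_cast hn
  have h : ∀ i ∈ Finset.range m, ∫ ω, |column f m n i ω| ^ 3 ∂μ
      ≤ (√m)⁻¹ ^ 3 * (1 + 16 * ∫ ω, f ω ^ 4 ∂μ) := by
    intro i _
    set T := vSum (act 0 (-1)) (fun ω => f ((act 1 0)^[i] ω)) n with hT
    have hT4 : MemLp T 4 μ := memLp_vSum_act hf4 n i
    have h4 : MemLp (fun ω => (√n)⁻¹ * T ω) 4 μ := hT4.const_mul _
    have e : ∀ ω, |column f m n i ω| ^ 3 = (√m)⁻¹ ^ 3 * |(√n)⁻¹ * T ω| ^ 3 := by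
      intro ω
      rw [column, one_div, Real.sqrt_mul hm'.le, mul_inv, mul_assoc, abs_mul, mul_pow,
        abs_of_nonneg (by positivity : 0 ≤ (√(m : ℝ))⁻¹)]
    simp only [e]
    rw [integral_const_mul]
    refine mul_le_mul_of_nonneg_left ?_ (by positivity)
    refine (integral_mono (integrable_abs_pow_three h4)
      ((integrable_const 1).fun_add (integrable_pow_four h4)) fun ω => abs_pow_three_le _).trans ?_
    rw [integral_add (integrable_const 1) (integrable_pow_four h4)]
    simp only [mul_pow]
    rw [integral_const_mul, integral_const, probReal_univ, one_smul]
    have hrow := (rowDiff_act hF hf hf4 i).integral_vSum_pow_four_le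
      (measurePreserving_act 0 (-1)) n
    rw [integral_comp' (g := fun ω => f ω ^ 4) ((measurePreserving_act 1 0).iterate i)
      (hf4.1.pow 4)] at hrow
    have e3 : (√(n : ℝ))⁻¹ ^ 4 = ((n : ℝ) ^ 2)⁻¹ := by
      rw [inv_pow, show (4 : ℕ) = 2 * 2 by norm_num, pow_mul, Real.sq_sqrt hn'.le]
    rw [e3]
    have h5 : ((n : ℝ) ^ 2)⁻¹ * ∫ ω, T ω ^ 4 ∂μ ≤ 16 * ∫ ω, f ω ^ 4 ∂μ := by
      rw [inv_mul_le_iff₀ (by positivity)]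
      linarith
    linarith
  refine (Finset.sum_le_card_nsmul _ _ _ h).trans (le_of_eq ?_)
  rw [Finset.card_range, nsmul_eq_mul]
  have : √(m : ℝ) ≠ 0 := by positivity
  have h2 : (m : ℝ) = √m * √m := (Real.mul_self_sqrt hm'.le).symm
  calc (m : ℝ) * ((√m)⁻¹ ^ 3 * (1 + 16 * ∫ ω, f ω ^ 4 ∂μ))
      = (√m * √m) * ((√m)⁻¹ ^ 3 * (1 + 16 * ∫ ω, f ω ^ 4 ∂μ)) := by rw [← h2]
    _ = _ := by field_simp

lemma sum_column_sq (m n : ℕ) (ω : Ω) :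
    ∑ i ∈ Finset.range m, column f m n i ω ^ 2 = (m : ℝ)⁻¹ * ∑ i ∈ Finset.range m,
      ((n : ℝ)⁻¹ * vSum (act 0 (-1)) (fun ω => f ((act 1 0)^[i] ω)) n ω ^ 2) := by
  rw [Finset.mul_sum]
  refine Finset.sum_congr rfl fun i _ => ?_
  rw [column, mul_pow, one_div, inv_pow, Real.sq_sqrt (by positivity), mul_inv, mul_assoc]

lemma memLp_normalizedSum (hf4 : MemLp f 4 μ) (m n : ℕ) : MemLp (normalizedSum f m n) 4 μ := by
  unfold normalizedSum
  exact (memLp_finsetSum _ fun (i : ℕ) _ => memLp_finsetSum _ fun (j : ℕ) _ =>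
    memLp_comp (measurePreserving_act i j) hf4).const_mul _

end Invariance

/-- The characteristic functions of the normalized sums converge to the Gaussian one. -/
theorem exists_forall_norm_charFun_sub_le [IsProbabilityMeasure μ] [ErgodicVAdd (ℤ × ℤ) Ω μ]
    (hF : IsCompletelyCommutingInvariant μ F) (hf : IsMartingaleDifference μ F f)
    (hf4 : MemLp f 4 μ)
    (hf_tail : Tendsto (fun ℓ : ℕ => eLpNorm (μ[f | rowLimit F (-(ℓ : ℤ)) ⊔ inv₁]) 2 μ)
      atTop (𝓝 0)) (t : ℝ) {ε : ℝ} (hε : 0 < ε) :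
    ∃ M : ℕ, ∀ m n, M ≤ m → M ≤ n → ‖charFun (μ.map (normalizedSum f m n)) t
      - Complex.exp ((-(t ^ 2 * (∫ ω, f ω ^ 2 ∂μ) / 2) : ℝ))‖ ≤ ε := by
  have hU : MeasurePreserving (act (Ω := Ω) 1 0) μ μ := measurePreserving_act 1 0
  have hV : MeasurePreserving (act (Ω := Ω) 0 (-1)) μ μ := measurePreserving_act 0 (-1)
  have hUV : Function.Commute (act (Ω := Ω) 1 0) (act 0 (-1)) := act_commute _ _ _ _
  have hβ := tendsto_avg_integral_sq_relExp hU hV hUV hf4 (decorrelates_clamp hF hf hf_tail)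
  set v := ∫ ω, f ω ^ 2 ∂μ with hv
  have hv0 : 0 ≤ v := integral_nonneg fun ω => sq_nonneg _
  obtain ⟨K, hK⟩ := exists_norm_integral_exp_sub_le (μ := μ) hv0 t
  obtain ⟨M₁, hM₁⟩ := exists_forall_integral_abs_quadratic_le hU hV hUV (rowDiff_act hF hf hf4) hβ
    (fun h hh h₁ h₂ => ae_eq_integral_of_invariant hh h₁ h₂)
    (show 0 < ε / (2 * (|K| + 1)) by positivity)
  have hlim : Tendsto (fun m : ℕ => (1 + 16 * ∫ ω, f ω ^ 4 ∂μ) * (√(m : ℝ))⁻¹) atTop (𝓝 0) := by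
    have := (Real.tendsto_sqrt_atTop.comp tendsto_natCast_atTop_atTop).inv_tendsto_atTop
    simpa using this.const_mul (1 + 16 * ∫ ω, f ω ^ 4 ∂μ)
  obtain ⟨M₂, hM₂⟩ := eventually_atTop.1 (hlim.eventually
    (gt_mem_nhds (show 0 < ε / (2 * (|K| + 1)) by positivity)))
  refine ⟨max (max M₁ M₂) 1, fun m n hm hn => ?_⟩
  have hm1 : 0 < m := le_of_max_le_right hm
  have hn1 : 0 < n := le_of_max_le_right hn
  have b1 := hM₁ m n (le_of_max_le_left (le_of_max_le_left hm))
    (le_of_max_le_left (le_of_max_le_left hn))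
  have b2 := (sum_integral_abs_column_le hF hf hf4 hm1 hn1).trans
    (hM₂ m (le_of_max_le_right (le_of_max_le_left hm))).le
  have b3 := hK _ _ (isMDS_column hF hf hf4 m n) (fun i =>
    (memLp_sq_of_memLp_four (memLp_column hf4 m n i)).integrable one_le_two) m
  have e : charFun (μ.map (normalizedSum f m n)) t
      = ∫ ω, Complex.exp (t * (∑ i ∈ Finset.range m, column f m n i ω : ℝ) * Complex.I) ∂μ := by
    have hm4 := (memLp_normalizedSum hf4 m n).1
    have hc : Continuous fun x : ℝ => Complex.exp (t * x * Complex.I) := by fun_prop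
    have hT := measurePreserving_act (Ω := Ω) (μ := μ) (-1) (-(n : ℤ) - 1)
    rw [charFun_apply_real, integral_map hm4.aemeasurable hc.aestronglyMeasurable]
    simp only [← normalizedSum_act]
    have h1 : AEStronglyMeasurable (fun ω => Complex.exp (t * (normalizedSum f m n ω : ℝ)
      * Complex.I)) μ := hc.comp_aestronglyMeasurable hm4
    conv_lhs => rw [← hT.map_eq]
    rw [integral_map hT.aemeasurable (by rwa [hT.map_eq])]
  rw [e]
  refine b3.trans ?_
  simp only [sum_column_sq]
  have hK1 : K ≤ |K| + 1 := (le_abs_self K).trans (by linarith)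
  have hK0 : 0 < |K| + 1 := by positivity
  set a := ∫ ω, |(m : ℝ)⁻¹ * ∑ i ∈ Finset.range m,
      ((n : ℝ)⁻¹ * vSum (act 0 (-1)) (fun ω => f ((act 1 0)^[i] ω)) n ω ^ 2) - v| ∂μ with ha
  set b := ∑ i ∈ Finset.range m, ∫ ω, |column f m n i ω| ^ 3 ∂μ with hb
  have ha0 : 0 ≤ a := integral_nonneg fun ω => abs_nonneg _
  have hb0 : 0 ≤ b := Finset.sum_nonneg fun i _ => integral_nonneg fun ω => by positivity
  calc K * (a + b) ≤ (|K| + 1) * (ε / (2 * (|K| + 1)) + ε / (2 * (|K| + 1))) := by gcongr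
    _ = ε := by field_simp; ring

end Field

end MartingaleField

theorem mainTheorem3 {Ω : Type*} [mΩ : MeasurableSpace Ω] [AddAction (ℤ × ℤ) Ω]
    [MeasurableConstVAdd (ℤ × ℤ) Ω] (μ : Measure Ω) [IsProbabilityMeasure μ]
    [ErgodicVAdd (ℤ × ℤ) Ω μ]
    (F : ℤ → ℤ → MeasurableSpace Ω)
    (hF : MartingaleField.IsCompletelyCommutingInvariant μ F)
    (hF_top : ∀ A : Set Ω, MeasurableSet A →
      ∃ B : Set Ω, MeasurableSet[MartingaleField.totalLimit F] B ∧ A =ᵐ[μ] B)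
    (f : Ω → ℝ)
    (hf : MartingaleField.IsMartingaleDifference μ F f)
    (hf_orth : MartingaleField.OrthogonalTo μ MartingaleField.prodFactor f)
    (hf_four : MemLp f 4 μ)
    (hf_tail : Tendsto
      (fun ℓ : ℕ =>
        eLpNorm (μ[f | MartingaleField.rowLimit F (-(ℓ : ℤ)) ⊔ MartingaleField.inv₁]) 2 μ)
      atTop (𝓝 0)) :
    TendstoInDistribution
      (fun (p : ℕ × ℕ) (ω : Ω) => MartingaleField.normalizedSum f p.1 p.2 ω)
      (comap (fun p : ℕ × ℕ => min p.1 p.2) atTop)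
      (id : ℝ → ℝ)
      (fun _ => μ)
      (gaussianReal 0 (∫ ω, f ω ^ 2 ∂μ).toNNReal) := by
  have hv0 : 0 ≤ ∫ ω, f ω ^ 2 ∂μ := integral_nonneg fun ω => sq_nonneg _
  refine ⟨fun p => (MartingaleField.memLp_normalizedSum hf_four p.1 p.2).1.aemeasurable,
    aemeasurable_id, tendsto_of_seq_tendsto fun p hp =>
      ProbabilityMeasure.tendsto_iff_tendsto_charFun.2 fun t => ?_⟩
  have hp' : Tendsto (fun k => min (p k).1 (p k).2) atTop atTop := tendsto_comap_iff.1 hp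
  have e : charFun ((gaussianReal 0 (∫ ω, f ω ^ 2 ∂μ).toNNReal).map id) t
      = Complex.exp ((-(t ^ 2 * (∫ ω, f ω ^ 2 ∂μ) / 2) : ℝ)) := by
    rw [Measure.map_id, charFun_gaussianReal, Real.coe_toNNReal _ hv0]
    congr 1
    push_cast
    ring
  change Tendsto (fun k => charFun (μ.map (MartingaleField.normalizedSum f (p k).1 (p k).2)) t) atTop
    (𝓝 (charFun ((gaussianReal 0 (∫ ω, f ω ^ 2 ∂μ).toNNReal).map id) t))
  rw [e, Metric.tendsto_atTop]
  intro ε hε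
  obtain ⟨M, hM⟩ := MartingaleField.exists_forall_norm_charFun_sub_le hF hf hf_four hf_tail t
    (show 0 < ε / 2 by positivity)
  obtain ⟨N, hN⟩ := eventually_atTop.1 (hp'.eventually_ge_atTop M)
  refine ⟨N, fun k hk => ?_⟩
  rw [dist_eq_norm]
  have hk' := hN k hk
  exact (hM _ _ (hk'.trans (min_le_left _ _)) (hk'.trans (min_le_right _ _))).trans_lt
    (by linarith)
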